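/- Let $m,L,l>0$, $d\ge 1$, and let $u:\mathbb R^d\to\mathbb R$ be differentiable with gradient $h=\nabla u$ such that, for all $x,y\in\mathbb R^d$, $$\langle h(x)-h(y),x-y\rangle\ge 2m|x-y|^2,\qquad |h(x)-h(y)|\le L(1+|x|+|y|)^l|x-y| .$$ Let $\pi\propto e^{-u(x)}dx$ on $\mathbb R^d$ and $\Pi\propto e^{-u(x)-|v|^2/2}dx\,dv$ on $\mathbb R^{2d}$ be the probability measures with these densities, and let $W_2$ be the 2-Wasserstein distance for the Euclidean distance. For $\lambda>0$ put $g(x)=h(x)-mx$, $r_\lambda=(L+m)\lambda^{-1/(2(l+2))}$, $R_\lambda=\sup_{|x|<r_\lambda}|g(x)|$, and define the tamed drift $$h_\lambda(x)=t(x)g(x)+R_\lambda s(x)x+mx,$$ where $t(x)=1$ if $|x|\le r_\lambda-1$, $t(x)=r_\lambda-|x|$ if $r_\lambda-1<|x|<r_\lambda$, $t(x)=0$ if $|x|\ge r_\lambda$; and $s(x)=0$ if $|x|\le r_\lambda-2$, $s(x)=|x|-r_\lambda+2$ if $r_\lambda-2<|x|<r_\lambda-1$, $s(x)=1$ if $r_\lambda-1\le|x|\le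 r_\lambda$, $s(x)=r_\lambda/|x|$ if $|x|>r_\lambda$. Let $M_\lambda$ be the (best) Lipschitz constant of $h_\lambda$. For a friction $\gamma>0$ and $\tilde\eta=e^{-\lambda\gamma/2}$, the tamed OBABO scheme is the Markov chain $(x_n,v_n)$ on $\mathbb R^{2d}$ whose transition $(x_0,v_0)\mapsto(x_1,v_1)$ is $$v_0'=\tilde\eta v_0+\sqrt{1-\tilde\eta^2}\,G,\quad v_{1/2}=v_0'-\tfrac\lambda2h_\lambda(x_0),\quad x_1=x_0+\lambda v_{1/2},\quad v_1'=v_{1/2}-\tfrac\lambda2h_\lambda(x_1),\quad v_1=\tilde\eta v_1'+\sqrt{1-\tilde\eta^2}\,G',$$ with $G,G'$ independent standard Gaussian vectors in $\mathbb R^d$, independent of the current state. The initial law $\mathcal L(x_0,v_0)$ is assumed to have finite moments of all orders. Call $(\lambda,\gamma)$ admissible if $\lambda>0$, $r_\lambda\ge2$, $M_\lambda\ge1$, $\gamma\ge2\sqrt{M_\lambda}$ and $\lambda\le m/(33\gamma^3)$. (i) For every $H\ge0$ there are $K>0$ and $p\in\mathbb N$, depending only on $m,L,l,H$, such that for all $d\ge1$,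 all $u$ as above with $|\nabla u(0)|\le H$, all initial laws as above, all admissible $(\lambda,\gamma)$ and all $n\in\mathbb N$, $$W_2(\mathcal L(x_n),\pi)\le W_2(\mathcal L(x_n,v_n),\Pi)\le 3\sqrt{M_\lambda}\Bigl(1-\frac{m}{3\gamma}\lambda\Bigr)^{n/2}W_2(\mathcal L(x_0,v_0),\Pi)+C'M_\lambda\frac{\lambda\gamma}{m},\qquad C'=K d^{\,p}.$$ (ii) Accuracy $\varepsilon$ is reached in $O(\varepsilon^{-2.5}\log(1/\varepsilon))$ iterations: for every $d\ge 1$, every $u$ and every initial law as above there is $A>0$ such that for every $\varepsilon\in(0,1/2]$ there is an admissible $(\lambda,\gamma)$ with $W_2(\mathcal L(x_n,v_n),\Pi)\le\varepsilon$ for all $n\ge A\,\varepsilon^{-2.5}\log(1/\varepsilon)$. -/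

import Mathlib

open MeasureTheory ProbabilityTheory
open scoped ENNReal NNReal Gradient

noncomputable section

namespace TamedOBABO

/-- Euclidean space of dimension `d`. -/
abbrev E (d : ℕ) : Type := EuclideanSpace ℝ (Fin d)

/-- Positions and velocities `(x, v)`. The Euclidean distance on this space enters through
`phaseSqDist`; the (sup) norm of the product type is never used. -/
abbrev Phase (d : ℕ) : Type := E d × E d

/-! ### The 2-Wasserstein distance -/

/-- `ρ` is a coupling of `μ` and `ν`. -/
def IsCoupling {X : Type*} [MeasurableSpace X] (ρ : Measure (X × X)) (μ ν : Measure X) : Prop :=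
  ρ.map Prod.fst = μ ∧ ρ.map Prod.snd = ν

/-- The 2-Wasserstein distance, with values in `[0, ∞]`, for the distance whose square is `sq`. -/
def W2 {X : Type*} [MeasurableSpace X] (sq : X → X → ℝ) (μ ν : Measure X) : ℝ≥0∞ :=
  (⨅ (ρ : Measure (X × X)) (_ : IsCoupling ρ μ ν),
    ∫⁻ p, ENNReal.ofReal (sq p.1 p.2) ∂ρ) ^ (1 / 2 : ℝ)

/-- Squared Euclidean distance of positions. -/
def posSqDist {d : ℕ} (x y : E d) : ℝ := ‖x - y‖ ^ 2

/-- Squared Euclidean distance on `ℝ^d × ℝ^d`. -/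
def phaseSqDist {d : ℕ} (z w : Phase d) : ℝ := ‖z.1 - w.1‖ ^ 2 + ‖z.2 - w.2‖ ^ 2

/-! ### The potential and the target measures -/

/-- Strong convexity with constant `2 m`, and local Lipschitz continuity of the gradient with
polynomial growth of the Lipschitz constant. -/
structure PotentialAssumptions {d : ℕ} (m L l : ℝ) (u : E d → ℝ) : Prop where
  differentiable : Differentiable ℝ u
  strongly_monotone : ∀ x y : E d, 2 * m * ‖x - y‖ ^ 2 ≤ inner ℝ (∇ u x - ∇ u y) (x - y)
  locally_lipschitz : ∀ x y : E d,
    ‖∇ u x - ∇ u y‖ ≤ L * (1 + ‖x‖ + ‖y‖) ^ l * ‖x - y‖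

/-- The probability measure with density proportional to `exp (-V)`. -/
def gibbs {X : Type*} [MeasureSpace X] (V : X → ℝ) : Measure X :=
  (∫⁻ x, ENNReal.ofReal (Real.exp (-V x)))⁻¹ •
    (volume : Measure X).withDensity fun x => ENNReal.ofReal (Real.exp (-V x))

/-- The target `π ∝ exp (-u)` on positions. -/
def targetPos {d : ℕ} (u : E d → ℝ) : Measure (E d) := gibbs u

/-- The extended target `Π ∝ exp (-(|v|² / 2 + u x))`. -/
def targetPhase {d : ℕ} (u : E d → ℝ) : Measure (Phase d) :=
  gibbs fun z : Phase d => ‖z.2‖ ^ 2 / 2 + u z.1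

/-- Finite moments of all even orders of the initial position and velocity. -/
def AllMoments {d : ℕ} (μ : Measure (Phase d)) : Prop :=
  ∀ k : ℕ, Integrable (fun z : Phase d => ‖z.1‖ ^ (2 * k)) μ ∧
    Integrable (fun z : Phase d => ‖z.2‖ ^ (2 * k)) μ

/-! ### The tamed drift -/

/-- The truncation radius `r_λ = (L + m) (1 / √λ) ^ (1 / (l + 2))`. -/
def radius (m L l lam : ℝ) : ℝ := (L + m) * (1 / √lam) ^ (1 / (l + 2))

/-- `g (x) = ∇ u (x) - m x`. -/
def gDrift {d : ℕ} (m : ℝ) (u : E d → ℝ) (x : E d) : E d := ∇ u x - m • x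

/-- The supremum of `|g|` over the ball of radius `r` around the origin. -/
def gSup {d : ℕ} (m : ℝ) (u : E d → ℝ) (r : ℝ) : ℝ :=
  sSup ((fun x : E d => ‖gDrift m u x‖) '' Metric.ball 0 r)

/-- The cut-off `t`, as a function of `ρ = |x|`. -/
def cutT (r ρ : ℝ) : ℝ :=
  if ρ ≤ r - 1 then 1 else if ρ < r then r - ρ else 0

/-- The cut-off `s`, as a function of `ρ = |x|`. -/
def cutS (r ρ : ℝ) : ℝ :=
  if ρ ≤ r - 2 then 0 else if ρ < r - 1 then ρ - r + 2 else if ρ ≤ r then 1 else r / ρ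

/-- The tamed drift `h_λ (x) = t (x) g (x) + R_λ s (x) x + m x`. -/
def tamedDrift {d : ℕ} (m L l : ℝ) (u : E d → ℝ) (lam : ℝ) (x : E d) : E d :=
  let r := radius m L l lam
  cutT r ‖x‖ • gDrift m u x + (gSup m u r * cutS r ‖x‖) • x + m • x

/-- The (best) Lipschitz constant of a map. -/
def lipConst {d : ℕ} (f : E d → E d) : ℝ := ((sInf {K : ℝ≥0 | LipschitzWith K f} : ℝ≥0) : ℝ)

/-- The Lipschitz constant `M_λ` of the tamed drift. -/
def tamedLip {d : ℕ} (m L l : ℝ) (u : E d → ℝ) (lam : ℝ) : ℝ :=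
  lipConst (tamedDrift m L l u lam)

/-! ### The OBABO scheme -/

/-- Partial velocity refreshment, with `η = exp (-λγ/2)` and a Gaussian input `g`. -/
def stepO {d : ℕ} (lam γ : ℝ) (z : Phase d) (g : E d) : Phase d :=
  (z.1, Real.exp (-(lam * γ) / 2) • z.2 + √(1 - Real.exp (-(lam * γ) / 2) ^ 2) • g)

/-- Velocity update by half a step of the drift `b`. -/
def stepB {d : ℕ} (b : E d → E d) (lam : ℝ) (z : Phase d) : Phase d :=
  (z.1, z.2 - (lam / 2) • b z.1)

/-- Position update by a full step. -/
def stepA {d : ℕ} (lam : ℝ) (z : Phase d) : Phase d := (z.1 + lam • z.2, z.2)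

/-- One transition of the OBABO chain with drift `b` and Gaussian inputs `g`, `g'`. -/
def obaboStep {d : ℕ} (b : E d → E d) (lam γ : ℝ) (z : Phase d) (g g' : E d) : Phase d :=
  stepO lam γ (stepB b lam (stepA lam (stepB b lam (stepO lam γ z g)))) g'

/-- The law of the `n`-th iterate `(x_n, v_n)` of the OBABO chain started from `μ₀`: at every
step the two inputs are standard Gaussian, independent of each other and of the current state. -/
def obaboLaw {d : ℕ} (b : E d → E d) (lam γ : ℝ) (μ₀ : Measure (Phase d)) :
    ℕ → Measure (Phase d)
  | 0 => μ₀
  | n + 1 =>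
    ((obaboLaw b lam γ μ₀ n).prod ((stdGaussian (E d)).prod (stdGaussian (E d)))).map
      fun q => obaboStep b lam γ q.1 q.2.1 q.2.2

/-- The law of the `n`-th iterate of the tamed OBABO scheme for the potential `u`. -/
def tamedLaw {d : ℕ} (m L l : ℝ) (u : E d → ℝ) (lam γ : ℝ) (μ₀ : Measure (Phase d)) (n : ℕ) :
    Measure (Phase d) :=
  obaboLaw (tamedDrift m L l u lam) lam γ μ₀ n

/-- Admissible step sizes and friction coefficients. -/
structure Admissible {d : ℕ} (m L l : ℝ) (u : E d → ℝ) (lam γ : ℝ) : Prop where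
  lam_pos : 0 < lam
  radius_ge : 2 ≤ radius m L l lam
  lip_ge : 1 ≤ tamedLip m L l u lam
  friction_ge : 2 * √(tamedLip m L l u lam) ≤ γ
  lam_le : lam ≤ m / (33 * γ ^ 3)

end TamedOBABO

end

open MeasureTheory ProbabilityTheory
open scoped ENNReal NNReal Gradient

noncomputable section

namespace TamedOBABO

/-! The scheme is compared with an exact counterpart. Replacing the Verlet step by the Hamiltonian
flow for time `lam` gives a transition O–flow–O that leaves the extended target invariant. Both
transitions are driven by the same Gaussian inputs, the second one from the target. The difference
after one step is the sum of two terms: two numerical steps from different points, which contract,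
and a numerical step minus the flow from a point distributed as the target, which is a local error.
Since that error is only averaged over the target, no moments of the numerical chain enter.

Contraction holds for the twisted form |z|² + 2β⟨z,w⟩ + 2/(3M)|w|² (`twistForm_contraction`),
provided the drift is m-strongly monotone and 2M-cocoercive. The tamed drift is not a gradient in
general, so the Baillon–Haddad theorem does not apply to it directly. Away from three spheres, its
increments near a point p are t(p) times those of g, plus a cocoercive remainder, plus the linear
part. The field g is the gradient of a convex function, to which a local Baillon–Haddad theorem
applies. Cocoercivity is additive, which allows summing these parts and gluing along segments
(`tameField_cocoercive`). The lower bound R r + 2m ≤ M (`le_lipschitz_tamed`) keeps the total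
constant at 2M.

The local error is O(λ²) with a polynomial weight free of the dimension (`exists_local_error`).
Taming is active only for |x| > r - 2, where r^(l+2) is of order λ^(-1/2), so extra powers of |x|
pay for a factor λ. The weight is integrated with `exists_moment_bound`, polynomial in d. Invariance
of the target under the flow (`exists_hamiltonian_flow`) follows from conservation of energy and of
volume, the latter by approximation with compositions of shears.

Summing local errors λ² at contraction rate mλ/(3γ) gives λγ/m, and returning to the Euclidean
distance costs √M. Hence `exists_W2_phase_le` has the error √M λγ/m, sharper than the factor M in
(i), and (ii) rests on this sharper form: with γ = 2√M and M = O(λ^(-1/2)) the error is O(√λ), so λ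
is of order ε² and γ/λ = O(ε^(-5/2)) steps suffice up to a logarithm. -/

open Set Filter Topology

/-! ### Contraction of one step in the twisted norm -/

section Contraction

variable {V : Type*} [NormedAddCommGroup V] [InnerProductSpace ℝ V]

/-- The quadratic form `|z|² + 2 β ⟪z, w⟫ + A |w|²`. -/
def twistForm (β A : ℝ) (z w : V) : ℝ := ‖z‖ ^ 2 + 2 * β * inner ℝ z w + A * ‖w‖ ^ 2

/-- The relation `hβ` is chosen so that the coefficient of ⟨z, w⟩ is the same before and after the
step: the transport contribution h e makes up for the damping of β by e². No indefinite ⟨z, w⟩ term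
is then left to estimate. The force D₁ is paired with the new position z₁, where its monotonicity
and cocoercivity are available. -/
lemma twistForm_step_eq (β A h e : ℝ) (hβ : β * (1 - e ^ 2) = h * e) (z w D₀ D₁ z₁ w₁ : V)
    (hz : z₁ = z + (h * e) • w - (h ^ 2 / 2) • D₀)
    (hw : w₁ = e ^ 2 • w - (e * h / 2) • (D₀ + D₁)) :
    twistForm β A z₁ w₁ = ‖z‖ ^ 2 + 2 * β * inner ℝ z w +
      (h ^ 2 * e ^ 2 + 2 * β * h * e ^ 3 + A * e ^ 4) * ‖w‖ ^ 2
      - (h ^ 2 + β * h * e) * inner ℝ D₀ z - β * h * e * inner ℝ D₁ z₁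
      - (A * h * e ^ 3 + h ^ 3 * e + 2 * β * h ^ 2 * e ^ 2) * inner ℝ w D₀
      - A * h * e ^ 3 * inner ℝ w D₁
      + (h ^ 4 / 4 + β * h ^ 3 * e / 2) * ‖D₀‖ ^ 2
      + (A * h ^ 2 * e ^ 2 / 4) * (‖D₀‖ ^ 2 + 2 * inner ℝ D₀ D₁ + ‖D₁‖ ^ 2) := by
  subst hz hw
  simp only [twistForm, ← real_inner_self_eq_norm_sq, inner_add_left, inner_add_right,
    inner_sub_left, inner_sub_right, real_inner_smul_left, real_inner_smul_right]
  simp only [real_inner_comm z w, real_inner_comm z D₀, real_inner_comm z D₁,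
    real_inner_comm w D₀, real_inner_comm w D₁, real_inner_comm D₀ D₁]
  linear_combination (- 2 * inner ℝ z w) * hβ

lemma abs_two_inner_le (x y : V) : |2 * inner ℝ x y| ≤ ‖x‖ ^ 2 + ‖y‖ ^ 2 := by
  have h1 := norm_add_sq_real x y
  have h2 := norm_sub_sq_real x y
  rw [abs_le]; constructor <;> nlinarith [sq_nonneg ‖x + y‖, sq_nonneg ‖x - y‖]

set_option maxHeartbeats 1000000 in
/-- Scalar part of the contraction estimate. -/
lemma twistForm_scalar_bound {h k μ A β e Z W S p q d₀ d₁ a₀ a₁ c Z₁ : ℝ}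
    (hh : 0 < h) (hk0 : 0 < k) (hk : k ≤ 1 / 4) (hμ0 : 0 < μ) (hμ : μ ≤ k / 2)
    (hhμ : h ≤ μ / 33) (hA : A * k = 2 / 3)
    (he1 : e ≤ 1) (he : 1 - h / 2 ≤ e) (he4 : e ^ 4 ≤ 1 - 2 * h + 4 * h ^ 2)
    (hβ1 : β ≤ 1) (hβ : 1 - h / 2 ≤ β)
    (hZ : 0 ≤ Z) (hW : 0 ≤ W) (hd₀ : 0 ≤ d₀) (hd₁ : 0 ≤ d₁) (hp : d₀ ≤ 2 * k * p)
    (hq : d₁ ≤ 2 * k * q) (hpZ : μ * Z ≤ p) (hqZ : μ * Z₁ ≤ q)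
    (hZ₁ : 9 / 10 * Z - 9 * (2 * h ^ 2 * W + h ^ 4 / 2 * d₀) ≤ Z₁)
    (hZ₁0 : 0 ≤ Z₁)
    (hS : |2 * S| ≤ Z / 2 + 2 * W) (ha₀ : |2 * a₀| ≤ W + d₀) (ha₁ : |2 * a₁| ≤ W + d₁)
    (hc : |2 * c| ≤ d₀ + d₁) :
    Z + 2 * β * S + (h ^ 2 * e ^ 2 + 2 * β * h * e ^ 3 + A * e ^ 4) * W
      - (h ^ 2 + β * h * e) * p - β * h * e * q
      - (A * h * e ^ 3 + h ^ 3 * e + 2 * β * h ^ 2 * e ^ 2) * a₀ - A * h * e ^ 3 * a₁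
      + (h ^ 4 / 4 + β * h ^ 3 * e / 2) * d₀
      + (A * h ^ 2 * e ^ 2 / 4) * (d₀ + 2 * c + d₁)
    ≤ (1 - μ * h / 3) * (Z + 2 * β * S + A * W) := by
  -- In the application Z = ‖z‖², Z₁ = ‖z₁‖², W = ‖w‖², S = ⟨z,w⟩, p = ⟨D₀,z⟩, q = ⟨D₁,z₁⟩, dᵢ =
  -- ‖Dᵢ‖², aᵢ = ⟨w,Dᵢ⟩ and c = ⟨D₀,D₁⟩.
  have hh1 : h ≤ 1 / 264 := by linarith
  have e0 : 0 < e := by linarith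
  have β0 : 0 < β := by linarith
  have A0 : 0 < A := pos_of_mul_pos_left (by linarith only [hA]) hk0.le
  have hA83 : 8 / 3 ≤ A := by
    linarith only [hA, mul_le_mul_of_nonneg_left hk A0.le]
  have p0 : 0 ≤ p := by
    linarith only [mul_nonneg hμ0.le hZ, hpZ]
  have q0 : 0 ≤ q := by
    linarith only [mul_nonneg hμ0.le hZ₁0, hqZ]
  have βe : 1 - h ≤ β * e := by
    have := mul_le_mul hβ he (by linarith only [hh1]) β0.le
    linarith only [this, sq_nonneg h]
  have βe1 : β * e ≤ 1 := mul_le_one₀ hβ1 e0.le he1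
  have e2 : e ^ 2 ≤ 1 := pow_le_one₀ e0.le he1
  have e3 : e ^ 3 ≤ 1 := pow_le_one₀ e0.le he1
  -- This fixes A = 2/(3k). To first order the terms in ⟨w, Dᵢ⟩ cost h A W + h A (d₀ + d₁)/2, at
  -- most h A W + (2/3) h (p + q). Of the gain h (p + q) a third remains to contract Z, and of the
  -- damping 2 h A W one half remains to contract W.
  have hAd₀ : A * d₀ ≤ 4 / 3 * p := by
    linear_combination mul_le_mul_of_nonneg_left hp A0.le + 2 * p * hA
  have hAd₁ : A * d₁ ≤ 4 / 3 * q := by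
    linear_combination mul_le_mul_of_nonneg_left hq A0.le + 2 * q * hA
  have d₀p : d₀ ≤ p / 2 := by linarith only [hp, mul_le_mul_of_nonneg_right hk p0]
  have T1 : h * (1 - h) * p ≤ (h ^ 2 + β * h * e) * p := by
    apply mul_le_mul_of_nonneg_right _ p0
    linarith only [sq_nonneg h, mul_le_mul_of_nonneg_left βe hh.le]
  have T2 : h * (1 - h) * q ≤ β * h * e * q := by
    apply mul_le_mul_of_nonneg_right _ q0
    linarith only [mul_le_mul_of_nonneg_left βe hh.le]
  have aux : ∀ {t s a b : ℝ}, 0 ≤ t → t ≤ s → |2 * a| ≤ b → - (t * a) ≤ s * (b / 2) := by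
    intro t s a b ht hts hab
    have h1 := (abs_le.1 hab).1
    have b0 : 0 ≤ b := (abs_nonneg _).trans hab
    have h2 : t * (-a) ≤ t * (b / 2) := mul_le_mul_of_nonneg_left (by linarith) ht
    have h3 : t * (b / 2) ≤ s * (b / 2) := mul_le_mul_of_nonneg_right hts (by linarith)
    linarith
  have c1 : A * h * e ^ 3 ≤ A * h := by
    simpa using mul_le_mul_of_nonneg_left e3 (mul_pos A0 hh).le
  have T3 := aux (by positivity) c1 ha₀
  have T4 := aux (by positivity) c1 ha₁
  have c2 : h ^ 3 * e + 2 * β * h ^ 2 * e ^ 2 ≤ 3 * h ^ 2 := by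
    have s1 : h ^ 3 * e ≤ h ^ 2 := by
      have : h * e ≤ 1 := mul_le_one₀ (by linarith only [hh1]) e0.le he1
      linarith only [mul_le_mul_of_nonneg_left this (sq_nonneg h)]
    have s2 : 2 * β * h ^ 2 * e ^ 2 ≤ 2 * h ^ 2 := by
      have : β * e ^ 2 ≤ 1 := mul_le_one₀ hβ1 (by positivity) e2
      linarith only [mul_le_mul_of_nonneg_left this (sq_nonneg h)]
    linarith
  have T5 := aux (by positivity) c2 ha₀
  have T6 : (h ^ 4 / 4 + β * h ^ 3 * e / 2) * d₀ ≤ h ^ 3 * d₀ := by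
    apply mul_le_mul_of_nonneg_right _ hd₀
    have s1 : h ^ 4 ≤ h ^ 3 := by
      have : h ^ 3 * h ≤ h ^ 3 * 1 := mul_le_mul_of_nonneg_left (by linarith only [hh1]) (by positivity)
      linarith only [this]
    have s2 : h ^ 3 * (β * e) ≤ h ^ 3 * 1 := mul_le_mul_of_nonneg_left βe1 (by positivity)
    have : 0 ≤ h ^ 3 := by positivity
    linarith only [this, s1, s2]
  have T7 : (A * h ^ 2 * e ^ 2 / 4) * (d₀ + 2 * c + d₁) ≤ 2 / 3 * h ^ 2 * (p + q) := by
    have h1 := (abs_le.1 hc).2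
    have s0 : (A * h ^ 2 * e ^ 2 / 4) * (d₀ + 2 * c + d₁)
        ≤ (A * h ^ 2 * e ^ 2 / 4) * (2 * (d₀ + d₁)) :=
      mul_le_mul_of_nonneg_left (by linarith) (by positivity)
    have s1 : (A * h ^ 2 * e ^ 2 / 4) * (2 * (d₀ + d₁)) = (h ^ 2 / 2 * (A * d₀ + A * d₁)) * e ^ 2 := by
      ring
    have s2 : (h ^ 2 / 2 * (A * d₀ + A * d₁)) * e ^ 2 ≤ (h ^ 2 / 2 * (A * d₀ + A * d₁)) * 1 :=
      mul_le_mul_of_nonneg_left e2 (by positivity)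
    have s3 : h ^ 2 / 2 * (A * d₀ + A * d₁) ≤ h ^ 2 / 2 * (4 / 3 * p + 4 / 3 * q) :=
      mul_le_mul_of_nonneg_left (by linarith) (by positivity)
    linarith only [s0, s1, s2, s3]
  have T8 : (h ^ 2 * e ^ 2 + 2 * β * h * e ^ 3 + A * e ^ 4) * W
      ≤ (h ^ 2 + 2 * h + A * (1 - 2 * h + 4 * h ^ 2)) * W := by
    apply mul_le_mul_of_nonneg_right _ hW
    have s1 : h ^ 2 * e ^ 2 ≤ h ^ 2 * 1 := mul_le_mul_of_nonneg_left e2 (by positivity)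
    have s2 : 2 * h * (β * e ^ 3) ≤ 2 * h * 1 :=
      mul_le_mul_of_nonneg_left (mul_le_one₀ hβ1 (by positivity) e3) (by positivity)
    have s3 := mul_le_mul_of_nonneg_left he4 A0.le
    linarith only [s1, s2, s3]
  have T9 : μ * h / 3 * (Z + 2 * β * S + A * W) ≤ μ * h / 3 * (3 / 2 * Z + 2 * W + A * W) := by
    apply mul_le_mul_of_nonneg_left _ (by positivity)
    have h1 := aux (a := -S) (s := 1) β0.le hβ1 (b := Z / 2 + 2 * W) (by rwa [mul_neg, abs_neg])
    linarith only [h1]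
  -- lower bound of `q` by `Z`
  have hq' : μ * (9 / 10 * Z) - 9 * μ * (2 * h ^ 2 * W + h ^ 4 / 2 * d₀) ≤ q := by
    linarith only [mul_le_mul_of_nonneg_left hZ₁ hμ0.le, hqZ]
  have hμ8 : μ ≤ 1 / 8 := by linarith
  have hhp : 0 ≤ h * p := by positivity
  have hhq : 0 ≤ h * q := by positivity
  have hhW : 0 ≤ h * W := by positivity
  have hAW : 8 / 3 * (h * W) ≤ A * (h * W) := mul_le_mul_of_nonneg_right hA83 hhW
  have sm : ∀ {y : ℝ}, 0 ≤ h * y → h ^ 2 * y ≤ 1 / 264 * (h * y) := by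
    intro y hy; linarith only [mul_le_mul_of_nonneg_right hh1 hy]
  have P2 := sm hhp
  have Q2 := sm hhq
  have W2 := sm hhW
  have AW2 : h ^ 2 * (A * W) ≤ 1 / 264 * (h * (A * W)) := sm (by positivity)
  have P3 : h ^ 3 * d₀ ≤ h ^ 2 * p := by
    have : h ^ 3 ≤ h ^ 2 := by
      linarith only [mul_le_mul_of_nonneg_left hh1 (sq_nonneg h), sq_nonneg h]
    calc h ^ 3 * d₀ ≤ h ^ 2 * d₀ := mul_le_mul_of_nonneg_right this hd₀
      _ ≤ h ^ 2 * p := mul_le_mul_of_nonneg_left (by linarith) (by positivity)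
  have hd2 : h ^ 2 * d₀ ≤ h ^ 2 * p := mul_le_mul_of_nonneg_left (by linarith) (by positivity)
  have hhd : h * (A * d₀) ≤ h * (4 / 3 * p) := mul_le_mul_of_nonneg_left hAd₀ hh.le
  have hhd' : h * (A * d₁) ≤ h * (4 / 3 * q) := mul_le_mul_of_nonneg_left hAd₁ hh.le
  -- weighted lower bounds
  have L1 : h * (μ * Z) ≤ h * p := mul_le_mul_of_nonneg_left hpZ hh.le
  have L2 := mul_le_mul_of_nonneg_left hq' hh.le
  have hμZ : 0 ≤ h * (μ * Z) := by positivity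
  have L3 : 9 * μ * (2 * h ^ 2 * W + h ^ 4 / 2 * d₀) ≤ h ^ 2 * W * 9 / 4 + h ^ 2 * p := by
    have i0 : h ^ 4 ≤ h ^ 2 := by
      have : h ^ 2 ≤ 1 := pow_le_one₀ hh.le (by linarith only [hh1])
      linarith only [mul_le_mul_of_nonneg_left this (sq_nonneg h)]
    have i1 : h ^ 4 / 2 * d₀ ≤ h ^ 2 / 2 * p := by
      have := mul_le_mul i0 d₀p hd₀ (by positivity)
      linarith only [this, mul_nonneg (sq_nonneg h) p0]
    have i2 : 9 * μ * (2 * h ^ 2 * W + h ^ 4 / 2 * d₀) ≤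
        9 / 8 * (2 * h ^ 2 * W + h ^ 4 / 2 * d₀) :=
      mul_le_mul_of_nonneg_right (by linarith) (by positivity)
    have : 0 ≤ h ^ 2 * p := by positivity
    linarith only [i1, i2, this]
  have L4 := mul_le_mul_of_nonneg_left L3 hh.le
  have L5 : h * (h ^ 2 * W * 9 / 4 + h ^ 2 * p) ≤ 1 / 264 * (h * W * 9 / 4 + h * p) := by
    have i1 : h * (h ^ 2 * W) ≤ 1 * (h ^ 2 * W) :=
      mul_le_mul_of_nonneg_right (by linarith) (by positivity)
    have i2 : h * (h ^ 2 * p) ≤ 1 * (h ^ 2 * p) :=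
      mul_le_mul_of_nonneg_right (by linarith) (by positivity)
    linarith only [i1, i2, P2, W2]
  have R1 : μ * h / 3 * (2 * W + A * W) ≤ 1 / 24 * (2 * (h * W) + A * (h * W)) := by
    have : μ * (2 * (h * W) + A * (h * W)) ≤ 1 / 8 * (2 * (h * W) + A * (h * W)) :=
      mul_le_mul_of_nonneg_right hμ8 (by positivity)
    linarith only [this]
  linarith only [T1, T2, T3, T4, T5, T6, T7, T8, T9, P2, Q2, W2, AW2, P3, hd2, hhd, hhd', L1, L2,
    L4, L5, R1, hμZ, hhp, hhq, hhW, hAW]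


/-- The coefficient of the cross term of the twisted norm (in units where the friction is `1`). -/
def twistCoeff (h : ℝ) : ℝ := h * Real.exp (-h / 2) / (1 - Real.exp (-h / 2) ^ 2)

lemma one_sub_exp_sq_pos {h : ℝ} (hh : 0 < h) : 0 < 1 - Real.exp (-h / 2) ^ 2 := by
  have h1 : Real.exp (-h / 2) < 1 := Real.exp_lt_one_iff.2 (by linarith)
  nlinarith [Real.exp_pos (-h / 2)]

/-- The coefficient equals (h/2)/sinh(h/2), and x ≤ sinh x for x ≥ 0. -/
lemma twistCoeff_le_one {h : ℝ} (hh : 0 < h) : twistCoeff h ≤ 1 := by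
  rw [twistCoeff, div_le_one (one_sub_exp_sq_pos hh)]
  have h1 := Real.self_le_sinh_iff.2 (by linarith : (0 : ℝ) ≤ h / 2)
  rw [Real.sinh_eq] at h1
  have h2 : Real.exp (h / 2) * Real.exp (-h / 2) = 1 := by
    rw [← Real.exp_add, ← Real.exp_zero]; ring_nf
  rw [neg_div'] at h1
  have h3 := mul_le_mul_of_nonneg_right h1 (Real.exp_pos (-h / 2)).le
  nlinarith

lemma le_twistCoeff {h : ℝ} (hh : 0 < h) : 1 - h / 2 ≤ twistCoeff h := by
  rw [twistCoeff, le_div_iff₀ (one_sub_exp_sq_pos hh)]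
  have h1 := Real.add_one_le_exp (-h / 2)
  have h2 : Real.exp (-h / 2) ^ 2 = Real.exp (-h) := by rw [← Real.exp_nat_mul]; ring_nf
  have h3 := Real.add_one_le_exp (-h)
  have h4 := one_sub_exp_sq_pos hh
  calc (1 - h / 2) * (1 - Real.exp (-h / 2) ^ 2)
      ≤ Real.exp (-h / 2) * (1 - Real.exp (-h / 2) ^ 2) :=
        mul_le_mul_of_nonneg_right (by linarith) h4.le
    _ ≤ Real.exp (-h / 2) * h := mul_le_mul_of_nonneg_left (by linarith) (Real.exp_pos _).le
    _ = _ := mul_comm _ _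

/-- Contraction of the twisted norm for one synchronously coupled step, with unit friction. -/
lemma twistForm_contraction_unit {h k μ : ℝ} (hh : 0 < h) (hk0 : 0 < k) (hk : k ≤ 1 / 4)
    (hμ0 : 0 < μ) (hμ : μ ≤ k / 2) (hhμ : h ≤ μ / 33) {z w D₀ D₁ z₁ w₁ : V}
    (hz : z₁ = z + (h * Real.exp (-h / 2)) • w - (h ^ 2 / 2) • D₀)
    (hw : w₁ = Real.exp (-h / 2) ^ 2 • w - (Real.exp (-h / 2) * h / 2) • (D₀ + D₁))
    (hp : ‖D₀‖ ^ 2 ≤ 2 * k * inner ℝ D₀ z) (hq : ‖D₁‖ ^ 2 ≤ 2 * k * inner ℝ D₁ z₁)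
    (hpZ : μ * ‖z‖ ^ 2 ≤ inner ℝ D₀ z) (hqZ : μ * ‖z₁‖ ^ 2 ≤ inner ℝ D₁ z₁) :
    twistForm (twistCoeff h) (2 / (3 * k)) z₁ w₁ ≤
      (1 - μ * h / 3) * twistForm (twistCoeff h) (2 / (3 * k)) z w := by
  have hβ : twistCoeff h * (1 - Real.exp (-h / 2) ^ 2) = h * Real.exp (-h / 2) :=
    div_mul_cancel₀ _ (one_sub_exp_sq_pos hh).ne'
  have he1 : Real.exp (-h / 2) ≤ 1 := Real.exp_le_one_iff.2 (by linarith)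
  have he0 := Real.exp_pos (-h / 2)
  have he := Real.add_one_le_exp (-h / 2)
  have he4 : Real.exp (-h / 2) ^ 4 ≤ 1 - 2 * h + 4 * h ^ 2 := by
    have h2 : Real.exp (-h / 2) ^ 4 = Real.exp (-(2 * h)) := by
      rw [← Real.exp_nat_mul]; push_cast; ring_nf
    have h3 := (abs_le.1 (Real.abs_exp_sub_one_sub_id_le (x := -(2 * h))
      (by rw [abs_neg, abs_of_pos (by linarith)]; linarith))).2
    rw [h2]; linarith
  rw [twistForm_step_eq _ _ _ _ hβ z w D₀ D₁ z₁ w₁ hz hw]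
  generalize Real.exp (-h / 2) = e at *
  have hZ₁ : 9 / 10 * ‖z‖ ^ 2 - 9 * (2 * h ^ 2 * ‖w‖ ^ 2 + h ^ 4 / 2 * ‖D₀‖ ^ 2) ≤ ‖z₁‖ ^ 2 := by
    set y := z₁ - z with hy
    have h1 : ‖y‖ ^ 2 ≤ 2 * h ^ 2 * ‖w‖ ^ 2 + h ^ 4 / 2 * ‖D₀‖ ^ 2 := by
      have h2 : y = (h * e) • w + (-(h ^ 2 / 2)) • D₀ := by rw [hy, hz]; module
      have h3 := abs_two_inner_le ((h * e) • w) ((-(h ^ 2 / 2)) • D₀)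
      have h4 := norm_add_sq_real ((h * e) • w) ((-(h ^ 2 / 2)) • D₀)
      rw [← h2] at h4
      have h5 := (abs_le.1 h3).2
      rw [norm_smul, norm_smul, mul_pow, mul_pow, Real.norm_eq_abs, Real.norm_eq_abs, sq_abs,
        sq_abs] at h4 h5
      have h6 : e ^ 2 * (h ^ 2 * ‖w‖ ^ 2) ≤ 1 * (h ^ 2 * ‖w‖ ^ 2) :=
        mul_le_mul_of_nonneg_right (pow_le_one₀ he0.le he1) (by positivity)
      linarith only [h4, h5, h6]
    have h2 : z₁ = z + y := by rw [hy]; abel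
    have h3 := norm_add_sq_real z y
    -- Nonnegativity of ‖z + 10 y‖² gives ‖z + y‖² ≥ (9/10)‖z‖² - 9‖y‖², which transfers the decay
    -- obtained at z₁ back to z.
    have h4 := norm_add_sq_real z ((10 : ℝ) • y)
    rw [real_inner_smul_right, norm_smul, mul_pow] at h4
    norm_num at h4
    rw [h2]
    linarith only [h1, h3, h4, sq_nonneg ‖z + (10 : ℝ) • y‖]
  have hS : |2 * inner ℝ z w| ≤ ‖z‖ ^ 2 / 2 + 2 * ‖w‖ ^ 2 := by
    have h1 := norm_add_sq_real z ((2 : ℝ) • w)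
    have h2 := norm_sub_sq_real z ((2 : ℝ) • w)
    rw [real_inner_smul_right, norm_smul, mul_pow] at h1 h2
    norm_num at h1 h2
    rw [abs_le]
    constructor
    · linarith only [h1, sq_nonneg ‖z + (2 : ℝ) • w‖]
    · linarith only [h2, sq_nonneg ‖z - (2 : ℝ) • w‖]
  rw [twistForm]
  exact twistForm_scalar_bound hh hk0 hk hμ0 hμ hhμ (by field_simp) he1 (by linarith) he4
    (twistCoeff_le_one hh) (le_twistCoeff hh) (by positivity) (by positivity) (by positivity)
    (by positivity) hp hq hpZ hqZ hZ₁ (by positivity) hS (abs_two_inner_le _ _)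
    (abs_two_inner_le _ _) (abs_two_inner_le _ _)

/-- Contraction of the twisted norm for one synchronously coupled OBABO step, before the noise. -/
lemma twistForm_contraction {lam γ M m : ℝ} (hlam : 0 < lam) (hm : 0 < m) (hM : 2 * m ≤ M)
    (hγ0 : 0 < γ) (hγ : 4 * M ≤ γ ^ 2) (hlamγ : lam ≤ m / (33 * γ ^ 3)) {z w D₀ D₁ z₁ w₁ : V}
    (hz : z₁ = z + lam • (Real.exp (-(lam * γ) / 2) • w - (lam / 2) • D₀))
    (hw : w₁ = Real.exp (-(lam * γ) / 2) •
      (Real.exp (-(lam * γ) / 2) • w - (lam / 2) • D₀ - (lam / 2) • D₁))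
    (hp : ‖D₀‖ ^ 2 ≤ 2 * M * inner ℝ D₀ z) (hq : ‖D₁‖ ^ 2 ≤ 2 * M * inner ℝ D₁ z₁)
    (hpZ : m * ‖z‖ ^ 2 ≤ inner ℝ D₀ z) (hqZ : m * ‖z₁‖ ^ 2 ≤ inner ℝ D₁ z₁) :
    twistForm (twistCoeff (lam * γ) / γ) (2 / (3 * M)) z₁ w₁ ≤
      (1 - m / (3 * γ) * lam) * twistForm (twistCoeff (lam * γ) / γ) (2 / (3 * M)) z w := by
  have hM0 : 0 < M := by linarith
  have hγ2 : 0 < γ ^ 2 := by positivity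
  -- Rescaling velocities by 1/γ and forces by 1/γ² reduces to unit friction with h = λγ, k = M/γ²,
  -- μ = m/γ². The condition h ≤ μ/33 then reads λ ≤ m/(33γ³).
  have conv : ∀ x y : V, twistForm (twistCoeff (lam * γ) / γ) (2 / (3 * M)) x y =
      twistForm (twistCoeff (lam * γ)) (2 / (3 * (M / γ ^ 2))) x (γ⁻¹ • y) := by
    intro x y
    rw [twistForm, twistForm, real_inner_smul_right, norm_smul, mul_pow, norm_inv,
      Real.norm_eq_abs, inv_pow, sq_abs]
    field_simp
  have hrate : m / (3 * γ) * lam = m / γ ^ 2 * (lam * γ) / 3 := by field_simp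
  rw [conv, conv, hrate]
  have sq : ∀ D : V, ‖(γ ^ 2)⁻¹ • D‖ ^ 2 = (γ ^ 2)⁻¹ * ((γ ^ 2)⁻¹ * ‖D‖ ^ 2) := by
    intro D
    rw [norm_smul, mul_pow, Real.norm_of_nonneg (by positivity)]; ring
  refine twistForm_contraction_unit (D₀ := (γ ^ 2)⁻¹ • D₀) (D₁ := (γ ^ 2)⁻¹ • D₁) (by positivity)
    (by positivity) ?_ (by positivity) ?_ ?_ ?_ ?_ ?_ ?_ ?_ ?_
  · rw [div_le_iff₀ hγ2]; linarith
  · rw [div_right_comm]; gcongr; linarith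
  · rw [le_div_iff₀ (by positivity)] at hlamγ
    rw [le_div_iff₀ (by positivity), le_div_iff₀ (by positivity)]
    linarith
  · rw [hz]
    match_scalars <;> field_simp
  · rw [hw]
    match_scalars <;> field_simp
  · rw [sq, real_inner_smul_left]
    have := mul_le_mul_of_nonneg_left hp (by positivity : 0 ≤ (γ ^ 2)⁻¹ * (γ ^ 2)⁻¹)
    calc _ = (γ ^ 2)⁻¹ * (γ ^ 2)⁻¹ * ‖D₀‖ ^ 2 := by ring
      _ ≤ _ := this
      _ = _ := by ring
  · rw [sq, real_inner_smul_left]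
    have := mul_le_mul_of_nonneg_left hq (by positivity : 0 ≤ (γ ^ 2)⁻¹ * (γ ^ 2)⁻¹)
    calc _ = (γ ^ 2)⁻¹ * (γ ^ 2)⁻¹ * ‖D₁‖ ^ 2 := by ring
      _ ≤ _ := this
      _ = _ := by ring
  · rw [real_inner_smul_left]
    have := mul_le_mul_of_nonneg_left hpZ (by positivity : 0 ≤ (γ ^ 2)⁻¹)
    calc _ = (γ ^ 2)⁻¹ * (m * ‖z‖ ^ 2) := by ring
      _ ≤ _ := this
  · rw [real_inner_smul_left]
    have := mul_le_mul_of_nonneg_left hqZ (by positivity : 0 ≤ (γ ^ 2)⁻¹)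
    calc _ = (γ ^ 2)⁻¹ * (m * ‖z₁‖ ^ 2) := by ring
      _ ≤ _ := this

lemma two_mul_inner_le_weighted (a b δ : ℝ) (hδ : 0 < δ) (z w : V) (hb : b ^ 2 ≤ a) :
    |2 * b * inner ℝ z w| ≤ δ * ‖z‖ ^ 2 + a / δ * ‖w‖ ^ 2 := by
  have h1 : |inner ℝ z w| ≤ ‖z‖ * ‖w‖ := abs_real_inner_le_norm z w
  have h2 : a / δ * ‖w‖ ^ 2 ≥ b ^ 2 / δ * ‖w‖ ^ 2 := by gcongr
  rw [abs_mul, abs_mul, abs_two]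
  have h3 : |b| * |inner ℝ z w| ≤ |b| * (‖z‖ * ‖w‖) := by gcongr
  have h4 : δ * ‖z‖ ^ 2 + b ^ 2 / δ * ‖w‖ ^ 2 - 2 * |b| * (‖z‖ * ‖w‖) =
      (δ * ‖z‖ - |b| * ‖w‖) ^ 2 / δ := by
    rw [← sq_abs b]; field_simp; ring
  have h5 : 0 ≤ (δ * ‖z‖ - |b| * ‖w‖) ^ 2 / δ := by positivity
  linarith

lemma twistCoeff_div_sq_le {lam γ M : ℝ} (hlam : 0 < lam) (hγ0 : 0 < γ) (hM : 0 < M)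
    (hγ : 4 * M ≤ γ ^ 2) (hh : lam * γ ≤ 2) : (twistCoeff (lam * γ) / γ) ^ 2 ≤ 1 / (4 * M) := by
  have h1 := twistCoeff_le_one (mul_pos hlam hγ0)
  have h0 : 0 ≤ twistCoeff (lam * γ) := by have := le_twistCoeff (mul_pos hlam hγ0); linarith
  rw [div_pow]
  calc twistCoeff (lam * γ) ^ 2 / γ ^ 2 ≤ 1 / γ ^ 2 := by gcongr; exact pow_le_one₀ h0 h1
    _ ≤ _ := by gcongr

lemma twistForm_le {b M : ℝ} (hM : 1 ≤ M) (hb : b ^ 2 ≤ 1 / (4 * M)) (z w : V) :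
    twistForm b (2 / (3 * M)) z w ≤ 3 / 2 * (‖z‖ ^ 2 + ‖w‖ ^ 2) := by
  have h1 := (abs_le.1 (two_mul_inner_le_weighted _ b (1 / 2) (by norm_num) z w hb)).2
  have h2 : 2 / (3 * M) + 1 / (4 * M) / (1 / 2) ≤ 3 / 2 := by
    have : 2 / (3 * M) + 1 / (4 * M) / (1 / 2) = (7 / 6) / M := by field_simp; norm_num
    rw [this, div_le_iff₀ (by linarith)]; linarith
  have h3 := mul_le_mul_of_nonneg_right h2 (sq_nonneg ‖w‖)
  rw [twistForm]; linarith

/-- Young's inequality with weight 2/3 leaves |z|²/3 and 7/(24 M)|w|². With the upper constant 3/2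
this gives the ratio (36/7) M, whose square root is below 3√M. -/
lemma le_twistForm {b M : ℝ} (hM : 1 ≤ M) (hb : b ^ 2 ≤ 1 / (4 * M)) (z w : V) :
    ‖z‖ ^ 2 + ‖w‖ ^ 2 ≤ 24 / 7 * M * twistForm b (2 / (3 * M)) z w := by
  have hM0 : 0 < M := by linarith
  have h1 := (abs_le.1 (two_mul_inner_le_weighted _ b (2 / 3) (by norm_num) z w hb)).1
  have h3 : 1 / 3 * ‖z‖ ^ 2 + 7 / 24 / M * ‖w‖ ^ 2 ≤ twistForm b (2 / (3 * M)) z w := by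
    have : 2 / (3 * M) = 7 / 24 / M + 1 / (4 * M) / (2 / 3) := by field_simp; norm_num
    rw [twistForm, this]; linarith
  have h4 := mul_le_mul_of_nonneg_left h3 (by positivity : 0 ≤ 24 / 7 * M)
  have h5 : 24 / 7 * M * (1 / 3 * ‖z‖ ^ 2 + 7 / 24 / M * ‖w‖ ^ 2)
      = 8 / 7 * (M * ‖z‖ ^ 2) + ‖w‖ ^ 2 := by
    field_simp; ring
  have h6 : 1 * ‖z‖ ^ 2 ≤ M * ‖z‖ ^ 2 := by gcongr
  rw [h5] at h4
  linarith [sq_nonneg ‖z‖]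

end Contraction

/-! ### Passing from local to global relations along a segment -/

section Gluing

/-- A closed transitive relation on the line that holds locally to the right of every point of
`[a, b)` holds between `a` and `b`. -/
lemma rel_of_eventually_right {P : ℝ → ℝ → Prop} {a b : ℝ} (hab : a ≤ b)
    (hrefl : ∀ s, P s s) (htrans : ∀ s t u, s ≤ t → t ≤ u → P s t → P t u → P s u)
    (hclosed : ∀ s, IsClosed {t | P s t})
    (hloc : ∀ s ∈ Ico a b, ∀ᶠ t in 𝓝[>] s, P s t) : P a b := by
  have : Icc a b ⊆ {t | P a t} := by
    refine IsClosed.Icc_subset_of_forall_exists_gt ((hclosed a).inter isClosed_Icc) (hrefl a) ?_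
    rintro x ⟨hx, hxab⟩ y hy
    have h1 : ∀ᶠ t in 𝓝[>] x, t ∈ Ioc x y := Ioc_mem_nhdsGT hy
    obtain ⟨t, ht, hty⟩ := ((hloc x hxab).and h1).exists
    exact ⟨t, htrans a x t hxab.1 hty.1.le hx ht, hty⟩
  exact this ⟨hab, le_rfl⟩

/-- Variant of `rel_of_eventually_right` in which the local hypothesis may fail on a set without
right accumulation points. -/
lemma rel_of_eventually_eventually_right {P : ℝ → ℝ → Prop} {a b : ℝ} (hab : a ≤ b)
    (hrefl : ∀ s, P s s) (htrans : ∀ s t u, s ≤ t → t ≤ u → P s t → P t u → P s u)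
    (hclosed : ∀ s, IsClosed {t | P s t}) (hclosed' : ∀ t, IsClosed {s | P s t})
    (hloc : ∀ s ∈ Ico a b, ∀ᶠ s' in 𝓝[>] s, ∀ᶠ t in 𝓝[>] s', P s' t) : P a b := by
  refine rel_of_eventually_right hab hrefl htrans hclosed fun s hs => ?_
  obtain ⟨c, hc, hsub⟩ := mem_nhdsGT_iff_exists_Ioo_subset.1 (hloc s hs)
  have h1 : ∀ᶠ t in 𝓝[>] s, t ∈ Ioo s c := Ioo_mem_nhdsGT hc
  filter_upwards [h1] with t ht
  have h2 : ∀ᶠ s' in 𝓝[>] s, P s' t := by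
    have h3 : ∀ᶠ s' in 𝓝[>] s, s' ∈ Ioo s t := Ioo_mem_nhdsGT ht.1
    filter_upwards [h3] with s' hs'
    exact rel_of_eventually_right hs'.2.le hrefl htrans hclosed fun v hv =>
      hsub ⟨hs'.1.trans_le hv.1, hv.2.trans ht.2⟩
  -- The point s itself may be exceptional; the relation from s' to t is known for all s' slightly
  -- larger, and s' tends to s.
  exact (hclosed' t).mem_of_tendsto (tendsto_id.mono_left nhdsWithin_le_nhds) h2

variable {V : Type*} [NormedAddCommGroup V] [InnerProductSpace ℝ V]

/-- A nonconstant affine curve leaves every sphere to one of its sides. -/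
lemma eventually_norm_lt_or_gt (x ξ : V) (hξ : ξ ≠ 0) (c s : ℝ) :
    (∀ᶠ t in 𝓝[>] s, ‖x + t • ξ‖ < c) ∨ (∀ᶠ t in 𝓝[>] s, c < ‖x + t • ξ‖) := by
  have hcont : ContinuousAt (fun t : ℝ => ‖x + t • ξ‖) s := by fun_prop
  rcases lt_trichotomy ‖x + s • ξ‖ c with h | h | h
  · exact Or.inl ((hcont.eventually (gt_mem_nhds h)).filter_mono nhdsWithin_le_nhds)
  · have hc : 0 ≤ c := h ▸ norm_nonneg _
    have hpos : 0 < ‖ξ‖ ^ 2 := by positivity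
    have key : ∀ t : ℝ, ‖x + t • ξ‖ ^ 2 = c ^ 2 + (t - s) * (2 * inner ℝ (x + s • ξ) ξ
        + (t - s) * ‖ξ‖ ^ 2) := by
      intro t
      have h1 : x + t • ξ = (x + s • ξ) + (t - s) • ξ := by module
      rw [h1, norm_add_sq_real, h, real_inner_smul_right, norm_smul, mul_pow, Real.norm_eq_abs,
        sq_abs]
      ring
    rcases le_or_gt 0 (inner ℝ (x + s • ξ) ξ) with hB | hB
    · right
      filter_upwards [self_mem_nhdsWithin] with t ht
      have ht' : 0 < t - s := sub_pos.2 ht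
      refine lt_of_pow_lt_pow_left₀ 2 (norm_nonneg _) ?_
      rw [key t]
      have : 0 < (t - s) * (2 * inner ℝ (x + s • ξ) ξ + (t - s) * ‖ξ‖ ^ 2) := by positivity
      linarith
    · left
      -- The upper end is the second intersection of the line with the sphere; between the two the
      -- squared norm stays below c².
      have h1 : ∀ᶠ t in 𝓝[>] s, t ∈ Ioo s (s + -2 * inner ℝ (x + s • ξ) ξ / ‖ξ‖ ^ 2) := by
        refine Ioo_mem_nhdsGT ?_
        have : 0 < -2 * inner ℝ (x + s • ξ) ξ / ‖ξ‖ ^ 2 := div_pos (by linarith) hpos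
        linarith
      filter_upwards [h1] with t ht
      have ht' : 0 < t - s := sub_pos.2 ht.1
      refine lt_of_pow_lt_pow_left₀ 2 hc ?_
      rw [key t]
      have h2 : t - s < -2 * inner ℝ (x + s • ξ) ξ / ‖ξ‖ ^ 2 := by linarith [ht.2]
      rw [lt_div_iff₀ hpos] at h2
      nlinarith
  · exact Or.inr ((hcont.eventually (lt_mem_nhds h)).filter_mono nhdsWithin_le_nhds)

/-- Gluing along a segment of a relation that holds locally off three spheres. -/
lemma rel_segment_of_local {x ξ : V} (hξ : ξ ≠ 0) {P : ℝ → ℝ → Prop} (c₁ c₂ c₃ : ℝ)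
    (hrefl : ∀ s, P s s) (htrans : ∀ s t u, s ≤ t → t ≤ u → P s t → P t u → P s u)
    (hclosed : ∀ s, IsClosed {t | P s t}) (hclosed' : ∀ t, IsClosed {s | P s t})
    (hloc : ∀ s, ‖x + s • ξ‖ ≠ c₁ → ‖x + s • ξ‖ ≠ c₂ → ‖x + s • ξ‖ ≠ c₃ →
      ∀ᶠ t in 𝓝[>] s, P s t) : P 0 1 := by
  refine rel_of_eventually_eventually_right zero_le_one hrefl htrans hclosed hclosed'
    fun s _ => ?_
  have aux : ∀ c, ∀ᶠ t in 𝓝[>] s, ‖x + t • ξ‖ ≠ c := fun c => by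
    rcases eventually_norm_lt_or_gt x ξ hξ c s with h | h
    · exact h.mono fun t ht => ht.ne
    · exact h.mono fun t ht => ht.ne'
  filter_upwards [aux c₁, aux c₂, aux c₃] with t h1 h2 h3 using hloc t h1 h2 h3

end Gluing

/-! ### Additivity of cocoercivity and gluing -/

section Cocoercive

variable {V : Type*} [NormedAddCommGroup V] [InnerProductSpace ℝ V]

/-- This is ‖A + B‖²/(a + b) ≤ ‖A‖²/a + ‖B‖²/b, equivalent to ‖bA - aB‖² ≥ 0. It serves twice: to
add two fields at the same pair of points, and to concatenate increments along a segment. -/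
lemma cocoercive_add {A B ξ : V} {a b : ℝ} (ha : 0 ≤ a) (hb : 0 ≤ b)
    (hA : ‖A‖ ^ 2 ≤ a * inner ℝ A ξ) (hB : ‖B‖ ^ 2 ≤ b * inner ℝ B ξ) :
    ‖A + B‖ ^ 2 ≤ (a + b) * inner ℝ (A + B) ξ := by
  have zero : ∀ {C : V}, ‖C‖ ^ 2 ≤ 0 * inner ℝ C ξ → C = 0 := by
    intro C hC
    rw [zero_mul] at hC
    exact norm_eq_zero.1 (pow_eq_zero_iff two_ne_zero |>.1 (le_antisymm hC (sq_nonneg _)))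
  rcases ha.eq_or_lt with rfl | ha
  · simpa [zero hA] using hB
  rcases hb.eq_or_lt with rfl | hb
  · simpa [zero hB] using hA
  have h1 := norm_sub_sq_real (b • A) (a • B)
  rw [real_inner_smul_left, real_inner_smul_right, norm_smul, norm_smul, mul_pow, mul_pow,
    Real.norm_of_nonneg ha.le, Real.norm_of_nonneg hb.le] at h1
  rw [norm_add_sq_real, inner_add_left]
  have h2 := mul_le_mul_of_nonneg_left hA (by positivity : 0 ≤ b * (a + b))
  have h3 := mul_le_mul_of_nonneg_left hB (by positivity : 0 ≤ a * (a + b))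
  have h4 : 0 ≤ a * b * ((a + b) * (inner ℝ A ξ + inner ℝ B ξ)
      - (‖A‖ ^ 2 + 2 * inner ℝ A B + ‖B‖ ^ 2)) := by
    linarith [sq_nonneg ‖b • A - a • B‖]
  have h5 := nonneg_of_mul_nonneg_right h4 (mul_pos ha hb)
  linarith

lemma cocoercive_smul_self {ξ : V} {m : ℝ} : ‖m • ξ‖ ^ 2 ≤ m * inner ℝ (m • ξ) ξ := by
  rw [norm_smul, real_inner_smul_left, real_inner_self_eq_norm_sq, mul_pow, Real.norm_eq_abs,
    sq_abs]
  exact le_of_eq (by ring)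

/-- Gluing of cocoercivity along segments. -/
lemma cocoercive_of_local {f : V → V} (hf : Continuous f) {κ : ℝ} (hκ : 0 ≤ κ) (c₁ c₂ c₃ : ℝ)
    (hloc : ∀ p, ‖p‖ ≠ c₁ → ‖p‖ ≠ c₂ → ‖p‖ ≠ c₃ →
      ∀ᶠ q in 𝓝 p, ‖f q - f p‖ ^ 2 ≤ κ * inner ℝ (f q - f p) (q - p)) (x y : V) :
    ‖f y - f x‖ ^ 2 ≤ κ * inner ℝ (f y - f x) (y - x) := by
  rcases eq_or_ne x y with rfl | hxy
  · simp
  have hξ : y - x ≠ 0 := sub_ne_zero.2 hxy.symm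
  set ξ := y - x with hξd
  -- The constant carries the length t - s and the direction ξ is kept fixed, so that concatenating
  -- two pieces is an instance of `cocoercive_add`.
  have key := rel_segment_of_local (x := x) hξ (P := fun s t =>
    ‖f (x + t • ξ) - f (x + s • ξ)‖ ^ 2 ≤
      κ * ((t - s) * inner ℝ (f (x + t • ξ) - f (x + s • ξ)) ξ)) c₁ c₂ c₃ (by simp) ?_ ?_ ?_ ?_
  · simpa [hξd] using key
  · intro s t u hst htu h1 h2
    have h3 := cocoercive_add (mul_nonneg hκ (sub_nonneg.2 htu)) (mul_nonneg hκ (sub_nonneg.2 hst))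
      (by rw [mul_assoc]; exact h2) (by rw [mul_assoc]; exact h1)
    rw [sub_add_sub_cancel] at h3
    calc _ ≤ _ := h3
      _ = _ := by ring
  · intro s
    exact isClosed_le (by fun_prop) (by fun_prop)
  · intro s
    exact isClosed_le (by fun_prop) (by fun_prop)
  · intro s h1 h2 h3
    have h4 : Tendsto (fun t : ℝ => x + t • ξ) (𝓝[>] s) (𝓝 (x + s • ξ)) :=
      (Continuous.tendsto (by fun_prop) s).mono_left nhdsWithin_le_nhds
    filter_upwards [h4.eventually (hloc _ h1 h2 h3)] with t ht
    have h5 : x + t • ξ - (x + s • ξ) = (t - s) • ξ := by module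
    rwa [h5, real_inner_smul_right] at ht

/-- Gluing of Lipschitz estimates along segments. -/
lemma norm_sub_le_of_local {f : V → V} (hf : Continuous f) {C : ℝ} (c₁ c₂ c₃ : ℝ)
    (hloc : ∀ p, ‖p‖ ≠ c₁ → ‖p‖ ≠ c₂ → ‖p‖ ≠ c₃ →
      ∀ᶠ q in 𝓝 p, ‖f q - f p‖ ≤ C * ‖q - p‖) (x y : V) :
    ‖f y - f x‖ ≤ C * ‖y - x‖ := by
  rcases eq_or_ne x y with rfl | hxy
  · simp
  have hξ : y - x ≠ 0 := sub_ne_zero.2 hxy.symm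
  set ξ := y - x with hξd
  have key := rel_segment_of_local (x := x) hξ (P := fun s t =>
    ‖f (x + t • ξ) - f (x + s • ξ)‖ ≤ C * (|t - s| * ‖ξ‖)) c₁ c₂ c₃ (by simp) ?_ ?_ ?_ ?_
  · simpa [hξd] using key
  · intro s t u hst htu h1 h2
    have h3 := norm_add_le (f (x + u • ξ) - f (x + t • ξ)) (f (x + t • ξ) - f (x + s • ξ))
    rw [sub_add_sub_cancel] at h3
    rw [abs_of_nonneg (sub_nonneg.2 hst)] at h1
    rw [abs_of_nonneg (sub_nonneg.2 htu)] at h2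
    rw [abs_of_nonneg (sub_nonneg.2 (hst.trans htu))]
    linarith
  · intro s
    exact isClosed_le (by fun_prop) (by fun_prop)
  · intro s
    exact isClosed_le (by fun_prop) (by fun_prop)
  · intro s h1 h2 h3
    have h4 : Tendsto (fun t : ℝ => x + t • ξ) (𝓝[>] s) (𝓝 (x + s • ξ)) :=
      (Continuous.tendsto (by fun_prop) s).mono_left nhdsWithin_le_nhds
    filter_upwards [h4.eventually (hloc _ h1 h2 h3)] with t ht
    have h5 : x + t • ξ - (x + s • ξ) = (t - s) • ξ := by module
    rwa [h5, norm_smul, Real.norm_eq_abs] at ht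

end Cocoercive

/-! ### A local Baillon–Haddad theorem -/

section BaillonHaddad

variable {V : Type*} [NormedAddCommGroup V] [InnerProductSpace ℝ V] [CompleteSpace V]

lemma hasDerivAt_comp_segment {φ : V → ℝ} {g : V → V} (hφ : ∀ x, HasGradientAt φ (g x) x)
    (x ξ : V) (t : ℝ) : HasDerivAt (fun s : ℝ => φ (x + s • ξ)) (inner ℝ (g (x + t • ξ)) ξ) t := by
  have h1 : HasDerivAt (fun s : ℝ => x + s • ξ) ξ t := by
    simpa using ((hasDerivAt_id t).smul_const ξ).const_add x
  have h2 := (hφ (x + t • ξ)).hasFDerivAt.comp_hasDerivAt t h1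
  simpa [Function.comp_def] using h2

/-- A differentiable function with monotone gradient lies above its tangents. -/
lemma add_inner_le_of_monotone {φ : V → ℝ} {g : V → V} (hφ : ∀ x, HasGradientAt φ (g x) x)
    {c : ℝ} (hmono : ∀ x y, c * ‖x - y‖ ^ 2 ≤ inner ℝ (g x - g y) (x - y)) (x y : V) :
    φ x + inner ℝ (g x) (y - x) + c / 2 * ‖y - x‖ ^ 2 ≤ φ y := by
  set ξ := y - x with hξ
  have hder : ∀ t : ℝ, HasDerivAt (fun s : ℝ => φ (x + s • ξ) - s * inner ℝ (g x) ξ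
      - c / 2 * ‖ξ‖ ^ 2 * s ^ 2) (inner ℝ (g (x + t • ξ)) ξ - inner ℝ (g x) ξ
      - c * ‖ξ‖ ^ 2 * t) t := by
    intro t
    have h1 := ((hasDerivAt_comp_segment hφ x ξ t).sub
      ((hasDerivAt_id t).mul_const (inner ℝ (g x) ξ))).sub
      (((hasDerivAt_id t).pow 2).const_mul (c / 2 * ‖ξ‖ ^ 2))
    refine h1.congr_deriv ?_
    simp; ring
  have hm : MonotoneOn (fun s : ℝ => φ (x + s • ξ) - s * inner ℝ (g x) ξ
      - c / 2 * ‖ξ‖ ^ 2 * s ^ 2) (Icc 0 1) := by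
    refine monotoneOn_of_deriv_nonneg (convex_Icc 0 1)
      (fun t _ => (hder t).continuousAt.continuousWithinAt)
      (fun t _ => (hder t).differentiableAt.differentiableWithinAt) ?_
    intro t ht
    rw [interior_Icc] at ht
    rw [(hder t).deriv]
    have h1 := hmono (x + t • ξ) x
    rw [add_sub_cancel_left, real_inner_smul_right, norm_smul, mul_pow, Real.norm_eq_abs, sq_abs,
      inner_sub_left] at h1
    have h2 : t * (c * ‖ξ‖ ^ 2 * t) ≤ t * (inner ℝ (g (x + t • ξ)) ξ - inner ℝ (g x) ξ) := by
      linarith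
    linarith [le_of_mul_le_mul_left h2 ht.1]
  have h := hm (left_mem_Icc.2 zero_le_one) (right_mem_Icc.2 zero_le_one) zero_le_one
  simp [hξ] at h
  simp [hξ]; linarith

/-- The descent inequality on a ball. -/
lemma le_add_inner_of_upper {φ : V → ℝ} {g : V → V} (hφ : ∀ x, HasGradientAt φ (g x) x)
    {K δ : ℝ} {p : V} (hup : ∀ x ∈ Metric.ball p δ, ∀ y ∈ Metric.ball p δ,
      inner ℝ (g x - g y) (x - y) ≤ K * ‖x - y‖ ^ 2) {x y : V} (hx : x ∈ Metric.ball p δ)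
    (hy : y ∈ Metric.ball p δ) :
    φ y ≤ φ x + inner ℝ (g x) (y - x) + K / 2 * ‖y - x‖ ^ 2 := by
  set ξ := y - x with hξ
  have hder : ∀ t : ℝ, HasDerivAt (fun s : ℝ => φ (x + s • ξ) - s * inner ℝ (g x) ξ
      - K / 2 * ‖ξ‖ ^ 2 * s ^ 2) (inner ℝ (g (x + t • ξ)) ξ - inner ℝ (g x) ξ
      - K * ‖ξ‖ ^ 2 * t) t := by
    intro t
    have h1 := ((hasDerivAt_comp_segment hφ x ξ t).sub
      ((hasDerivAt_id t).mul_const (inner ℝ (g x) ξ))).sub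
      (((hasDerivAt_id t).pow 2).const_mul (K / 2 * ‖ξ‖ ^ 2))
    refine h1.congr_deriv ?_
    simp; ring
  have hm : AntitoneOn (fun s : ℝ => φ (x + s • ξ) - s * inner ℝ (g x) ξ
      - K / 2 * ‖ξ‖ ^ 2 * s ^ 2) (Icc 0 1) := by
    refine antitoneOn_of_deriv_nonpos (convex_Icc 0 1)
      (fun t _ => (hder t).continuousAt.continuousWithinAt)
      (fun t _ => (hder t).differentiableAt.differentiableWithinAt) ?_
    intro t ht
    rw [interior_Icc] at ht
    rw [(hder t).deriv]
    have hmem : x + t • ξ ∈ Metric.ball p δ := by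
      refine (convex_ball p δ).segment_subset hx hy ?_
      rw [segment_eq_image']
      exact ⟨t, Ioo_subset_Icc_self ht, rfl⟩
    have h1 := hup _ hmem x hx
    rw [add_sub_cancel_left, real_inner_smul_right, norm_smul, mul_pow, Real.norm_eq_abs, sq_abs,
      inner_sub_left] at h1
    have h2 : t * (inner ℝ (g (x + t • ξ)) ξ - inner ℝ (g x) ξ) ≤ t * (K * ‖ξ‖ ^ 2 * t) := by
      linarith
    linarith [le_of_mul_le_mul_left h2 ht.1]
  have h := hm (left_mem_Icc.2 zero_le_one) (right_mem_Icc.2 zero_le_one) zero_le_one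
  simp [hξ] at h
  simp [hξ]; linarith

/-- Local form of the Baillon–Haddad theorem. -/
lemma eventually_cocoercive_of_upper {φ : V → ℝ} {g : V → V}
    (hφ : ∀ x, HasGradientAt φ (g x) x) (hg : Continuous g)
    (hmono : ∀ x y, 0 ≤ inner ℝ (g x - g y) (x - y)) {K : ℝ} (hK : 0 < K) {p : V}
    (hup : ∀ᶠ z in 𝓝 (p, p), inner ℝ (g z.1 - g z.2) (z.1 - z.2) ≤ K * ‖z.1 - z.2‖ ^ 2) :
    ∀ᶠ q in 𝓝 p, ‖g q - g p‖ ^ 2 ≤ K * inner ℝ (g q - g p) (q - p) := by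
  obtain ⟨δ, hδ, hball⟩ := Metric.eventually_nhds_iff_ball.1 hup
  have hup' : ∀ x ∈ Metric.ball p δ, ∀ y ∈ Metric.ball p δ,
      inner ℝ (g x - g y) (x - y) ≤ K * ‖x - y‖ ^ 2 := fun x hx y hy =>
    hball (x, y) (by rw [← ball_prod_same]; exact ⟨hx, hy⟩)
  -- The value of φ at the gradient step x - K⁻¹(g x - g y) is bounded above by the descent
  -- inequality from x and below by the tangent at y. Only the descent inequality is local, so y
  -- need not lie in the ball. Adding the inequality with x and y exchanged removes φ.
  have key : ∀ x y : V, x ∈ Metric.ball p δ → x - K⁻¹ • (g x - g y) ∈ Metric.ball p δ →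
      φ y - φ x ≤ inner ℝ (g y) (y - x) - ‖g x - g y‖ ^ 2 / (2 * K) := by
    intro x y hx hx'
    set D := g x - g y with hD
    have h1 := le_add_inner_of_upper hφ hup' hx hx'
    have h2 := add_inner_le_of_monotone hφ (c := 0) (by simpa using hmono) y (x - K⁻¹ • D)
    have h3 : x - K⁻¹ • D - x = -(K⁻¹ • D) := by abel
    have h4 : x - K⁻¹ • D - y = -(y - x) - K⁻¹ • D := by abel
    rw [h3, inner_neg_right, norm_neg, norm_smul, mul_pow, real_inner_smul_right,
      Real.norm_of_nonneg (by positivity)] at h1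
    rw [h4, inner_sub_right, inner_neg_right, real_inner_smul_right] at h2
    have h5 : inner ℝ (g x) D - inner ℝ (g y) D = ‖D‖ ^ 2 := by
      rw [← inner_sub_left, real_inner_self_eq_norm_sq]
    have h6 : K⁻¹ * inner ℝ (g x) D = K⁻¹ * inner ℝ (g y) D + K⁻¹ * ‖D‖ ^ 2 := by
      rw [← h5]; ring
    have h7 : K / 2 * (K⁻¹ ^ 2 * ‖D‖ ^ 2) = K⁻¹ * ‖D‖ ^ 2 / 2 := by field_simp
    have h8 : ‖D‖ ^ 2 / (2 * K) = K⁻¹ * ‖D‖ ^ 2 / 2 := by field_simp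
    rw [h8]
    linarith
  have c1 : ∀ᶠ q in 𝓝 p, q - K⁻¹ • (g q - g p) ∈ Metric.ball p δ := by
    have : ContinuousAt (fun q => q - K⁻¹ • (g q - g p)) p := by fun_prop
    refine this.eventually_mem ?_
    simpa only [sub_self, smul_zero, sub_zero] using Metric.ball_mem_nhds p hδ
  have c2 : ∀ᶠ q in 𝓝 p, p - K⁻¹ • (g p - g q) ∈ Metric.ball p δ := by
    have : ContinuousAt (fun q => p - K⁻¹ • (g p - g q)) p := by fun_prop
    refine this.eventually_mem ?_
    simpa only [sub_self, smul_zero, sub_zero] using Metric.ball_mem_nhds p hδ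
  filter_upwards [c1, c2, Metric.ball_mem_nhds p hδ] with q h1 h2 h3
  have k1 := key q p h3 h1
  have k2 := key p q (Metric.mem_ball_self hδ) h2
  rw [norm_sub_rev (g p)] at k2
  have h4 : inner ℝ (g q - g p) (q - p) = inner ℝ (g q) (q - p) - inner ℝ (g p) (q - p) :=
    inner_sub_left _ _ _
  have h5 : inner ℝ (g p) (p - q) = - inner ℝ (g p) (q - p) := by
    rw [← inner_neg_right, neg_sub]
  have h6 : ‖g q - g p‖ ^ 2 / K = ‖g q - g p‖ ^ 2 / (2 * K) + ‖g q - g p‖ ^ 2 / (2 * K) := by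
    field_simp; norm_num
  have h7 : ‖g q - g p‖ ^ 2 / K ≤ inner ℝ (g q - g p) (q - p) := by linarith
  rwa [div_le_iff₀' hK] at h7

end BaillonHaddad

/-! ### The tamed field on each zone -/

section Zones

variable {V : Type*} [NormedAddCommGroup V] [InnerProductSpace ℝ V]

/-- The tamed field without its linear part. -/
def tameField (r R : ℝ) (g : V → V) (x : V) : V := cutT r ‖x‖ • g x + (R * cutS r ‖x‖) • x

/-- The clamped formulas make continuity visible and evaluate the cut-offs on closed zones, both end
spheres included. -/
lemma cutT_eq (r ρ : ℝ) : cutT r ρ = max 0 (min 1 (r - ρ)) := by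
  unfold cutT
  split_ifs with h1 h2
  · rw [min_eq_left (by linarith), max_eq_right zero_le_one]
  · rw [min_eq_right (by linarith), max_eq_right (by linarith)]
  · rw [max_eq_left]; exact (min_le_right _ _).trans (by linarith)

lemma cutS_eq {r : ℝ} (hr : 2 ≤ r) (ρ : ℝ) :
    cutS r ρ = max 0 (min 1 (ρ - r + 2)) * (r / max r ρ) := by
  unfold cutS
  split_ifs with h1 h2 h3
  · rw [max_eq_left ((min_le_right _ _).trans (by linarith)), zero_mul]
  · rw [min_eq_right (by linarith), max_eq_right (by linarith), max_eq_left (by linarith),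
      div_self (by linarith), mul_one]
  · rw [min_eq_left (by linarith), max_eq_right zero_le_one, max_eq_left (by linarith),
      div_self (by linarith), mul_one]
  · rw [min_eq_left (by linarith), max_eq_right zero_le_one, max_eq_right (by linarith), one_mul]

lemma continuous_cutT (r : ℝ) : Continuous (cutT r) := by
  rw [show cutT r = fun ρ => max 0 (min 1 (r - ρ)) from funext (cutT_eq r)]
  fun_prop

lemma continuous_cutS {r : ℝ} (hr : 2 ≤ r) : Continuous (cutS r) := by
  rw [show cutS r = fun ρ => max 0 (min 1 (ρ - r + 2)) * (r / max r ρ) from funext (cutS_eq hr)]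
  refine Continuous.mul (by fun_prop) (continuous_const.div (by fun_prop) fun ρ => ?_)
  have := le_max_left r ρ
  linarith

lemma cutT_mem_Icc (r ρ : ℝ) : cutT r ρ ∈ Icc (0 : ℝ) 1 := by
  rw [cutT_eq]
  exact ⟨le_max_left _ _, max_le zero_le_one (min_le_left _ _)⟩

lemma cutS_mem_Icc {r : ℝ} (hr : 2 ≤ r) (ρ : ℝ) : cutS r ρ ∈ Icc (0 : ℝ) 1 := by
  have h0 : 0 < max r ρ := lt_max_of_lt_left (by linarith)
  have h1 : r / max r ρ ≤ 1 := (div_le_one h0).2 (le_max_left _ _)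
  have h2 : 0 ≤ r / max r ρ := div_nonneg (by linarith) h0.le
  rw [cutS_eq hr]
  exact ⟨mul_nonneg (le_max_left _ _) h2,
    mul_le_one₀ (max_le zero_le_one (min_le_left _ _)) h2 h1⟩

lemma continuous_tameField {r R : ℝ} (hr : 2 ≤ r) {g : V → V} (hg : Continuous g) :
    Continuous (tameField r R g) := by
  unfold tameField
  have := (continuous_cutT r).comp (continuous_norm (E := V))
  have := (continuous_cutS hr).comp (continuous_norm (E := V))
  simp only [Function.comp_def] at *
  fun_prop

/-- Two points in one of the three closed zones of the ball of radius `r`. -/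
def SameZone (r : ℝ) (x y : V) : Prop :=
  (‖x‖ ≤ r - 2 ∧ ‖y‖ ≤ r - 2) ∨ (‖x‖ ∈ Icc (r - 2) (r - 1) ∧ ‖y‖ ∈ Icc (r - 2) (r - 1)) ∨
    (‖x‖ ∈ Icc (r - 1) r ∧ ‖y‖ ∈ Icc (r - 1) r)

/-- In the first three zones, the increments of the tamed field are those of `g` up to a
cocoercive part. -/
lemma exists_tameField_sub {r R : ℝ} (hr : 2 ≤ r) (hR : 0 ≤ R) {g : V → V}
    (hgR : ∀ x, ‖x‖ ≤ r → ‖g x‖ ≤ R) {x y : V} (hxy : SameZone r x y) :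
    ∃ S, tameField r R g x - tameField r R g y = cutT r ‖x‖ • (g x - g y) + S ∧
      ‖S‖ ^ 2 ≤ R * r * inner ℝ S (x - y) := by
  have sc : ∀ {A ξ : V} {c : ℝ}, ‖A‖ ^ 2 ≤ c * inner ℝ A ξ →
      ‖R • A‖ ^ 2 ≤ R * c * inner ℝ (R • A) ξ := by
    intro A ξ c h
    rw [norm_smul, mul_pow, real_inner_smul_left, Real.norm_of_nonneg hR]
    nlinarith [mul_le_mul_of_nonneg_left h (sq_nonneg R)]
  rcases hxy with ⟨hx, hy⟩ | ⟨hx, hy⟩ | ⟨hx, hy⟩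
  · refine ⟨0, ?_, by simp⟩
    have e1 : ∀ z : V, ‖z‖ ≤ r - 2 → tameField r R g z = g z := fun z hz => by
      simp [tameField, cutT, cutS, hz, show ‖z‖ ≤ r - 1 by linarith]
    rw [e1 x hx, e1 y hy]
    simp [cutT, show ‖x‖ ≤ r - 1 by linarith]
  · have e1 : ∀ z : V, ‖z‖ ∈ Icc (r - 2) (r - 1) →
        tameField r R g z = g z + R • ((‖z‖ - r + 2) • z) := fun z hz => by
      have h1 : cutS r ‖z‖ = ‖z‖ - r + 2 := by
        rw [cutS_eq hr, min_eq_right (by linarith [hz.2]), max_eq_right (by linarith [hz.1]),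
          max_eq_left (by linarith [hz.2]), div_self (by linarith), mul_one]
      simp [tameField, cutT, h1, hz.2, smul_smul]
    refine ⟨R • ((‖x‖ - r + 2) • x - (‖y‖ - r + 2) • y), ?_, sc ?_⟩
    · rw [e1 x hx, e1 y hy]
      simp only [cutT, hx.2, if_true]
      module
    · have hc : inner ℝ x y ≤ ‖x‖ * ‖y‖ := real_inner_le_norm x y
      simp only [← real_inner_self_eq_norm_sq, inner_sub_left, inner_sub_right,
        real_inner_smul_left, real_inner_smul_right, real_inner_comm x y]
      rw [real_inner_self_eq_norm_sq, real_inner_self_eq_norm_sq]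
      obtain ⟨hx1, hx2⟩ := hx
      obtain ⟨hy1, hy2⟩ := hy
      have n1 := norm_nonneg x
      have n2 := norm_nonneg y
      generalize ‖x‖ = a at *
      generalize ‖y‖ = b at *
      generalize inner ℝ x y = q at *
      set s := a - r + 2 with hs
      set t := b - r + 2 with ht
      have s0 : 0 ≤ s := by linarith
      have t0 : 0 ≤ t := by linarith
      have s1 : s ≤ 1 := by linarith
      have t1 : t ≤ 1 := by linarith
      -- The claim is affine in q = ⟨x, y⟩ with coefficient -(r(s + t) - 2st) ≤ 0, so the worst case
      -- is q = ab. There only the radial profile (ρ - r + 2)ρ matters, and its difference quotient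
      -- a + b - r + 2 lies between 0 and r.
      have hco : 0 ≤ r * (s + t) - 2 * (s * t) := by nlinarith
      have main : 0 ≤ (s * a - t * b) * (r * (a - b) - (s * a - t * b)) := by
        have f1 : s * a - t * b = (a - b) * (a + b - r + 2) := by rw [hs, ht]; ring
        rw [f1]
        have f2 : (a - b) * (a + b - r + 2) * (r * (a - b) - (a - b) * (a + b - r + 2)) =
          (a - b) ^ 2 * ((a + b - r + 2) * (2 * r - 2 - a - b)) := by ring
        rw [f2]
        exact mul_nonneg (sq_nonneg _) (mul_nonneg (by linarith) (by linarith))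
      nlinarith [mul_nonneg hco (sub_nonneg.2 hc)]
  · have e1 : ∀ z : V, ‖z‖ ∈ Icc (r - 1) r → cutT r ‖z‖ = r - ‖z‖ ∧ cutS r ‖z‖ = 1 := fun z hz => by
      constructor
      · rw [cutT_eq, min_eq_right (by linarith [hz.1]), max_eq_right (by linarith [hz.2])]
      · rw [cutS_eq hr, min_eq_left (by linarith [hz.1]), max_eq_right zero_le_one,
          max_eq_left hz.2, div_self (by linarith), mul_one]
    -- Here t(x) - t(y) = ‖y‖ - ‖x‖. The term R(x - y) compensates the decrease of t, because ‖g y‖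
    -- ≤ R. Expanding gives ‖S‖² ≤ 2R⟨S, x - y⟩, which is enough since r ≥ 2.
    refine ⟨(‖y‖ - ‖x‖) • g y + R • (x - y), ?_, ?_⟩
    · unfold tameField
      rw [(e1 x hx).1, (e1 x hx).2, (e1 y hy).1, (e1 y hy).2]
      module
    · have hR2 : 0 ≤ R * (r - 2) := mul_nonneg hR (by linarith)
      set ξ := x - y
      have hτ : (‖y‖ - ‖x‖) ^ 2 ≤ ‖ξ‖ ^ 2 := by
        have := abs_norm_sub_norm_le y x
        rw [norm_sub_rev] at this
        exact sq_le_sq' (by linarith [(abs_le.1 this).1]) (abs_le.1 this).2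
      have hgy := hgR y hy.2
      have hgy2 : ‖g y‖ ^ 2 ≤ R ^ 2 := by gcongr
      generalize ‖y‖ - ‖x‖ = τ at *
      rw [norm_add_sq_real, inner_add_left, real_inner_smul_left, real_inner_smul_left,
        real_inner_smul_right, real_inner_smul_left, real_inner_self_eq_norm_sq, norm_smul, norm_smul,
        mul_pow, mul_pow, Real.norm_eq_abs, Real.norm_eq_abs, sq_abs, sq_abs]
      have h1 : τ ^ 2 * ‖g y‖ ^ 2 ≤ ‖ξ‖ ^ 2 * R ^ 2 := by gcongr
      have h2 : 0 ≤ τ * inner ℝ (g y) ξ + R * ‖ξ‖ ^ 2 := by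
        have h3 : |τ * inner ℝ (g y) ξ| ≤ ‖ξ‖ * (R * ‖ξ‖) := by
          rw [abs_mul]
          have : |τ| ≤ ‖ξ‖ := abs_le_of_sq_le_sq hτ (norm_nonneg _)
          have h4 := abs_real_inner_le_norm (g y) ξ
          have h5 : ‖g y‖ * ‖ξ‖ ≤ R * ‖ξ‖ := by gcongr
          exact mul_le_mul this (h4.trans h5) (abs_nonneg _) (norm_nonneg _)
        linarith [(abs_le.1 h3).1]
      nlinarith [mul_nonneg hR2 h2]

/-- Outside the ball of radius `r` the tamed field is `R` times a projection. -/
lemma tameField_cocoercive_outside {r R : ℝ} (hr : 2 ≤ r) {g : V → V} {x y : V}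
    (hx : r ≤ ‖x‖) (hy : r ≤ ‖y‖) :
    ‖tameField r R g x - tameField r R g y‖ ^ 2 ≤
      R * inner ℝ (tameField r R g x - tameField r R g y) (x - y) := by
  have e1 : ∀ z : V, r ≤ ‖z‖ → tameField r R g z = (R * r) • (‖z‖⁻¹ • z) := fun z hz => by
    have h1 : cutT r ‖z‖ = 0 := by
      rw [cutT_eq, max_eq_left ((min_le_right _ _).trans (by linarith))]
    have h2 : cutS r ‖z‖ = r / ‖z‖ := by
      rw [cutS_eq hr, min_eq_left (by linarith), max_eq_right zero_le_one,
          max_eq_right hz, one_mul]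
    rw [tameField, h1, h2, zero_smul, zero_add, smul_smul, mul_assoc, div_eq_mul_inv]
  have hx0 : 0 < ‖x‖ := by linarith
  have hy0 : 0 < ‖y‖ := by linarith
  rw [e1 x hx, e1 y hy, ← smul_sub, norm_smul, real_inner_smul_left, mul_pow, Real.norm_eq_abs,
    sq_abs]
  have hc : inner ℝ x y ≤ ‖x‖ * ‖y‖ := real_inner_le_norm x y
  have h1 : ‖‖x‖⁻¹ • x - ‖y‖⁻¹ • y‖ ^ 2 = 2 - 2 * (inner ℝ x y / (‖x‖ * ‖y‖)) := by
    rw [norm_sub_sq_real, norm_smul, norm_smul, real_inner_smul_left, real_inner_smul_right,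
      norm_inv, norm_inv, norm_norm, norm_norm, inv_mul_cancel₀ hx0.ne', inv_mul_cancel₀ hy0.ne']
    field_simp; ring
  have h2 : inner ℝ (‖x‖⁻¹ • x - ‖y‖⁻¹ • y) (x - y) =
      (‖x‖ + ‖y‖) * (1 - inner ℝ x y / (‖x‖ * ‖y‖)) := by
    rw [inner_sub_left, inner_sub_right, inner_sub_right, real_inner_smul_left,
      real_inner_smul_left, real_inner_smul_left, real_inner_smul_left,
      real_inner_self_eq_norm_sq, real_inner_self_eq_norm_sq, real_inner_comm x y]
    field_simp; ring
  have h3 : inner ℝ x y / (‖x‖ * ‖y‖) ≤ 1 := (div_le_one (by positivity)).2 hc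
  rw [h1, h2]
  have h4 : 0 ≤ R ^ 2 * r * ((‖x‖ + ‖y‖ - 2 * r) * (1 - inner ℝ x y / (‖x‖ * ‖y‖))) :=
    mul_nonneg (mul_nonneg (sq_nonneg _) (by linarith)) (mul_nonneg (by linarith) (by linarith))
  linarith

end Zones

/-! ### Lipschitz bounds and cocoercivity of the tamed field -/

section TamedField

variable {V : Type*} [NormedAddCommGroup V] [InnerProductSpace ℝ V]

lemma norm_le_of_cocoercive {S ξ : V} {c : ℝ} (h : ‖S‖ ^ 2 ≤ c * inner ℝ S ξ) (hc : 0 ≤ c) :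
    ‖S‖ ≤ c * ‖ξ‖ := by
  rcases (norm_nonneg S).eq_or_lt with h0 | h0
  · rw [← h0]; positivity
  · have h1 : c * inner ℝ S ξ ≤ c * (‖S‖ * ‖ξ‖) := by gcongr; exact real_inner_le_norm _ _
    have h2 : ‖S‖ * ‖S‖ ≤ ‖S‖ * (c * ‖ξ‖) := by nlinarith
    exact le_of_mul_le_mul_left h2 h0

omit [InnerProductSpace ℝ V] in
lemma eventually_sameZone {r : ℝ} {p : V} (hp : ‖p‖ < r) (h1 : ‖p‖ ≠ r - 2) (h2 : ‖p‖ ≠ r - 1) :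
    ∀ᶠ z in 𝓝 (p, p), SameZone r z.1 z.2 := by
  have c1 : ContinuousAt (fun z : V × V => ‖z.1‖) (p, p) := by fun_prop
  have c2 : ContinuousAt (fun z : V × V => ‖z.2‖) (p, p) := by fun_prop
  rcases lt_or_gt_of_ne h1 with h | h
  · filter_upwards [c1.eventually (gt_mem_nhds h), c2.eventually (gt_mem_nhds h)] with z a b
    exact Or.inl ⟨a.le, b.le⟩
  rcases lt_or_gt_of_ne h2 with h' | h'
  · filter_upwards [c1.eventually (Icc_mem_nhds h h'), c2.eventually (Icc_mem_nhds h h')] with z a b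
    exact Or.inr (Or.inl ⟨a, b⟩)
  · filter_upwards [c1.eventually (Icc_mem_nhds h' hp), c2.eventually (Icc_mem_nhds h' hp)]
      with z a b
    exact Or.inr (Or.inr ⟨a, b⟩)

omit [InnerProductSpace ℝ V] in
lemma SameZone.norm_le {r : ℝ} {x y : V} (h : SameZone r x y) : ‖x‖ ≤ r ∧ ‖y‖ ≤ r := by
  rcases h with ⟨a, b⟩ | ⟨a, b⟩ | ⟨a, b⟩
  · exact ⟨by linarith, by linarith⟩
  · exact ⟨by linarith [a.2], by linarith [b.2]⟩
  · exact ⟨a.2, b.2⟩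

omit [InnerProductSpace ℝ V] in
lemma eventually_pair_self {P : V × V → Prop} {p : V} (h : ∀ᶠ z in 𝓝 (p, p), P z) :
    ∀ᶠ q in 𝓝 p, P (p, q) :=
  (Continuous.tendsto (by fun_prop : Continuous fun q : V => (p, q)) p).eventually h

omit [InnerProductSpace ℝ V] in
lemma eventually_both_outside {r : ℝ} {p : V} (hp : r < ‖p‖) : ∀ᶠ q in 𝓝 p, r ≤ ‖q‖ :=
  ((continuous_norm.tendsto p).eventually (lt_mem_nhds hp)).mono fun _ h => h.le

/-- Global Lipschitz bound for the tamed field. -/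
lemma norm_tameField_sub_le {r R G : ℝ} (hr : 2 ≤ r) (hR : 0 ≤ R) (hG : 0 ≤ G) {g : V → V}
    (hg : Continuous g) (hgR : ∀ x, ‖x‖ ≤ r → ‖g x‖ ≤ R)
    (hgG : ∀ x y, ‖x‖ ≤ r → ‖y‖ ≤ r → ‖g x - g y‖ ≤ G * ‖x - y‖) (x y : V) :
    ‖tameField r R g y - tameField r R g x‖ ≤ (G + R * r) * ‖y - x‖ := by
  refine norm_sub_le_of_local (continuous_tameField hr hg) (r - 2) (r - 1) r ?_ x y
  intro p h1 h2 h3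
  rcases lt_or_gt_of_ne h3 with h | h
  · filter_upwards [eventually_pair_self (eventually_sameZone h h1 h2)] with q hq
    obtain ⟨S, hS, hS2⟩ := exists_tameField_sub hr hR hgR hq
    have hS3 := norm_le_of_cocoercive hS2 (by positivity)
    have ht := cutT_mem_Icc r ‖p‖
    rw [norm_sub_rev, norm_sub_rev q p, hS]
    calc _ ≤ ‖cutT r ‖p‖ • (g p - g q)‖ + ‖S‖ := norm_add_le _ _
      _ ≤ 1 * (G * ‖p - q‖) + R * r * ‖p - q‖ := by
        rw [norm_smul, Real.norm_of_nonneg ht.1]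
        exact add_le_add (mul_le_mul ht.2 (hgG p q hq.norm_le.1 hq.norm_le.2) (norm_nonneg _)
          zero_le_one) hS3
      _ = _ := by ring
  · filter_upwards [eventually_both_outside h] with q hq
    have h4 := norm_le_of_cocoercive (tameField_cocoercive_outside (R := R) (g := g) hr hq h.le) hR
    refine h4.trans ?_
    gcongr
    nlinarith

/-- The radial growth of the tamed field bounds its Lipschitz constant from below. -/
lemma le_lipschitz_tamed [Nontrivial V] {r R m M : ℝ} (hr : 2 ≤ r) {g : V → V}
    (hmono : ∀ x y, m * ‖x - y‖ ^ 2 ≤ inner ℝ (g x - g y) (x - y))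
    (hM : ∀ x y, ‖(tameField r R g x + m • x) - (tameField r R g y + m • y)‖ ≤ M * ‖x - y‖) :
    R * r + 2 * m ≤ M := by
  obtain ⟨e, he⟩ := exists_norm_eq V zero_le_one
  -- On two points of one ray at radii r - 1 and r - 1 - δ, in the zone where t = 1 and s is affine,
  -- the radial term has difference quotient R(r - δ). The fields g and m x contribute at least m
  -- each.
  have key : ∀ δ : ℝ, 0 < δ → δ < 1 → R * (r - δ) + 2 * m ≤ M := by
    intro δ h0 h1
    have n1 : ‖(r - 1) • e‖ = r - 1 := by
      rw [norm_smul, he, mul_one, Real.norm_of_nonneg (by linarith)]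
    have n2 : ‖(r - 1 - δ) • e‖ = r - 1 - δ := by
      rw [norm_smul, he, mul_one, Real.norm_of_nonneg (by linarith)]
    have f1 : ∀ c : ℝ, r - 2 ≤ c → c ≤ r - 1 →
        cutT r c = 1 ∧ cutS r c = c - r + 2 := by
      intro c hc hc'
      constructor
      · simp [cutT, hc']
      · rw [cutS_eq hr, min_eq_right (by linarith), max_eq_right (by linarith),
          max_eq_left (by linarith), div_self (by linarith), mul_one]
    have hsub : (r - 1) • e - (r - 1 - δ) • e = δ • e := by module
    have h2 := hM ((r - 1) • e) ((r - 1 - δ) • e)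
    have h3 := hmono ((r - 1) • e) ((r - 1 - δ) • e)
    set x := (r - 1) • e with hx
    set y := (r - 1 - δ) • e with hy
    have h4 : (tameField r R g x + m • x) - (tameField r R g y + m • y) =
        (g x - g y) + (δ * (R * (r - δ) + m)) • e := by
      rw [tameField, tameField, n1, n2, (f1 (r - 1) (by linarith) le_rfl).1,
        (f1 (r - 1) (by linarith) le_rfl).2, (f1 (r - 1 - δ) (by linarith) (by linarith)).1,
        (f1 (r - 1 - δ) (by linarith) (by linarith)).2, hx, hy]
      module
    have h5 := real_inner_le_norm ((tameField r R g x + m • x) - (tameField r R g y + m • y)) (x - y)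
    have hn : ‖x - y‖ = δ := by rw [hsub, norm_smul, he, mul_one, Real.norm_of_nonneg h0.le]
    have h6 : inner ℝ ((tameField r R g x + m • x) - (tameField r R g y + m • y)) (x - y) =
        inner ℝ (g x - g y) (x - y) + δ ^ 2 * (R * (r - δ) + m) := by
      rw [h4, inner_add_left, hsub, real_inner_smul_left, real_inner_smul_right e,
        real_inner_self_eq_norm_sq, he]
      ring
    rw [hn] at h2 h3 h5
    have h7 : δ ^ 2 * (R * (r - δ) + 2 * m) ≤ δ ^ 2 * M := by
      have := mul_le_mul_of_nonneg_right h2 h0.le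
      linarith
    exact le_of_mul_le_mul_left h7 (by positivity)
  have hlim : Tendsto (fun δ : ℝ => R * (r - δ) + 2 * m) (𝓝[>] 0) (𝓝 (R * (r - 0) + 2 * m)) :=
    (Continuous.tendsto (by fun_prop) 0).mono_left nhdsWithin_le_nhds
  rw [sub_zero] at hlim
  refine le_of_tendsto hlim ?_
  filter_upwards [Ioo_mem_nhdsGT (zero_lt_one' ℝ)] with δ hδ using key δ hδ.1 hδ.2

/-- Cocoercivity of the tamed field. -/
lemma tameField_cocoercive [Nontrivial V] [CompleteSpace V] {r R m M : ℝ} (hr : 2 ≤ r) (hR : 0 ≤ R)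
    (hm : 0 < m) {φ : V → ℝ} {g : V → V} (hφ : ∀ x, HasGradientAt φ (g x) x) (hg : Continuous g)
    (hgR : ∀ x, ‖x‖ ≤ r → ‖g x‖ ≤ R)
    (hmono : ∀ x y, m * ‖x - y‖ ^ 2 ≤ inner ℝ (g x - g y) (x - y))
    (hM : ∀ x y, ‖(tameField r R g x + m • x) - (tameField r R g y + m • y)‖ ≤ M * ‖x - y‖)
    (x y : V) :
    ‖tameField r R g y - tameField r R g x‖ ^ 2 ≤
      (2 * M - 2 * m) * inner ℝ (tameField r R g y - tameField r R g x) (y - x) := by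
  have hMR := le_lipschitz_tamed hr hmono hM
  have hRr : 0 ≤ R * r := by positivity
  have hM0 : 0 < M := by linarith
  have hMm : 0 < M - m := by linarith
  have hmono0 : ∀ x y, 0 ≤ inner ℝ (g x - g y) (x - y) := fun x y =>
    le_trans (by positivity) (hmono x y)
  refine cocoercive_of_local (continuous_tameField hr hg) (by linarith) (r - 2) (r - 1) r ?_ x y
  intro p h1 h2 h3
  rcases lt_or_gt_of_ne h3 with h | h
  · set c := cutT r ‖p‖ with hc
    have hc0 : 0 < c := by
      rw [hc, cutT_eq]; exact lt_max_of_lt_right (lt_min one_pos (by linarith))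
    have hup : ∀ᶠ z in 𝓝 (p, p),
        inner ℝ (g z.1 - g z.2) (z.1 - z.2) ≤ M / c * ‖z.1 - z.2‖ ^ 2 := by
      have ct : ContinuousAt (fun z : V × V => cutT r ‖z.1‖) (p, p) := by
        have := continuous_cutT r
        fun_prop
      -- Since S is monotone, the M-Lipschitz bound gives t(z₁)⟨Δg, ξ⟩ ≤ (M - m)‖ξ‖². The slack m
      -- allows replacing t at the moving point by c = t(p), by continuity, giving the bound M/c for
      -- g near p.
      have hlt : c * (M - m) / M < c := by
        rw [div_lt_iff₀ hM0]; nlinarith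
      filter_upwards [ct.eventually (lt_mem_nhds hlt), eventually_sameZone h h1 h2] with z hz hzz
      obtain ⟨S, hS, hS2⟩ := exists_tameField_sub hr hR hgR hzz
      have hS3 : 0 ≤ inner ℝ S (z.1 - z.2) := by
        rcases hRr.eq_or_lt with h0 | h0
        · rw [← h0, zero_mul] at hS2
          have : S = 0 := norm_eq_zero.1
            (pow_eq_zero_iff two_ne_zero |>.1 (le_antisymm hS2 (sq_nonneg _)))
          simp [this]
        · exact nonneg_of_mul_nonneg_right ((sq_nonneg _).trans hS2) h0
      have h5 := real_inner_le_norm ((tameField r R g z.1 + m • z.1) -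
        (tameField r R g z.2 + m • z.2)) (z.1 - z.2)
      have h6 := mul_le_mul_of_nonneg_right (hM z.1 z.2) (norm_nonneg (z.1 - z.2))
      have h7 : (tameField r R g z.1 + m • z.1) - (tameField r R g z.2 + m • z.2) =
          (tameField r R g z.1 - tameField r R g z.2) + m • (z.1 - z.2) := by module
      rw [h7, hS, inner_add_left, inner_add_left, real_inner_smul_left, real_inner_smul_left,
        real_inner_self_eq_norm_sq] at h5
      rw [h7, hS] at h6
      have h8 := mul_le_mul_of_nonneg_right hz.le (hmono0 z.1 z.2)
      have h9 : c * (M - m) / M * inner ℝ (g z.1 - g z.2) (z.1 - z.2) ≤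
          (M - m) * ‖z.1 - z.2‖ ^ 2 := by linarith
      have h10 : (M - m) * inner ℝ (g z.1 - g z.2) (z.1 - z.2) ≤
          (M - m) * (M / c * ‖z.1 - z.2‖ ^ 2) := by
        have := mul_le_mul_of_nonneg_left h9 (by positivity : 0 ≤ M / c)
        calc _ = M / c * (c * (M - m) / M * inner ℝ (g z.1 - g z.2) (z.1 - z.2)) := by
              field_simp
          _ ≤ _ := this
          _ = _ := by ring
      exact le_of_mul_le_mul_left h10 hMm
    have hbh := eventually_cocoercive_of_upper hφ hg hmono0 (by positivity : 0 < M / c) hup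
    filter_upwards [hbh, eventually_pair_self (eventually_sameZone h h1 h2)] with q hq hz
    obtain ⟨S, hS, hS2⟩ := exists_tameField_sub hr hR hgR hz
    rw [← neg_sub (tameField r R g p), ← neg_sub p q, inner_neg_neg, norm_neg, hS]
    rw [← neg_sub (g p), ← neg_sub p q, inner_neg_neg, norm_neg] at hq
    have hA : ‖c • (g p - g q)‖ ^ 2 ≤ M * inner ℝ (c • (g p - g q)) (p - q) := by
      rw [norm_smul, mul_pow, real_inner_smul_left, Real.norm_of_nonneg hc0.le]
      calc c ^ 2 * ‖g p - g q‖ ^ 2 ≤ c ^ 2 * (M / c * inner ℝ (g p - g q) (p - q)) := by gcongr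
        _ = _ := by field_simp
    -- The constants M of c Δg and R r of S add up to M + R r ≤ 2M - 2m by `hMR`; the part m x will
    -- add m.
    have hsum := cocoercive_add hM0.le hRr hA hS2
    refine hsum.trans (mul_le_mul_of_nonneg_right (by linarith) ?_)
    exact nonneg_of_mul_nonneg_right ((sq_nonneg _).trans hsum) (by linarith)
  · filter_upwards [eventually_both_outside h] with q hq
    have h4 := tameField_cocoercive_outside (R := R) (g := g) hr hq h.le
    rcases hR.eq_or_lt with h0 | h0
    · have h5 : tameField r R g q - tameField r R g p = 0 := by
        rw [← h0, zero_mul] at h4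
        rw [← h0]
        exact norm_eq_zero.1 (pow_eq_zero_iff two_ne_zero |>.1 (le_antisymm h4 (sq_nonneg _)))
      simp [h5]
    · refine h4.trans (mul_le_mul_of_nonneg_right (by nlinarith) ?_)
      exact nonneg_of_mul_nonneg_right ((sq_nonneg _).trans h4) h0

end TamedField

/-! ### Properties of the tamed drift and the size of its Lipschitz constant -/

section Drift

variable {d : ℕ} {m L l : ℝ} {u : E d → ℝ} {lam : ℝ}

lemma tamedDrift_eq (x : E d) : tamedDrift m L l u lam x =
    tameField (radius m L l lam) (gSup m u (radius m L l lam)) (gDrift m u) x + m • x := rfl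

lemma PotentialAssumptions.continuous_gradient (hu : PotentialAssumptions m L l u) (hl : 0 ≤ l) :
    Continuous (∇ u) := by
  rw [continuous_iff_continuousAt]
  intro x
  rw [ContinuousAt, tendsto_iff_norm_sub_tendsto_zero]
  have h1 : Tendsto (fun y => L * (1 + ‖y‖ + ‖x‖) ^ l * ‖y - x‖) (𝓝 x) (𝓝 0) := by
    have : ContinuousAt (fun y => L * (1 + ‖y‖ + ‖x‖) ^ l * ‖y - x‖) x := by
      have h2 : ContinuousAt (fun y : E d => (1 + ‖y‖ + ‖x‖) ^ l) x :=
        ContinuousAt.rpow_const (by fun_prop) (Or.inr hl)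
      fun_prop
    simpa [ContinuousAt] using this
  exact squeeze_zero (fun _ => norm_nonneg _) (fun y => hu.locally_lipschitz y x) h1

lemma PotentialAssumptions.continuous_gDrift (hu : PotentialAssumptions m L l u) (hl : 0 ≤ l) :
    Continuous (gDrift m u) := by
  have := hu.continuous_gradient hl
  unfold gDrift
  fun_prop

lemma PotentialAssumptions.gDrift_monotone (hu : PotentialAssumptions m L l u) (x y : E d) :
    m * ‖x - y‖ ^ 2 ≤ inner ℝ (gDrift m u x - gDrift m u y) (x - y) := by
  have h1 := hu.strongly_monotone x y
  have h2 : gDrift m u x - gDrift m u y = (∇ u x - ∇ u y) - m • (x - y) := by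
    unfold gDrift; module
  rw [h2, inner_sub_left, real_inner_smul_left, real_inner_self_eq_norm_sq]
  linarith

lemma PotentialAssumptions.hasGradientAt_gDrift (hu : PotentialAssumptions m L l u) (x : E d) :
    HasGradientAt (fun x => u x - m / 2 * ‖x‖ ^ 2) (gDrift m u x) x := by
  have h1 := (hu.differentiable x).hasGradientAt.hasFDerivAt
  have h2 := (hasStrictFDerivAt_norm_sq x).hasFDerivAt.const_mul (m / 2)
  rw [hasGradientAt_iff_hasFDerivAt]
  refine (h1.sub h2).congr_fderiv ?_
  ext y
  simp [gDrift]
  ring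

/-- The supremum is taken over the open ball while the zones are closed; continuity extends the
bound to the sphere. -/
lemma norm_gDrift_le_gSup (hg : Continuous (gDrift m u)) {r : ℝ} (hr : 0 < r) {x : E d}
    (hx : ‖x‖ ≤ r) : ‖gDrift m u x‖ ≤ gSup m u r := by
  have hbdd : BddAbove ((fun x : E d => ‖gDrift m u x‖) '' Metric.ball 0 r) := by
    refine BddAbove.mono (image_mono Metric.ball_subset_closedBall) ?_
    exact ((isCompact_closedBall (0 : E d) r).image (by fun_prop)).bddAbove
  have h1 : ∀ y ∈ Metric.ball (0 : E d) r, ‖gDrift m u y‖ ≤ gSup m u r := fun y hy =>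
    le_csSup hbdd (mem_image_of_mem _ hy)
  have h2 : closure (Metric.ball (0 : E d) r) ⊆ {y | ‖gDrift m u y‖ ≤ gSup m u r} :=
    closure_minimal h1 (isClosed_le (by fun_prop) (by fun_prop))
  rw [closure_ball _ hr.ne'] at h2
  exact h2 (by simpa using hx)

lemma gSup_nonneg (hg : Continuous (gDrift m u)) {r : ℝ} (hr : 0 < r) : 0 ≤ gSup m u r :=
  (norm_nonneg _).trans (norm_gDrift_le_gSup hg hr (x := 0) (by simpa using hr.le))

lemma gSup_le {r B : ℝ} (hr : 0 < r) (h : ∀ x : E d, ‖x‖ ≤ r → ‖gDrift m u x‖ ≤ B) :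
    gSup m u r ≤ B := by
  refine csSup_le ((Metric.nonempty_ball.2 hr).image _) ?_
  rintro _ ⟨x, hx, rfl⟩
  exact h x (by simpa using (Metric.mem_ball.1 hx).le)

lemma norm_sub_le_lipConst {f : E d → E d} (h : ∃ K, LipschitzWith K f) (x y : E d) :
    ‖f x - f y‖ ≤ lipConst f * ‖x - y‖ := by
  rcases eq_or_ne x y with rfl | hxy
  · simp
  have h0 : 0 < ‖x - y‖ := norm_pos_iff.2 (sub_ne_zero.2 hxy)
  rw [← div_le_iff₀ h0]
  obtain ⟨c, hc⟩ : ∃ c : ℝ≥0, (c : ℝ) = ‖f x - f y‖ / ‖x - y‖ := ⟨⟨_, by positivity⟩, rfl⟩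
  have h1 : c ≤ sInf {K : ℝ≥0 | LipschitzWith K f} := by
    refine le_csInf h fun K hK => ?_
    rw [← NNReal.coe_le_coe, hc]
    have h2 := hK.dist_le_mul x y
    rw [dist_eq_norm, dist_eq_norm] at h2
    exact (div_le_iff₀ h0).2 h2
  rw [← hc]
  exact_mod_cast h1

lemma lipConst_le {f : E d → E d} {C : ℝ} (hC : 0 ≤ C) (h : ∀ x y, ‖f x - f y‖ ≤ C * ‖x - y‖) :
    lipConst f ≤ C := by
  have h1 : LipschitzWith ⟨C, hC⟩ f := LipschitzWith.of_dist_le_mul fun x y => by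
    rw [dist_eq_norm, dist_eq_norm]; exact h x y
  have h2 : sInf {K : ℝ≥0 | LipschitzWith K f} ≤ ⟨C, hC⟩ := csInf_le (OrderBot.bddBelow _) h1
  exact_mod_cast h2

/-- The infimum of the empty set in `ℝ≥0` is 0, so the requirement M ≥ 1 in admissibility certifies
that the drift is Lipschitz. -/
lemma exists_lipschitzWith_of_lipConst_pos {f : E d → E d} (h : 0 < lipConst f) :
    ∃ K, LipschitzWith K f := by
  by_contra hne
  push Not at hne
  have : {K : ℝ≥0 | LipschitzWith K f} = ∅ := by ext K; simpa using hne K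
  rw [lipConst, this, NNReal.sInf_empty] at h
  simp at h

/-- The properties of the tamed drift that the contraction argument uses. -/
structure DriftBounds (m M : ℝ) (b : E d → E d) : Prop where
  two_mul_le : 2 * m ≤ M
  lipschitz : ∀ x y, ‖b x - b y‖ ≤ M * ‖x - y‖
  strongly_monotone : ∀ x y, m * ‖x - y‖ ^ 2 ≤ inner ℝ (b x - b y) (x - y)
  cocoercive : ∀ x y, ‖b x - b y‖ ^ 2 ≤ 2 * M * inner ℝ (b x - b y) (x - y)

lemma nontrivial_E (hd : 1 ≤ d) : Nontrivial (E d) := by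
  have : Nonempty (Fin d) := ⟨⟨0, hd⟩⟩
  exact inferInstanceAs (Nontrivial (EuclideanSpace ℝ (Fin d)))

lemma driftBounds_tamedDrift (hd : 1 ≤ d) (hm : 0 < m) (hl : 0 < l)
    (hu : PotentialAssumptions m L l u) (hr : 2 ≤ radius m L l lam)
    (hlip : ∃ K, LipschitzWith K (tamedDrift m L l u lam)) :
    DriftBounds m (tamedLip m L l u lam) (tamedDrift m L l u lam) ∧
      gSup m u (radius m L l lam) * radius m L l lam + 2 * m ≤ tamedLip m L l u lam := by
  have := nontrivial_E hd
  have hg := hu.continuous_gDrift hl.le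
  have hr0 : 0 < radius m L l lam := by linarith
  have hR := gSup_nonneg hg hr0
  have hL := norm_sub_le_lipConst hlip
  have hMR := le_lipschitz_tamed hr hu.gDrift_monotone (fun x y => by
    simpa only [tamedDrift_eq] using hL x y)
  have hco := tameField_cocoercive hr hR hm hu.hasGradientAt_gDrift hg
    (fun x hx => norm_gDrift_le_gSup hg hr0 hx) hu.gDrift_monotone (fun x y => by
    simpa only [tamedDrift_eq] using hL x y)
  have h2m : 2 * m ≤ lipConst (tamedDrift m L l u lam) := by
    have : 0 ≤ gSup m u (radius m L l lam) * radius m L l lam := by positivity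
    linarith
  have hsub : ∀ x y, tamedDrift m L l u lam x - tamedDrift m L l u lam y =
      (tameField (radius m L l lam) (gSup m u (radius m L l lam)) (gDrift m u) x -
      tameField (radius m L l lam) (gSup m u (radius m L l lam)) (gDrift m u) y) + m • (x - y) := by
    intro x y; rw [tamedDrift_eq, tamedDrift_eq]; module
  refine ⟨⟨h2m, hL, fun x y => ?_, fun x y => ?_⟩, hMR⟩
  · rw [hsub, inner_add_left, real_inner_smul_left, real_inner_self_eq_norm_sq]
    have := nonneg_of_mul_nonneg_right ((sq_nonneg _).trans (hco y x)) (by linarith)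
    linarith
  · have h1 := cocoercive_add (by linarith) hm.le (hco y x) (cocoercive_smul_self (m := m))
    rw [← hsub] at h1
    refine h1.trans (mul_le_mul_of_nonneg_right ?_ ?_)
    · unfold tamedLip; linarith
    · exact nonneg_of_mul_nonneg_right ((sq_nonneg _).trans h1) (by linarith)

lemma PotentialAssumptions.norm_gDrift_sub_le (hm : 0 ≤ m) (hL : 0 ≤ L) (hl : 0 ≤ l)
    (hu : PotentialAssumptions m L l u) {r : ℝ} (hr : 1 ≤ r) {x y : E d} (hx : ‖x‖ ≤ r)
    (hy : ‖y‖ ≤ r) : ‖gDrift m u x - gDrift m u y‖ ≤ (L * 3 ^ l * r ^ l + m) * ‖x - y‖ := by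
  have h1 : gDrift m u x - gDrift m u y = (∇ u x - ∇ u y) - m • (x - y) := by
    unfold gDrift; module
  have h2 : (1 + ‖x‖ + ‖y‖) ^ l ≤ 3 ^ l * r ^ l := by
    rw [← Real.mul_rpow (by norm_num) (by linarith)]
    exact Real.rpow_le_rpow (by positivity) (by linarith) hl
  calc _ ≤ ‖∇ u x - ∇ u y‖ + ‖m • (x - y)‖ := by rw [h1]; exact norm_sub_le _ _
    _ ≤ L * (3 ^ l * r ^ l) * ‖x - y‖ + m * ‖x - y‖ := by
      rw [norm_smul, Real.norm_of_nonneg hm]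
      have := hu.locally_lipschitz x y
      gcongr
      refine this.trans ?_
      gcongr
    _ = _ := by ring

/-- The exponent in the radius is chosen for this identity: R r grows at most like r^(l+2), hence
like λ^(-1/2). -/
lemma radius_rpow (hL : 0 < L) (hm : 0 < m) (hl : 0 < l) (hlam : 0 < lam) :
    radius m L l lam ^ (l + 2) = (L + m) ^ (l + 2) / √lam := by
  unfold radius
  rw [Real.mul_rpow (by positivity) (by positivity), ← Real.rpow_mul (by positivity),
    one_div_mul_cancel (by positivity), Real.rpow_one, mul_one_div]

/-- The tamed drift is Lipschitz with a constant of order `1 / √λ`. -/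
lemma exists_tamedLip_le (hm : 0 < m) (hL : 0 < L) (hl : 0 < l)
    (hu : PotentialAssumptions m L l u) : ∃ C : ℝ, 0 < C ∧ ∀ lam, 0 < lam →
      2 ≤ radius m L l lam → (∃ K, LipschitzWith K (tamedDrift m L l u lam)) ∧
        tamedLip m L l u lam ≤ C / √lam := by
  set H := ‖∇ u 0‖ with hH
  have hH0 : 0 ≤ H := norm_nonneg _
  refine ⟨(2 * (L * 3 ^ l) + H + 3 * m) * (L + m) ^ (l + 2), by positivity, fun lam hlam hr => ?_⟩
  have hg := hu.continuous_gDrift hl.le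
  set r := radius m L l lam with hrdef
  have hr0 : 0 < r := by linarith
  have hr1 : 1 ≤ r := by linarith
  have hR := gSup_nonneg (m := m) hg hr0
  have hG : 0 ≤ L * 3 ^ l * r ^ l + m := by positivity
  have hf := norm_tameField_sub_le (g := gDrift m u) hr hR hG hg
    (fun x hx => norm_gDrift_le_gSup hg hr0 hx)
    (fun x y hx hy => hu.norm_gDrift_sub_le hm.le hL.le hl.le hr1 hx hy)
  set R := gSup m u r
  have hRle : R ≤ (L * 3 ^ l * r ^ l + m) * r + H := by
    refine gSup_le hr0 fun x hx => ?_
    have h1 := hu.norm_gDrift_sub_le hm.le hL.le hl.le hr1 hx (y := 0) (by simpa using hr0.le)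
    have h2 : gDrift m u 0 = ∇ u 0 := by simp [gDrift]
    rw [h2, sub_zero] at h1
    have h3 : ‖gDrift m u x‖ ≤ ‖gDrift m u x - ∇ u 0‖ + ‖∇ u 0‖ := by
      simpa using norm_add_le (gDrift m u x - ∇ u 0) (∇ u 0)
    have h4 : (L * 3 ^ l * r ^ l + m) * ‖x‖ ≤ (L * 3 ^ l * r ^ l + m) * r := by gcongr
    linarith
  have hlip : ∀ x y, ‖tamedDrift m L l u lam x - tamedDrift m L l u lam y‖ ≤
      (L * 3 ^ l * r ^ l + m + R * r + m) * ‖x - y‖ := by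
    intro x y
    have h1 : tamedDrift m L l u lam x - tamedDrift m L l u lam y =
      (tameField r R (gDrift m u) x - tameField r R (gDrift m u) y) + m • (x - y) := by
      rw [tamedDrift_eq, tamedDrift_eq]; module
    have h2 := norm_add_le (tameField r R (gDrift m u) x - tameField r R (gDrift m u) y)
      (m • (x - y))
    rw [norm_smul, Real.norm_of_nonneg hm.le] at h2
    rw [h1]
    linarith [hf y x]
  have hC0 : 0 ≤ L * 3 ^ l * r ^ l + m + R * r + m := by positivity
  refine ⟨⟨⟨_, hC0⟩, LipschitzWith.of_dist_le_mul fun x y => by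
    rw [dist_eq_norm, dist_eq_norm]; exact hlip x y⟩, (lipConst_le hC0 hlip).trans ?_⟩
  rw [mul_div_assoc, ← radius_rpow hL hm hl hlam, ← hrdef, Real.rpow_add hr0, Real.rpow_two]
  set a := r ^ l with ha
  have ha1 : 1 ≤ a := Real.one_le_rpow hr1 hl.le
  set b := L * 3 ^ l with hb
  have hb0 : 0 < b := by positivity
  have h1 : R * r ≤ ((b * a + m) * r + H) * r := by gcongr
  have h2 : 1 ≤ r ^ 2 := one_le_pow₀ hr1
  have h3 : r ≤ r ^ 2 := by nlinarith
  have h4 : 1 ≤ a * r ^ 2 := one_le_mul_of_one_le_of_one_le ha1 h2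
  have h5 : a ≤ a * r ^ 2 := le_mul_of_one_le_right (by linarith) h2
  have h6 : r ^ 2 ≤ a * r ^ 2 := le_mul_of_one_le_left (by linarith) ha1
  have h7 : r ≤ a * r ^ 2 := h3.trans h6
  nlinarith [mul_le_mul_of_nonneg_left h5 hb0.le, mul_le_mul_of_nonneg_left h4 hm.le,
    mul_le_mul_of_nonneg_left h6 hm.le, mul_le_mul_of_nonneg_left h7 hH0]

/-- Monotonicity of g between antipodal points of the sphere of radius r forces R ≥ m r, and R r ≤
M. Small steps have large radii, so this secures M ≥ 1 for them. -/
lemma mul_radius_sq_le_tamedLip (hd : 1 ≤ d) (hm : 0 < m) (hl : 0 < l)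
    (hu : PotentialAssumptions m L l u) (hr : 2 ≤ radius m L l lam)
    (hlip : ∃ K, LipschitzWith K (tamedDrift m L l u lam)) :
    m * radius m L l lam ^ 2 ≤ tamedLip m L l u lam := by
  have h1 := (driftBounds_tamedDrift hd hm hl hu hr hlip).2
  have := nontrivial_E hd
  set r := radius m L l lam
  have hr0 : 0 < r := by linarith
  obtain ⟨e, he⟩ := exists_norm_eq (E d) hr0.le
  have hg := hu.continuous_gDrift hl.le
  have h2 := norm_gDrift_le_gSup hg hr0 (x := e) he.le
  have h3 := norm_gDrift_le_gSup hg hr0 (x := -e) (by rw [norm_neg]; exact he.le)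
  have h4 := hu.gDrift_monotone e (-e)
  have h5 := real_inner_le_norm (gDrift m u e - gDrift m u (-e)) (e - -e)
  have h6 : ‖e - -e‖ = 2 * r := by
    rw [sub_neg_eq_add, ← two_smul ℝ, norm_smul, he]; norm_num
  have h7 := norm_sub_le (gDrift m u e) (gDrift m u (-e))
  rw [h6] at h4 h5
  have h8 : ‖gDrift m u e - gDrift m u (-e)‖ * (2 * r) ≤ (2 * gSup m u r) * (2 * r) := by
    gcongr; linarith
  have h9 : m * r ^ 2 ≤ gSup m u r * r := by nlinarith
  linarith

end Drift

/-! ### Normalisation of Gibbs measures -/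

section GibbsMeasure

variable {X : Type*} [MeasureSpace X] {V : X → ℝ}

/-- The normalising constant of a Gibbs measure. -/
def partitionFn (V : X → ℝ) : ℝ≥0∞ := ∫⁻ x, ENNReal.ofReal (Real.exp (-V x))

lemma gibbs_def (V : X → ℝ) : gibbs V = (partitionFn V)⁻¹ •
    (volume : Measure X).withDensity fun x => ENNReal.ofReal (Real.exp (-V x)) := rfl

lemma partitionFn_ne_zero (hV : Measurable V) [NeZero (volume : Measure X)] :
    partitionFn V ≠ 0 := by
  rw [partitionFn, Ne, lintegral_eq_zero_iff (by fun_prop)]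
  intro h
  have : ∀ᵐ _ : X, False := by
    filter_upwards [h] with x hx
    have := Real.exp_pos (-V x)
    simp only [Pi.zero_apply, ENNReal.ofReal_eq_zero] at hx
    linarith
  exact NeZero.ne (volume : Measure X) (by simpa using this)

lemma isProbabilityMeasure_gibbs (h0 : partitionFn V ≠ 0) (h : partitionFn V ≠ ∞) :
    IsProbabilityMeasure (gibbs V) := by
  constructor
  rw [gibbs_def, Measure.smul_apply, withDensity_apply _ MeasurableSet.univ, Measure.restrict_univ,
    smul_eq_mul]
  exact ENNReal.inv_mul_cancel h0 h

end GibbsMeasure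

/-! ### The standard Gaussian as a Gibbs measure, and its rotation invariance -/

section Gaussian

variable {d : ℕ}

instance : NeZero (volume : Measure (E d)) := inferInstance

lemma integrable_exp_neg_mul_norm_sq {b : ℝ} (hb : 0 < b) :
    Integrable (fun v : E d => Real.exp (-b * ‖v‖ ^ 2)) := by
  have h := (GaussianFourier.integrable_cexp_neg_mul_sq_norm_add (V := E d) (b := b)
    (by simpa using hb) 0 0).norm
  refine h.congr (ae_of_all _ fun v => ?_)
  simp only [Complex.norm_exp]
  norm_cast
  simp

lemma lintegral_exp_neg_mul_norm_sq_lt_top {b : ℝ} (hb : 0 < b) :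
    ∫⁻ v : E d, ENNReal.ofReal (Real.exp (-b * ‖v‖ ^ 2)) < ∞ := by
  have h := (integrable_exp_neg_mul_norm_sq (d := d) hb).lintegral_lt_top
  exact h

lemma partitionFn_gaussian_ne_top : partitionFn (fun v : E d => ‖v‖ ^ 2 / 2) ≠ ∞ := by
  have h := lintegral_exp_neg_mul_norm_sq_lt_top (d := d) (b := 1 / 2) (by norm_num)
  rw [partitionFn]
  refine ne_of_lt (lt_of_eq_of_lt (lintegral_congr fun v => ?_) h)
  congr 2; ring

lemma gibbs_gaussian : gibbs (fun v : E d => ‖v‖ ^ 2 / 2) = stdGaussian (E d) := by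
  have hprob := isProbabilityMeasure_gibbs
    (partitionFn_ne_zero (V := fun v : E d => ‖v‖ ^ 2 / 2) (by fun_prop)) partitionFn_gaussian_ne_top
  have key : ∀ t : E d, charFun (gibbs (fun v : E d => ‖v‖ ^ 2 / 2)) t =
      ((partitionFn (fun v : E d => ‖v‖ ^ 2 / 2))⁻¹.toReal : ℂ) *
      ((Real.pi / (1 / 2 : ℂ)) ^ (Module.finrank ℝ (E d) / 2 : ℂ) *
        Complex.exp (-‖t‖ ^ 2 / 2)) := by
    intro t
    rw [charFun_apply, gibbs_def, integral_smul_measure,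
      integral_withDensity_eq_integral_toReal_smul (by fun_prop) (by simp)]
    have h1 := GaussianFourier.integral_cexp_neg_mul_sq_norm_add (V := E d) (b := 1 / 2)
      (by norm_num) Complex.I t
    have h2 : (Complex.I ^ 2 * (‖t‖ : ℂ) ^ 2 / (4 * (1 / 2))) = -‖t‖ ^ 2 / 2 := by
      rw [Complex.I_sq]; ring
    rw [h2] at h1
    rw [← h1, Complex.real_smul]
    congr 1
    refine integral_congr_ae (ae_of_all _ fun v => ?_)
    simp only
    rw [ENNReal.toReal_ofReal (Real.exp_pos _).le, Complex.real_smul, Complex.ofReal_exp,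
      ← Complex.exp_add]
    congr 1
    push_cast
    rw [real_inner_comm]
    ring
  -- At t = 0 the characteristic function of a probability measure is 1, which determines the
  -- product of the constants without computing the Gaussian integral.
  have hz := key 0
  rw [charFun_zero, probReal_univ] at hz
  simp only [norm_zero, Complex.ofReal_zero] at hz
  refine Measure.ext_of_charFun ?_
  ext t
  rw [key t, charFun_stdGaussian, ← mul_assoc]
  norm_num at hz ⊢
  rw [← hz]

/-- The standard Gaussian measure is invariant under partial refreshment. -/
lemma map_rotation_stdGaussian {a b : ℝ} (hab : a ^ 2 + b ^ 2 = 1) :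
    ((stdGaussian (E d)).prod (stdGaussian (E d))).map (fun p => a • p.1 + b • p.2) =
      stdGaussian (E d) := by
  have h1 : ((stdGaussian (E d)).prod (stdGaussian (E d))).map (fun p => a • p.1 + b • p.2) =
      (((stdGaussian (E d)).map (a • ·)).prod ((stdGaussian (E d)).map (b • ·))).map
        (fun p => p.1 + p.2) := by
    rw [Measure.map_prod_map _ _ (by fun_prop) (by fun_prop),
      Measure.map_map (by fun_prop) (by fun_prop)]
    rfl
  have p1 : IsProbabilityMeasure ((stdGaussian (E d)).map (a • ·)) :=
    Measure.isProbabilityMeasure_map (by fun_prop)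
  have p2 : IsProbabilityMeasure ((stdGaussian (E d)).map (b • ·)) :=
    Measure.isProbabilityMeasure_map (by fun_prop)
  have p3 : IsProbabilityMeasure ((((stdGaussian (E d)).map (a • ·)).prod
      ((stdGaussian (E d)).map (b • ·))).map (fun p => p.1 + p.2)) :=
    Measure.isProbabilityMeasure_map (by fun_prop)
  rw [h1]
  refine Measure.ext_of_charFun ?_
  rw [charFun_map_add_prod_eq_mul]
  ext t
  rw [Pi.mul_apply, charFun_map_smul, charFun_map_smul, charFun_stdGaussian, charFun_stdGaussian,
    charFun_stdGaussian, ← Complex.exp_add, norm_smul, norm_smul]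
  congr 1
  norm_cast
  rw [mul_pow, mul_pow, Real.norm_eq_abs, Real.norm_eq_abs, sq_abs, sq_abs]
  linear_combination (-‖t‖ ^ 2 / 2) * hab

end Gaussian

/-! ### The target measures and their invariance under refreshment -/

section Target

variable {d : ℕ} {m L l : ℝ} {u : E d → ℝ}

lemma PotentialAssumptions.hasGradientAt (hu : PotentialAssumptions m L l u) (x : E d) :
    HasGradientAt u (∇ u x) x := (hu.differentiable x).hasGradientAt

lemma PotentialAssumptions.tangent_le (hu : PotentialAssumptions m L l u) (x y : E d) :
    u x + inner ℝ (∇ u x) (y - x) + m * ‖y - x‖ ^ 2 ≤ u y := by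
  have h := add_inner_le_of_monotone hu.hasGradientAt hu.strongly_monotone x y
  linarith

lemma PotentialAssumptions.lower (hu : PotentialAssumptions m L l u) (x : E d) :
    u 0 - ‖∇ u 0‖ * ‖x‖ + m * ‖x‖ ^ 2 ≤ u x := by
  have h := hu.tangent_le 0 x
  rw [sub_zero] at h
  have h1 := (abs_le.1 (abs_real_inner_le_norm (∇ u 0) x)).1
  linarith

lemma PotentialAssumptions.lower_quarter (hm : 0 < m) (hu : PotentialAssumptions m L l u)
    (x : E d) : u 0 - ‖∇ u 0‖ ^ 2 / (4 * m) ≤ u x := by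
  have h := hu.lower x
  have h1 : m * ‖x‖ ^ 2 - ‖∇ u 0‖ * ‖x‖ + ‖∇ u 0‖ ^ 2 / (4 * m) =
      m * (‖x‖ - ‖∇ u 0‖ / (2 * m)) ^ 2 := by field_simp; ring
  have h2 : 0 ≤ m * (‖x‖ - ‖∇ u 0‖ / (2 * m)) ^ 2 := by positivity
  linarith

/-- The tangent inequality at θx, evaluated at x and at 0 with weights θ and 1 - θ; the gradient
terms cancel. -/
lemma PotentialAssumptions.strong_convex (hu : PotentialAssumptions m L l u) {θ : ℝ}
    (h0 : 0 ≤ θ) (h1 : θ ≤ 1) (x : E d) :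
    u (θ • x) ≤ θ * u x + (1 - θ) * u 0 - θ * (1 - θ) * (m * ‖x‖ ^ 2) := by
  have a := hu.tangent_le (θ • x) x
  have b := hu.tangent_le (θ • x) 0
  have e1 : x - θ • x = (1 - θ) • x := by module
  rw [e1, real_inner_smul_right, norm_smul, mul_pow, Real.norm_eq_abs, sq_abs] at a
  rw [zero_sub, inner_neg_right, norm_neg, real_inner_smul_right, norm_smul, mul_pow,
    Real.norm_eq_abs, sq_abs] at b
  linarith [mul_le_mul_of_nonneg_left a h0, mul_le_mul_of_nonneg_left b (sub_nonneg.2 h1)]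

lemma partitionFn_potential_ne_top (hm : 0 < m) (hu : PotentialAssumptions m L l u) :
    partitionFn u ≠ ∞ := by
  have h := lintegral_exp_neg_mul_norm_sq_lt_top (d := d) (b := m / 2) (by positivity)
  have h2 : partitionFn u ≤ ∫⁻ x : E d, ENNReal.ofReal (Real.exp (-u 0 + ‖∇ u 0‖ ^ 2 / (2 * m))) *
      ENNReal.ofReal (Real.exp (-(m / 2) * ‖x‖ ^ 2)) := by
    refine lintegral_mono fun x => ?_
    rw [← ENNReal.ofReal_mul (Real.exp_pos _).le, ← Real.exp_add]
    refine ENNReal.ofReal_le_ofReal (Real.exp_le_exp.2 ?_)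
    have h := hu.lower x
    have h1 : m / 2 * ‖x‖ ^ 2 - ‖∇ u 0‖ * ‖x‖ + ‖∇ u 0‖ ^ 2 / (2 * m) =
        m / 2 * (‖x‖ - ‖∇ u 0‖ / m) ^ 2 := by field_simp; ring
    have h2 : 0 ≤ m / 2 * (‖x‖ - ‖∇ u 0‖ / m) ^ 2 := by positivity
    linarith
  rw [lintegral_const_mul _ (by fun_prop)] at h2
  exact ne_of_lt (h2.trans_lt (ENNReal.mul_lt_top ENNReal.ofReal_lt_top h))

/-- The potential of the extended target. -/
def energy (u : E d → ℝ) (z : Phase d) : ℝ := ‖z.2‖ ^ 2 / 2 + u z.1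

lemma PotentialAssumptions.measurable (hu : PotentialAssumptions m L l u) : Measurable u :=
  hu.differentiable.continuous.measurable

lemma PotentialAssumptions.measurable_energy (hu : PotentialAssumptions m L l u) :
    Measurable (energy u) := by
  have := hu.measurable
  unfold energy
  fun_prop

lemma isProbabilityMeasure_targetPos (hm : 0 < m) (hu : PotentialAssumptions m L l u) :
    IsProbabilityMeasure (targetPos u) :=
  isProbabilityMeasure_gibbs (partitionFn_ne_zero hu.measurable) (partitionFn_potential_ne_top hm hu)

lemma partitionFn_energy (hu : PotentialAssumptions m L l u) :
    partitionFn (energy u) = partitionFn u * partitionFn (fun v : E d => ‖v‖ ^ 2 / 2) := by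
  have := hu.measurable
  rw [partitionFn, partitionFn, partitionFn, Measure.volume_eq_prod,
    ← lintegral_prod_mul (by fun_prop) (by fun_prop)]
  refine lintegral_congr fun z => ?_
  rw [← ENNReal.ofReal_mul (Real.exp_pos _).le, ← Real.exp_add, energy]
  congr 2; ring

lemma partitionFn_energy_ne_top (hm : 0 < m) (hu : PotentialAssumptions m L l u) :
    partitionFn (energy u) ≠ ∞ := by
  rw [partitionFn_energy hu]
  exact ENNReal.mul_ne_top (partitionFn_potential_ne_top hm hu) partitionFn_gaussian_ne_top

lemma partitionFn_energy_ne_zero (hu : PotentialAssumptions m L l u) :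
    partitionFn (energy u) ≠ 0 := by
  rw [partitionFn_energy hu]
  exact mul_ne_zero (partitionFn_ne_zero hu.measurable) (partitionFn_ne_zero (by fun_prop))

lemma targetPhase_def (u : E d → ℝ) : targetPhase u = gibbs (energy u) := rfl

lemma isProbabilityMeasure_targetPhase (hm : 0 < m) (hu : PotentialAssumptions m L l u) :
    IsProbabilityMeasure (targetPhase u) :=
  isProbabilityMeasure_gibbs (partitionFn_energy_ne_zero hu) (partitionFn_energy_ne_top hm hu)

lemma targetPhase_eq_prod (hu : PotentialAssumptions m L l u) :
    targetPhase u = (targetPos u).prod (stdGaussian (E d)) := by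
  have hmeas := hu.measurable
  rw [← gibbs_gaussian, targetPhase_def, targetPos, gibbs_def, gibbs_def, gibbs_def,
    Measure.prod_smul_left, Measure.prod_smul_right, smul_smul,
    prod_withDensity (by fun_prop) (by fun_prop), partitionFn_energy hu,
    ENNReal.mul_inv (Or.inl (partitionFn_ne_zero hmeas))
      (Or.inr (partitionFn_ne_zero (by fun_prop))), Measure.volume_eq_prod]
  congr 2
  ext z
  rw [← ENNReal.ofReal_mul (Real.exp_pos _).le, ← Real.exp_add, energy]
  congr 2; ring

lemma map_fst_targetPhase (hu : PotentialAssumptions m L l u) :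
    (targetPhase u).map Prod.fst = targetPos u := by
  rw [targetPhase_eq_prod hu, Measure.map_fst_prod, measure_univ, one_smul]

lemma continuous_stepO (lam γ : ℝ) : Continuous fun q : Phase d × E d => stepO lam γ q.1 q.2 := by
  unfold stepO
  fun_prop

/-- The partial velocity refreshment preserves the extended target. -/
lemma map_stepO_targetPhase (hm : 0 < m) (hu : PotentialAssumptions m L l u) {lam γ : ℝ}
    (hlam : 0 ≤ lam * γ) :
    ((targetPhase u).prod (stdGaussian (E d))).map (fun q => stepO lam γ q.1 q.2) =
      targetPhase u := by
  have := isProbabilityMeasure_targetPos hm hu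
  set e := Real.exp (-(lam * γ) / 2)
  have he0 : 0 < e := Real.exp_pos _
  have he1 : e ≤ 1 := Real.exp_le_one_iff.2 (by linarith)
  have hsq : e ^ 2 + √(1 - e ^ 2) ^ 2 = 1 := by
    rw [Real.sq_sqrt (by nlinarith)]; ring
  rw [targetPhase_eq_prod hu]
  have h1 : (fun q : Phase d × E d => stepO lam γ q.1 q.2) =
      (Prod.map id (fun p : E d × E d => e • p.1 + √(1 - e ^ 2) • p.2)) ∘
        MeasurableEquiv.prodAssoc := by
    ext q <;> rfl
  rw [h1, ← Measure.map_map (by fun_prop) (by fun_prop),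
    (measurePreserving_prodAssoc (targetPos u) (stdGaussian (E d)) (stdGaussian (E d))).map_eq,
    ← Measure.map_prod_map _ _ (by fun_prop) (by fun_prop), map_rotation_stdGaussian hsq,
    Measure.map_id]

end Target

/-! ### Moments of the target, with polynomial dependence on the dimension -/

section Moments

instance (d : ℕ) : (volume : Measure (Phase d)).IsAddHaarMeasure :=
  inferInstanceAs ((volume : Measure (E d)).prod (volume : Measure (E d))).IsAddHaarMeasure

variable {d : ℕ} {m L l : ℝ} {u : E d → ℝ}

lemma energy_smul_le (hu : PotentialAssumptions m L l u) {θ : ℝ} (h0 : 0 ≤ θ) (h1 : θ ≤ 1)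
    (z : Phase d) : energy u (θ • z) ≤ θ * energy u z + (1 - θ) * u 0
      - θ * (1 - θ) * (m * ‖z.1‖ ^ 2 + ‖z.2‖ ^ 2 / 2) := by
  have h := hu.strong_convex h0 h1 z.1
  simp only [energy, Prod.smul_fst, Prod.smul_snd, norm_smul, mul_pow, Real.norm_eq_abs, sq_abs]
  linarith

lemma energy_lower (hm : 0 < m) (hu : PotentialAssumptions m L l u) (z : Phase d) :
    u 0 - ‖∇ u 0‖ ^ 2 / (4 * m) ≤ energy u z := by
  have h := hu.lower_quarter hm z.1
  have : 0 ≤ ‖z.2‖ ^ 2 / 2 := by positivity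
  unfold energy; linarith

/-- A dimension-dependent exponential moment of the extended target, by scaling. -/
lemma lintegral_exp_moment_le (hd : 1 ≤ d) (hm : 0 < m) (hu : PotentialAssumptions m L l u) :
    ∫⁻ z, ENNReal.ofReal (Real.exp ((m * ‖z.1‖ ^ 2 + ‖z.2‖ ^ 2 / 2) / (4 * d))) ∂(targetPhase u) ≤
      ENNReal.ofReal (2 * Real.exp (‖∇ u 0‖ ^ 2 / (4 * m))) := by
  have hd' : (1 : ℝ) ≤ d := by exact_mod_cast hd
  have hmeas := hu.measurable_energy
  set B := ‖∇ u 0‖ ^ 2 / (4 * m) with hB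
  have hB0 : 0 ≤ B := by positivity
  -- With this θ the Jacobian θ^(-2d) of the scaling in dimension 2d is at most 2 by Bernoulli's
  -- inequality, and the gain of strong convexity is (1 - θ) q = q/(4d).
  set θ : ℝ := 1 - 1 / (4 * d) with hθ
  have hsmall : 1 / (4 * (d : ℝ)) ≤ 1 / 4 := by
    rw [div_le_div_iff₀ (by positivity) (by norm_num)]; linarith
  have hpos : 0 < 1 / (4 * (d : ℝ)) := by positivity
  have hθ0 : 0 < θ := by linarith
  have hθ1 : θ ≤ 1 := by linarith
  have point : ∀ z : Phase d, Real.exp (-energy u z) *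
      Real.exp ((m * ‖z.1‖ ^ 2 + ‖z.2‖ ^ 2 / 2) / (4 * d)) ≤
        Real.exp B * Real.exp (-energy u (θ • z)) := by
    intro z
    rw [← Real.exp_add, ← Real.exp_add, Real.exp_le_exp]
    have h1 := energy_smul_le hu hθ0.le hθ1 z
    have h2 := energy_lower hm hu (θ • z)
    set q := m * ‖z.1‖ ^ 2 + ‖z.2‖ ^ 2 / 2
    have h3 : q / (4 * d) = (1 - θ) * q := by rw [hθ]; ring
    rw [h3]
    -- One part θ of the energy at θz is kept; the remaining part 1 - θ is bounded below by u 0 - B.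
    -- Finally 1 - θ ≤ θ allows division by θ.
    have h4 : θ * (-energy u z + (1 - θ) * q) ≤ θ * (B + -energy u (θ • z)) := by
      have h5 : (1 - θ) * (u 0 - B) ≤ (1 - θ) * energy u (θ • z) :=
        mul_le_mul_of_nonneg_left h2 (by linarith)
      have h6 : (1 - θ) * B ≤ θ * B := mul_le_mul_of_nonneg_right (by linarith) hB0
      linarith
    exact le_of_mul_le_mul_left h4 hθ0
  have hscale : ∫⁻ z : Phase d, ENNReal.ofReal (Real.exp (-energy u (θ • z))) ≤
      2 * partitionFn (energy u) := by
    have h1 : ∫⁻ z : Phase d, ENNReal.ofReal (Real.exp (-energy u (θ • z))) =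
        ∫⁻ z, ENNReal.ofReal (Real.exp (-energy u z)) ∂((volume : Measure (Phase d)).map (θ • ·)) := by
      rw [lintegral_map (by fun_prop) (by fun_prop)]
    rw [h1, Measure.map_addHaar_smul _ hθ0.ne', lintegral_smul_measure, smul_eq_mul, partitionFn]
    gcongr
    refine ENNReal.ofReal_le_of_le_toReal ?_
    rw [ENNReal.toReal_ofNat]
    have hfin : Module.finrank ℝ (Phase d) = 2 * d := by
      rw [Module.finrank_prod, finrank_euclideanSpace, Fintype.card_fin]; ring
    rw [hfin, abs_of_pos (by positivity)]
    have h2 : 1 / 2 ≤ θ ^ (2 * d) := by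
      have h3 := one_add_mul_le_pow (a := -(1 / (4 * (d : ℝ)))) (by linarith) (2 * d)
      rw [← sub_eq_add_neg, ← hθ] at h3
      refine le_trans (le_of_eq ?_) h3
      push_cast; field_simp; ring
    rw [inv_le_comm₀ (by positivity) (by norm_num)]
    linarith
  rw [targetPhase_def, gibbs_def, lintegral_smul_measure,
    lintegral_withDensity_eq_lintegral_mul _ (by fun_prop) (by fun_prop), smul_eq_mul]
  have hle : ∫⁻ z : Phase d, ENNReal.ofReal (Real.exp (-energy u z)) *
      ENNReal.ofReal (Real.exp ((m * ‖z.1‖ ^ 2 + ‖z.2‖ ^ 2 / 2) / (4 * d))) ≤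
      ENNReal.ofReal (Real.exp B) * (2 * partitionFn (energy u)) := by
    refine le_trans (lintegral_mono
      (g := fun z => ENNReal.ofReal (Real.exp B) * ENNReal.ofReal (Real.exp (-energy u (θ • z))))
      fun z => ?_) ?_
    · beta_reduce
      rw [← ENNReal.ofReal_mul (Real.exp_pos _).le, ← ENNReal.ofReal_mul (Real.exp_pos _).le]
      exact ENNReal.ofReal_le_ofReal (point z)
    · rw [lintegral_const_mul _ (by fun_prop)]
      gcongr
  calc _ ≤ (partitionFn (energy u))⁻¹ * (ENNReal.ofReal (Real.exp B) *
        (2 * partitionFn (energy u))) := mul_le_mul_right hle _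
    _ = (partitionFn (energy u))⁻¹ * partitionFn (energy u) *
        (2 * ENNReal.ofReal (Real.exp B)) := by ring
    _ = ENNReal.ofReal (2 * Real.exp B) := by
      rw [ENNReal.inv_mul_cancel (partitionFn_energy_ne_zero hu) (partitionFn_energy_ne_top hm hu),
        one_mul, ENNReal.ofReal_mul (by norm_num)]
      simp

/-- Polynomial moments of the extended target grow polynomially with the dimension. -/
lemma exists_moment_bound {m : ℝ} (hm : 0 < m) (H : ℝ) (k : ℕ) : ∃ K : ℝ, 0 < K ∧
    ∀ (d : ℕ), 1 ≤ d → ∀ (L l : ℝ) (u : E d → ℝ), PotentialAssumptions m L l u → ‖∇ u 0‖ ≤ H →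
      ∫⁻ z, ENNReal.ofReal ((1 + ‖z.1‖ + ‖z.2‖) ^ (2 * k)) ∂(targetPhase u) ≤
        ENNReal.ofReal (K * (d : ℝ) ^ k) := by
  set c := min m (1 / 2) with hc
  have hc0 : 0 < c := lt_min hm (by norm_num)
  have hcm : c ≤ m := min_le_left _ _
  have hc2 : c ≤ 1 / 2 := min_le_right _ _
  set D := (12 / c) ^ k * k.factorial * Real.exp 1 with hD
  have hD0 : 0 < D := by positivity
  refine ⟨D * (2 * Real.exp (H ^ 2 / (4 * m))), by positivity, fun d hd L l u hu hH => ?_⟩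
  have hd' : (1 : ℝ) ≤ d := by exact_mod_cast hd
  have point : ∀ z : Phase d, (1 + ‖z.1‖ + ‖z.2‖) ^ (2 * k) ≤ D * (d : ℝ) ^ k *
      Real.exp ((m * ‖z.1‖ ^ 2 + ‖z.2‖ ^ 2 / 2) / (4 * d)) := by
    intro z
    set a := ‖z.1‖
    set b := ‖z.2‖
    have h1 : (1 + a + b) ^ 2 ≤ 3 * (1 + (a ^ 2 + b ^ 2)) := by
      nlinarith [sq_nonneg (a - b), sq_nonneg (1 - a), sq_nonneg (1 - b)]
    set s := a ^ 2 + b ^ 2 with hs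
    have hs0 : 0 ≤ s := by positivity
    -- The power is traded for an exponential through w^k ≤ k! e^w; since 3(1 + s) is a constant
    -- times d w, the trade costs d^k.
    set w := c * (1 + s) / (4 * d) with hw
    have hw0 : 0 ≤ w := by positivity
    have h2 : 3 * (1 + s) = (12 / c) * d * w := by rw [hw]; field_simp; norm_num
    have h3 : w ^ k ≤ k.factorial * Real.exp w := by
      have := Real.pow_div_factorial_le_exp (x := w) hw0 k
      rwa [div_le_iff₀ (by positivity), mul_comm] at this
    have h4 : w ≤ 1 + (m * a ^ 2 + b ^ 2 / 2) / (4 * d) := by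
      have h5 : 1 + (m * a ^ 2 + b ^ 2 / 2) / (4 * d) =
          (4 * d + (m * a ^ 2 + b ^ 2 / 2)) / (4 * d) := by field_simp
      rw [hw, h5]
      gcongr
      rw [hs]
      nlinarith [mul_le_mul_of_nonneg_right hcm (sq_nonneg a), mul_le_mul_of_nonneg_right hc2
        (sq_nonneg b)]
    calc (1 + a + b) ^ (2 * k) = ((1 + a + b) ^ 2) ^ k := pow_mul _ _ _
      _ ≤ ((12 / c) * d * w) ^ k := by rw [← h2]; gcongr
      _ = (12 / c) ^ k * d ^ k * w ^ k := by rw [mul_pow, mul_pow]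
      _ ≤ (12 / c) ^ k * d ^ k * (k.factorial *
          Real.exp (1 + (m * a ^ 2 + b ^ 2 / 2) / (4 * d))) := by
        gcongr
        exact h3.trans (by gcongr)
      _ = _ := by rw [Real.exp_add, hD]; ring
  calc _ ≤ ∫⁻ z, ENNReal.ofReal (D * (d : ℝ) ^ k) * ENNReal.ofReal
          (Real.exp ((m * ‖z.1‖ ^ 2 + ‖z.2‖ ^ 2 / 2) / (4 * d))) ∂(targetPhase u) := by
        refine lintegral_mono fun z => ?_
        rw [← ENNReal.ofReal_mul (by positivity)]
        exact ENNReal.ofReal_le_ofReal (point z)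
    _ ≤ ENNReal.ofReal (D * (d : ℝ) ^ k) *
        ENNReal.ofReal (2 * Real.exp (‖∇ u 0‖ ^ 2 / (4 * m))) := by
        rw [lintegral_const_mul _ (by fun_prop)]
        gcongr
        exact lintegral_exp_moment_le hd hm hu
    _ ≤ _ := by
        rw [← ENNReal.ofReal_mul (by positivity)]
        refine ENNReal.ofReal_le_ofReal ?_
        have h5 : Real.exp (‖∇ u 0‖ ^ 2 / (4 * m)) ≤ Real.exp (H ^ 2 / (4 * m)) := by gcongr
        calc _ ≤ D * (d : ℝ) ^ k * (2 * Real.exp (H ^ 2 / (4 * m))) := by gcongr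
          _ = _ := by ring

end Moments

/-! ### Volume and the flow of a bounded Lipschitz separable field -/

section SeparableFlow

variable {d : ℕ}

/-- The separable vector field `(x, v) ↦ (a v, c x)`. -/
def sepField (a c : E d → E d) (z : Phase d) : Phase d := (a z.2, c z.1)

/-- One step of the symplectic Euler scheme for a separable vector field. -/
def eulerStep (a c : E d → E d) (h : ℝ) (z : Phase d) : Phase d :=
  (z.1 + h • a (z.2 + h • c z.1), z.2 + h • c z.1)

lemma measurePreserving_shear {a : E d → E d} (ha : Continuous a) (h : ℝ) :
    MeasurePreserving (fun z : Phase d => (z.1, z.2 + h • a z.1)) := by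
  refine MeasurePreserving.skew_product (f := id) (g := fun x v => v + h • a x)
    (MeasurePreserving.id _) (by unfold Function.uncurry; fun_prop) (ae_of_all _ fun x => ?_)
  exact map_add_right_eq_self _ _

/-- The symplectic Euler step is a shear in the velocity followed by a shear in the position, the
latter obtained by conjugation with the swap. No Jacobian of the flow is needed, so a and c may be
merely Lipschitz. -/
lemma measurePreserving_eulerStep {a c : E d → E d} (ha : Continuous a) (hc : Continuous c)
    (h : ℝ) : MeasurePreserving (eulerStep a c h) := by
  have hs : MeasurePreserving (Prod.swap : Phase d → Phase d) := Measure.measurePreserving_swap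
  have := (hs.comp (measurePreserving_shear ha h)).comp (hs.comp (measurePreserving_shear hc h))
  exact this

variable {a c : E d → E d} {Λ B : ℝ}

/-- Global Lipschitz and boundedness hypotheses on a separable field. -/
structure SepBounds (a c : E d → E d) (Λ B : ℝ) : Prop where
  lip_nonneg : 0 ≤ Λ
  bound_nonneg : 0 ≤ B
  lip_left : ∀ x y, ‖a x - a y‖ ≤ Λ * ‖x - y‖
  lip_right : ∀ x y, ‖c x - c y‖ ≤ Λ * ‖x - y‖
  bound_left : ∀ x, ‖a x‖ ≤ B
  bound_right : ∀ x, ‖c x‖ ≤ B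

lemma continuous_of_norm_sub_le {f : E d → E d} (h : ∀ x y, ‖f x - f y‖ ≤ Λ * ‖x - y‖) :
    Continuous f := by
  have : LipschitzWith Λ.toNNReal f := LipschitzWith.of_dist_le_mul fun x y => by
    rw [dist_eq_norm, dist_eq_norm]
    exact (h x y).trans (by gcongr; exact Real.le_coe_toNNReal Λ)
  exact this.continuous

lemma SepBounds.norm_sepField_sub_le (h : SepBounds a c Λ B) (z w : Phase d) :
    ‖sepField a c z - sepField a c w‖ ≤ Λ * ‖z - w‖ := by
  have h0 := h.lip_nonneg
  refine norm_prod_le_iff.2 ⟨(h.lip_left _ _).trans ?_, (h.lip_right _ _).trans ?_⟩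
  · gcongr; exact norm_snd_le (z - w)
  · gcongr; exact norm_fst_le (z - w)

lemma SepBounds.norm_sepField_le (h : SepBounds a c Λ B) (z : Phase d) :
    ‖sepField a c z‖ ≤ B :=
  norm_prod_le_iff.2 ⟨h.bound_left _, h.bound_right _⟩

/-- A field bounded by B moves a point by at most B T in time T, so one application of
Picard–Lindelöf on that ball covers all of [0, T]. -/
lemma SepBounds.exists_curve (h : SepBounds a c Λ B) {T : ℝ} (hT : 0 ≤ T) (z₀ : Phase d) :
    ∃ z : ℝ → Phase d, z 0 = z₀ ∧
      ∀ t ∈ Icc 0 T, HasDerivWithinAt z (sepField a c (z t)) (Icc 0 T) t := by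
  have hB := h.bound_nonneg
  have hpl : IsPicardLindelof (fun _ => sepField a c) (⟨0, left_mem_Icc.2 hT⟩ : Icc 0 T) z₀
      (B * T).toNNReal 0 B.toNNReal Λ.toNNReal := by
    refine IsPicardLindelof.of_time_independent (fun x _ => ?_) ?_ ?_
    · exact (h.norm_sepField_le x).trans (Real.le_coe_toNNReal _)
    · refine LipschitzWith.lipschitzOnWith (LipschitzWith.of_dist_le_mul fun x y => ?_)
      rw [dist_eq_norm, dist_eq_norm]
      exact (h.norm_sepField_sub_le x y).trans (by gcongr; exact Real.le_coe_toNNReal _)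
    · rw [Real.coe_toNNReal _ hB, Real.coe_toNNReal _ (by positivity)]
      simp [hT]
  exact hpl.exists_eq_forall_mem_Icc_hasDerivWithinAt₀

lemma SepBounds.norm_curve_sub_le (h : SepBounds a c Λ B) {T : ℝ} {z : ℝ → Phase d}
    (hz : ∀ t ∈ Icc 0 T, HasDerivWithinAt z (sepField a c (z t)) (Icc 0 T) t) {s t : ℝ}
    (hs : s ∈ Icc 0 T) (ht : t ∈ Icc 0 T) : ‖z t - z s‖ ≤ B * |t - s| := by
  have := Convex.norm_image_sub_le_of_norm_hasDerivWithin_le (f := z) hz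
    (fun x _ => h.norm_sepField_le _) (convex_Icc 0 T) hs ht
  simpa using this

lemma SepBounds.local_error (h : SepBounds a c Λ B) {T : ℝ} {z : ℝ → Phase d}
    (hz : ∀ t ∈ Icc 0 T, HasDerivWithinAt z (sepField a c (z t)) (Icc 0 T) t) {t η : ℝ}
    (ht : 0 ≤ t) (hη : 0 ≤ η) (htη : t + η ≤ T) :
    ‖z (t + η) - z t - η • sepField a c (z t)‖ ≤ Λ * B * η ^ 2 := by
  have h0 := h.lip_nonneg
  have hB := h.bound_nonneg
  have hsub : Icc t (t + η) ⊆ Icc 0 T := Icc_subset_Icc ht htη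
  have ht' : t ∈ Icc t (t + η) := ⟨le_rfl, by linarith⟩
  have ht'' : t + η ∈ Icc t (t + η) := ⟨by linarith, le_rfl⟩
  have hder : ∀ s ∈ Icc t (t + η), HasDerivWithinAt
      (fun s => z s - (s - t) • sepField a c (z t))
      (sepField a c (z s) - sepField a c (z t)) (Icc t (t + η)) s := by
    intro s hs
    have h1 := (hz s (hsub hs)).mono hsub
    have h2 : HasDerivWithinAt (fun s => (s - t) • sepField a c (z t))
        (sepField a c (z t)) (Icc t (t + η)) s := by
      simpa using (((hasDerivAt_id s).sub_const t).smul_const (sepField a c (z t))).hasDerivWithinAt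
    exact h1.sub h2
  have hbd : ∀ s ∈ Icc t (t + η), ‖sepField a c (z s) - sepField a c (z t)‖ ≤ Λ * (B * η) := by
    intro s hs
    refine (h.norm_sepField_sub_le _ _).trans ?_
    gcongr
    refine (h.norm_curve_sub_le hz (hsub ht') (hsub hs)).trans ?_
    gcongr
    rw [abs_of_nonneg (by linarith [hs.1])]
    linarith [hs.2]
  have := Convex.norm_image_sub_le_of_norm_hasDerivWithin_le hder hbd (convex_Icc _ _) ht' ht''
  simp only [add_sub_cancel_left, sub_self, zero_smul, sub_zero, Real.norm_eq_abs,
    abs_of_nonneg hη] at this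
  rw [sub_right_comm]
  calc _ ≤ _ := this
    _ = _ := by ring

lemma SepBounds.eulerStep_error (h : SepBounds a c Λ B) {η : ℝ} (hη : 0 ≤ η) (w : Phase d) :
    ‖w + η • sepField a c w - eulerStep a c η w‖ ≤ Λ * B * η ^ 2 := by
  have h0 := h.lip_nonneg
  have hB := h.bound_nonneg
  have e1 : w + η • sepField a c w - eulerStep a c η w =
      (η • (a w.2 - a (w.2 + η • c w.1)), 0) := by
    ext1
    · simp [sepField, eulerStep, smul_sub]
    · simp [sepField, eulerStep]
  rw [e1]
  refine norm_prod_le_iff.2 ⟨?_, by simpa using by positivity⟩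
  rw [norm_smul, Real.norm_of_nonneg hη]
  have h1 := h.lip_left w.2 (w.2 + η • c w.1)
  rw [sub_add_cancel_left, norm_neg, norm_smul, Real.norm_of_nonneg hη] at h1
  have h2 : Λ * (η * ‖c w.1‖) ≤ Λ * (η * B) := by gcongr; exact h.bound_right _
  calc η * ‖a w.2 - a (w.2 + η • c w.1)‖ ≤ η * (Λ * (η * B)) := by gcongr; exact h1.trans h2
    _ = _ := by ring

lemma SepBounds.norm_eulerStep_sub_le (h : SepBounds a c Λ B) {η T : ℝ} (hη : 0 ≤ η) (hηT : η ≤ T)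
    (z w : Phase d) : ‖eulerStep a c η z - eulerStep a c η w‖ ≤
      (1 + η * (Λ * (1 + T * Λ))) * ‖z - w‖ := by
  have h0 := h.lip_nonneg
  have n1 : ‖z.1 - w.1‖ ≤ ‖z - w‖ := norm_fst_le (z - w)
  have n2 : ‖z.2 - w.2‖ ≤ ‖z - w‖ := norm_snd_le (z - w)
  have k0 : ‖(z.2 + η • c z.1) - (w.2 + η • c w.1)‖ ≤ (1 + η * Λ) * ‖z - w‖ := by
    have e : (z.2 + η • c z.1) - (w.2 + η • c w.1) = (z.2 - w.2) + η • (c z.1 - c w.1) := by module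
    rw [e]
    refine (norm_add_le _ _).trans ?_
    rw [norm_smul, Real.norm_of_nonneg hη]
    have := h.lip_right z.1 w.1
    calc _ ≤ ‖z - w‖ + η * (Λ * ‖z - w‖) := by
          gcongr; exact this.trans (by gcongr)
      _ = _ := by ring
  have k1 : (1 + η * Λ) * ‖z - w‖ ≤ (1 + T * Λ) * ‖z - w‖ := by gcongr
  have hT : 0 ≤ T := hη.trans hηT
  have e1 : eulerStep a c η z - eulerStep a c η w = ((z.1 - w.1) +
      η • (a (z.2 + η • c z.1) - a (w.2 + η • c w.1)), (z.2 + η • c z.1) - (w.2 + η • c w.1)) := by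
    ext1
    · simp only [eulerStep, Prod.fst_sub]; module
    · simp [eulerStep]
  rw [e1]
  refine norm_prod_le_iff.2 ⟨?_, k0.trans ?_⟩
  · refine (norm_add_le _ _).trans ?_
    rw [norm_smul, Real.norm_of_nonneg hη]
    calc _ ≤ ‖z - w‖ + η * (Λ * ((1 + T * Λ) * ‖z - w‖)) := by
          gcongr; exact (h.lip_left _ _).trans (by gcongr; exact k0.trans k1)
      _ = _ := by ring
  · gcongr
    have : 0 ≤ T * Λ := by positivity
    nlinarith

/-- A discrete Grönwall argument. The local error 2ΛBη² is ΛBη² for linearising the exact curve plus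
ΛBη² for the scheme against the explicit linearisation. -/
lemma SepBounds.norm_iterate_sub_le (h : SepBounds a c Λ B) {T : ℝ} (hT : 0 ≤ T)
    {z : ℝ → Phase d}
    (hz : ∀ t ∈ Icc 0 T, HasDerivWithinAt z (sepField a c (z t)) (Icc 0 T) t)
    {N : ℕ} (hN : 0 < N) {k : ℕ} (hk : k ≤ N) :
    ‖(eulerStep a c (T / N))^[k] (z 0) - z (k * (T / N))‖ ≤
      k * (2 * Λ * B * (T / N) ^ 2) * (1 + T / N * (Λ * (1 + T * Λ))) ^ k := by
  have h0 := h.lip_nonneg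
  have hB := h.bound_nonneg
  have hN1 : (1 : ℝ) ≤ N := by exact_mod_cast hN
  have hη : 0 ≤ T / N := by positivity
  have hηT : T / N ≤ T := div_le_self hT hN1
  set η := T / N with hηd
  set C := 1 + η * (Λ * (1 + T * Λ)) with hC
  have hC1 : 1 ≤ C := by
    have : 0 ≤ η * (Λ * (1 + T * Λ)) := by positivity
    linarith
  induction k with
  | zero => simp
  | succ k ih =>
    have hk' : k ≤ N := by omega
    have hkη : k * η + η ≤ T := by
      have : ((k : ℝ) + 1) ≤ N := by exact_mod_cast hk
      calc k * η + η = (k + 1) * η := by ring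
        _ ≤ N * η := by gcongr
        _ = T := by rw [hηd]; field_simp
    have e1 := h.local_error hz (by positivity) hη hkη
    have e2 := h.eulerStep_error hη (z (k * η))
    have e3 := h.norm_eulerStep_sub_le hη hηT ((eulerStep a c η)^[k] (z 0)) (z (k * η))
    rw [Function.iterate_succ_apply']
    have split : eulerStep a c η ((eulerStep a c η)^[k] (z 0)) - z ((k + 1 : ℕ) * η) =
        (eulerStep a c η ((eulerStep a c η)^[k] (z 0)) - eulerStep a c η (z (k * η))) -
        (z (k * η) + η • sepField a c (z (k * η)) - eulerStep a c η (z (k * η))) -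
        (z (k * η + η) - z (k * η) - η • sepField a c (z (k * η))) := by
      rw [show ((k + 1 : ℕ) : ℝ) * η = k * η + η by push_cast; ring]
      abel
    rw [split]
    have ih' := ih hk'
    have hpow : 1 ≤ C ^ (k + 1) := one_le_pow₀ hC1
    have hD : 0 ≤ 2 * Λ * B * η ^ 2 := by positivity
    have hC0 : 0 ≤ C := by linarith
    calc _ ≤ C * (k * (2 * Λ * B * η ^ 2) * C ^ k) + Λ * B * η ^ 2 + Λ * B * η ^ 2 :=
          (norm_sub_le _ _).trans (add_le_add ((norm_sub_le _ _).trans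
            (add_le_add (e3.trans (by gcongr)) e2)) e1)
      _ = k * (2 * Λ * B * η ^ 2) * C ^ (k + 1) + (2 * Λ * B * η ^ 2) * 1 := by ring
      _ ≤ k * (2 * Λ * B * η ^ 2) * C ^ (k + 1) + (2 * Λ * B * η ^ 2) * C ^ (k + 1) := by gcongr
      _ = _ := by push_cast; ring

/-- Convergence of the symplectic Euler scheme. -/
lemma SepBounds.tendsto_iterate (h : SepBounds a c Λ B) {T : ℝ} (hT : 0 ≤ T) {z : ℝ → Phase d}
    (hz : ∀ t ∈ Icc 0 T, HasDerivWithinAt z (sepField a c (z t)) (Icc 0 T) t) :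
    Tendsto (fun N : ℕ => (eulerStep a c (T / (N + 1 : ℕ)))^[N + 1] (z 0)) atTop (𝓝 (z T)) := by
  have h0 := h.lip_nonneg
  have hB := h.bound_nonneg
  set D := 2 * Λ * B * T ^ 2 * Real.exp (T * (Λ * (1 + T * Λ)))
  have hlim : Tendsto (fun N : ℕ => D * (1 / ((N : ℝ) + 1))) atTop (𝓝 0) := by
    simpa using tendsto_one_div_add_atTop_nhds_zero_nat.const_mul D
  rw [tendsto_iff_norm_sub_tendsto_zero]
  refine squeeze_zero (fun _ => norm_nonneg _) (fun N => ?_) hlim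
  have h1 := h.norm_iterate_sub_le hT hz (Nat.succ_pos N) le_rfl
  have hNpos : (0 : ℝ) < (N + 1 : ℕ) := by positivity
  rw [Nat.succ_eq_add_one, mul_div_cancel₀ T hNpos.ne'] at h1
  refine h1.trans ?_
  set M : ℝ := ((N + 1 : ℕ) : ℝ) with hM
  have h2 : (1 + T / M * (Λ * (1 + T * Λ))) ^ (N + 1) ≤ Real.exp (T * (Λ * (1 + T * Λ))) := by
    have h3 := Real.add_one_le_exp (T / M * (Λ * (1 + T * Λ)))
    calc _ ≤ Real.exp (T / M * (Λ * (1 + T * Λ))) ^ (N + 1) := by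
          gcongr
          linarith
      _ = _ := by
          rw [← Real.exp_nat_mul, ← hM]; congr 1; field_simp
  have h4 : M * (2 * Λ * B * (T / M) ^ 2) = 2 * Λ * B * T ^ 2 * (1 / M) := by field_simp
  have h5 : (N : ℝ) + 1 = M := by rw [hM]; push_cast; ring
  rw [h4, h5]
  calc _ ≤ 2 * Λ * B * T ^ 2 * (1 / M) * Real.exp (T * (Λ * (1 + T * Λ))) := by gcongr
    _ = _ := by ring

/-- A limit of measure preserving maps does not increase the measure of preimages. -/
lemma map_le_of_tendsto_measurePreserving {f : ℕ → Phase d → Phase d} {g : Phase d → Phase d}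
    (hf : ∀ n, MeasurePreserving (f n)) (hg : Measurable g)
    (hlim : ∀ z, Tendsto (fun n => f n z) atTop (𝓝 (g z))) :
    (volume : Measure (Phase d)).map g ≤ volume := by
  -- Indicators of open sets are lower semicontinuous, so Fatou's lemma settles open sets; outer
  -- regularity of volume then settles measurable sets.
  have hopen : ∀ U : Set (Phase d), IsOpen U → volume (g ⁻¹' U) ≤ volume U := by
    intro U hU
    have h1 : ∀ z, indicator (g ⁻¹' U) (fun _ => (1 : ℝ≥0∞)) z ≤
        liminf (fun n => indicator (f n ⁻¹' U) (fun _ => (1 : ℝ≥0∞)) z) atTop := by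
      intro z
      by_cases hz : g z ∈ U
      · have h2 : ∀ᶠ n in atTop, indicator (f n ⁻¹' U) (fun _ => (1 : ℝ≥0∞)) z = 1 := by
          filter_upwards [(hlim z).eventually (hU.mem_nhds hz)] with n hn
          exact indicator_of_mem (show z ∈ f n ⁻¹' U from hn) _
        rw [liminf_congr h2, liminf_const]
        rw [indicator_of_mem (show z ∈ g ⁻¹' U from hz)]
      · rw [indicator_of_notMem (show z ∉ g ⁻¹' U from hz)]
        exact zero_le
    calc volume (g ⁻¹' U) = ∫⁻ z, indicator (g ⁻¹' U) (fun _ => (1 : ℝ≥0∞)) z := by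
          rw [lintegral_indicator_const (hg hU.measurableSet), one_mul]
      _ ≤ ∫⁻ z, liminf (fun n => indicator (f n ⁻¹' U) (fun _ => (1 : ℝ≥0∞)) z) atTop :=
          lintegral_mono h1
      _ ≤ liminf (fun n => ∫⁻ z, indicator (f n ⁻¹' U) (fun _ => (1 : ℝ≥0∞)) z) atTop :=
          lintegral_liminf_le fun n =>
            measurable_const.indicator ((hf n).measurable hU.measurableSet)
      _ = volume U := by
          have : ∀ n, ∫⁻ z, indicator (f n ⁻¹' U) (fun _ => (1 : ℝ≥0∞)) z = volume U := fun n => by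
            rw [lintegral_indicator_const ((hf n).measurable hU.measurableSet), one_mul,
              (hf n).measure_preimage hU.measurableSet.nullMeasurableSet]
          simp_rw [this]
          exact liminf_const _
  refine Measure.le_iff.2 fun A hA => ?_
  rw [Measure.map_apply hg hA, A.measure_eq_iInf_isOpen volume]
  exact le_iInf₂ fun U hU => le_iInf fun hUo => (measure_mono (preimage_mono hU)).trans (hopen U hUo)

/-- The time `T` flow map of a bounded Lipschitz separable field does not increase volume. -/
lemma SepBounds.exists_flow (h : SepBounds a c Λ B) {T : ℝ} (hT : 0 ≤ T) :
    ∃ Φ : Phase d → Phase d, Measurable Φ ∧ (volume : Measure (Phase d)).map Φ ≤ volume ∧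
      ∀ z₀, ∃ z : ℝ → Phase d, z 0 = z₀ ∧ z T = Φ z₀ ∧
        ∀ t ∈ Icc 0 T, HasDerivWithinAt z (sepField a c (z t)) (Icc 0 T) t := by
  choose z hz0 hz using fun z₀ => h.exists_curve hT z₀
  have hlim : ∀ z₀, Tendsto (fun N : ℕ => (eulerStep a c (T / (N + 1 : ℕ)))^[N + 1] z₀) atTop
      (𝓝 (z z₀ T)) := fun z₀ => by
    have := h.tendsto_iterate hT (hz z₀)
    rwa [hz0 z₀] at this
  have hpres : ∀ N : ℕ, MeasurePreserving ((eulerStep a c (T / (N + 1 : ℕ)))^[N + 1]) := fun N =>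
    (measurePreserving_eulerStep (continuous_of_norm_sub_le h.lip_left)
      (continuous_of_norm_sub_le h.lip_right) _).iterate _
  have hmeas : Measurable fun z₀ => z z₀ T :=
    measurable_of_tendsto_metrizable (fun N => (hpres N).measurable) (tendsto_pi_nhds.2 hlim)
  exact ⟨fun z₀ => z z₀ T, hmeas, map_le_of_tendsto_measurePreserving hpres hmeas hlim,
    fun z₀ => ⟨z z₀, hz0 z₀, rfl, hz z₀⟩⟩

end SeparableFlow

/-! ### Radial truncation -/

section Clamp

variable {d : ℕ}

/-- Radial retraction onto the ball of radius `R`. -/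
def clamp (R : ℝ) (x : E d) : E d := (R / max R ‖x‖) • x

lemma clamp_eq_self {R : ℝ} (hR : 0 < R) {x : E d} (hx : ‖x‖ ≤ R) : clamp R x = x := by
  rw [clamp, max_eq_left hx, div_self hR.ne', one_smul]

lemma norm_clamp_le {R : ℝ} (hR : 0 < R) (x : E d) : ‖clamp R x‖ ≤ R := by
  have h0 : 0 < max R ‖x‖ := lt_max_of_lt_left hR
  rw [clamp, norm_smul, Real.norm_of_nonneg (by positivity), div_mul_eq_mul_div, div_le_iff₀ h0]
  gcongr
  exact le_max_right _ _

lemma norm_clamp_sub_le {R : ℝ} (hR : 0 < R) (x y : E d) :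
    ‖clamp R x - clamp R y‖ ≤ 2 * ‖x - y‖ := by
  have hx : 0 < max R ‖x‖ := lt_max_of_lt_left hR
  have hy : 0 < max R ‖y‖ := lt_max_of_lt_left hR
  have e : clamp R x - clamp R y =
      (R / max R ‖x‖) • (x - y) + (R / max R ‖x‖ - R / max R ‖y‖) • y := by
    unfold clamp; module
  have h1 : R / max R ‖x‖ ≤ 1 := (div_le_one hx).2 (le_max_left _ _)
  have h2 : R / max R ‖x‖ - R / max R ‖y‖ =
      (R / max R ‖x‖) * ((max R ‖y‖ - max R ‖x‖) / max R ‖y‖) := by field_simp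
  have h3 : |max R ‖y‖ - max R ‖x‖| ≤ ‖x - y‖ := by
    have := abs_max_sub_max_le_abs ‖y‖ ‖x‖ R
    rw [max_comm R, max_comm R, norm_sub_rev]
    exact this.trans (abs_norm_sub_norm_le y x)
  have h4 : ‖y‖ / max R ‖y‖ ≤ 1 := (div_le_one hy).2 (le_max_right _ _)
  have h0 : 0 ≤ R / max R ‖x‖ := by positivity
  rw [e]
  refine (norm_add_le _ _).trans ?_
  rw [norm_smul, norm_smul, Real.norm_of_nonneg h0, h2, Real.norm_eq_abs, abs_mul,
    abs_of_nonneg h0, abs_div, abs_of_pos hy]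
  have h5 : R / max R ‖x‖ * (|max R ‖y‖ - max R ‖x‖| / max R ‖y‖) * ‖y‖ =
      R / max R ‖x‖ * |max R ‖y‖ - max R ‖x‖| * (‖y‖ / max R ‖y‖) := by ring
  rw [h5]
  have h6 : R / max R ‖x‖ * |max R ‖y‖ - max R ‖x‖| * (‖y‖ / max R ‖y‖) ≤ 1 * ‖x - y‖ * 1 := by
    gcongr
  have h7 : R / max R ‖x‖ * ‖x - y‖ ≤ 1 * ‖x - y‖ := by gcongr
  linarith

end Clamp

/-! ### The Hamiltonian flow and invariance of the target -/

section HamiltonianFlow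

variable {d : ℕ} {m L l : ℝ} {u : E d → ℝ}

lemma energy_lower_sq (hm : 0 < m) (hu : PotentialAssumptions m L l u) (z : Phase d) :
    m / 2 * ‖z.1‖ ^ 2 + ‖z.2‖ ^ 2 / 2 ≤ energy u z - u 0 + ‖∇ u 0‖ ^ 2 / (2 * m) := by
  have h := hu.lower z.1
  have h1 : m / 2 * ‖z.1‖ ^ 2 - ‖∇ u 0‖ * ‖z.1‖ + ‖∇ u 0‖ ^ 2 / (2 * m) =
      m / 2 * (‖z.1‖ - ‖∇ u 0‖ / m) ^ 2 := by field_simp; ring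
  have h2 : 0 ≤ m / 2 * (‖z.1‖ - ‖∇ u 0‖ / m) ^ 2 := by positivity
  unfold energy; linarith

lemma PotentialAssumptions.norm_gradient_sub_le (hL : 0 ≤ L) (hl : 0 ≤ l)
    (hu : PotentialAssumptions m L l u) {R : ℝ} {x y : E d} (hx : ‖x‖ ≤ R) (hy : ‖y‖ ≤ R) :
    ‖∇ u x - ∇ u y‖ ≤ L * (1 + 2 * R) ^ l * ‖x - y‖ := by
  refine (hu.locally_lipschitz x y).trans ?_
  have h : 1 + ‖x‖ + ‖y‖ ≤ 1 + 2 * R := by linarith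
  gcongr

/-- Sublevel sets of the energy are bounded. -/
lemma exists_radius_of_energy_le (hm : 0 < m) (hu : PotentialAssumptions m L l u) (D : ℝ) :
    ∃ R : ℝ, 0 < R ∧ ∀ z : Phase d, energy u z ≤ D → ‖z.1‖ ≤ R ∧ ‖z.2‖ ≤ R := by
  set Q := |D - u 0 + ‖∇ u 0‖ ^ 2 / (2 * m)| with hQ
  refine ⟨√(2 * Q / m) + √(2 * Q) + 1, by positivity, fun z hz => ?_⟩
  have h1 := energy_lower_sq hm hu z
  have h2 : m / 2 * ‖z.1‖ ^ 2 + ‖z.2‖ ^ 2 / 2 ≤ Q := by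
    refine h1.trans (le_trans ?_ (le_abs_self _)); linarith
  have s1 : ‖z.1‖ ≤ √(2 * Q / m) := by
    refine Real.le_sqrt_of_sq_le ?_
    rw [le_div_iff₀ hm]
    nlinarith [sq_nonneg ‖z.2‖]
  have s2 : ‖z.2‖ ≤ √(2 * Q) := by
    refine Real.le_sqrt_of_sq_le ?_
    have : 0 ≤ m / 2 * ‖z.1‖ ^ 2 := by positivity
    linarith
  constructor
  · linarith [Real.sqrt_nonneg (2 * Q)]
  · linarith [Real.sqrt_nonneg (2 * Q / m)]

lemma sepBounds_clamp (hL : 0 ≤ L) (hl : 0 ≤ l) (hu : PotentialAssumptions m L l u) {R : ℝ}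
    (hR : 0 < R) : ∃ Λ B, SepBounds (clamp R) (fun x => -∇ u (clamp R x)) Λ B := by
  set K := L * (1 + 2 * R) ^ l with hK
  have hK0 : 0 ≤ K := by positivity
  refine ⟨2 + 2 * K, R + (K * R + ‖∇ u 0‖), by positivity, by positivity, fun x y => ?_,
    fun x y => ?_, fun x => ?_, fun x => ?_⟩
  · refine (norm_clamp_sub_le hR x y).trans ?_
    gcongr; linarith
  · have h1 := hu.norm_gradient_sub_le hL hl (norm_clamp_le hR x) (norm_clamp_le hR y)
    have h2 := norm_clamp_sub_le hR x y
    rw [neg_sub_neg, norm_sub_rev]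
    calc _ ≤ K * (2 * ‖x - y‖) := h1.trans (by gcongr)
      _ ≤ (2 + 2 * K) * ‖x - y‖ := by nlinarith [norm_nonneg (x - y)]
  · have := norm_clamp_le hR x
    have : 0 ≤ K * R + ‖∇ u 0‖ := by positivity
    linarith
  · have h1 := hu.norm_gradient_sub_le hL hl (norm_clamp_le hR x) (y := 0) (by simpa using hR.le)
    rw [sub_zero] at h1
    rw [norm_neg]
    have h2 : ‖∇ u (clamp R x)‖ ≤ ‖∇ u (clamp R x) - ∇ u 0‖ + ‖∇ u 0‖ := by
      simpa using norm_add_le (∇ u (clamp R x) - ∇ u 0) (∇ u 0)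
    have h3 : K * ‖clamp R x‖ ≤ K * R := by gcongr; exact norm_clamp_le hR x
    linarith

/-- A curve solves Hamilton's equations on `[0, T]`. -/
def IsHamiltonianCurve (u : E d → ℝ) (T : ℝ) (z : ℝ → Phase d) : Prop :=
  ∀ t ∈ Icc 0 T, HasDerivWithinAt z ((z t).2, -∇ u (z t).1) (Icc 0 T) t

lemma hasDerivWithinAt_energy (hu : PotentialAssumptions m L l u) {z : ℝ → Phase d} {z' : Phase d}
    {s : Set ℝ} {t : ℝ} (hz : HasDerivWithinAt z z' s t) :
    HasDerivWithinAt (fun t => energy u (z t))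
      (inner ℝ (z t).2 z'.2 + inner ℝ (∇ u (z t).1) z'.1) s t := by
  have h1 : HasDerivWithinAt (fun t => (z t).1) z'.1 s t :=
    (ContinuousLinearMap.fst ℝ (E d) (E d)).hasFDerivAt.comp_hasDerivWithinAt t hz
  have h2 : HasDerivWithinAt (fun t => (z t).2) z'.2 s t :=
    (ContinuousLinearMap.snd ℝ (E d) (E d)).hasFDerivAt.comp_hasDerivWithinAt t hz
  have h3 := (h2.norm_sq).div_const 2
  have h4 := (hu.hasGradientAt (z t).1).hasFDerivAt.comp_hasDerivWithinAt t h1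
  refine (h3.add h4).congr_deriv ?_
  simp

/-- A barrier argument with D + t/(T + 1), which stays below D + 1 and has positive slope. If the
energy touches it, the point lies in the ball of radius R, both truncations are inactive there, and
the energy has derivative 0, less than the slope. So the truncated curve never reaches the region
where truncation acts. -/
lemma energy_bounded_along (hu : PotentialAssumptions m L l u) {R D T : ℝ} (hR : 0 < R)
    (hRD : ∀ z : Phase d, energy u z ≤ D + 1 → ‖z.1‖ ≤ R ∧ ‖z.2‖ ≤ R) {z : ℝ → Phase d}
    (h0 : energy u (z 0) ≤ D) (hT : 0 ≤ T)
    (hz : ∀ t ∈ Icc 0 T, HasDerivWithinAt z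
      (sepField (clamp R) (fun x => -∇ u (clamp R x)) (z t)) (Icc 0 T) t) :
    ∀ t ∈ Icc 0 T, energy u (z t) ≤ D + 1 := by
  have hder : ∀ t ∈ Icc 0 T, HasDerivWithinAt (fun t => energy u (z t)) _ (Icc 0 T) t :=
    fun t ht => hasDerivWithinAt_energy hu (hz t ht)
  have hTT : T / (T + 1) ≤ 1 := (div_le_one (by linarith)).2 (by linarith)
  have hfence := image_le_of_deriv_right_lt_deriv_boundary (f := fun t => energy u (z t))
    (a := 0) (b := T) (fun t ht => (hder t ht).continuousWithinAt)
    (fun t ht => (hder t (Ico_subset_Icc_self ht)).mono_of_mem_nhdsWithin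
      (Icc_mem_nhdsGE_of_mem ht))
    (B := fun t => D + t / (T + 1)) (B' := fun _ => 1 / (T + 1)) (by simpa using h0)
    (fun t => ((hasDerivAt_id t).div_const (T + 1)).const_add D) ?_
  · intro t ht
    have h1 := hfence ht
    have h2 : t / (T + 1) ≤ T / (T + 1) := by gcongr; exact ht.2
    linarith
  · intro t ht heq
    have h2 : t / (T + 1) ≤ T / (T + 1) := by gcongr; exact ht.2.le
    have h3 := hRD (z t) (by linarith)
    simp only [sepField]
    rw [clamp_eq_self hR h3.1, clamp_eq_self hR h3.2, inner_neg_right, real_inner_comm,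
      neg_add_cancel]
    positivity

lemma isHamiltonianCurve_of_clamp (hu : PotentialAssumptions m L l u) {R D T : ℝ} (hR : 0 < R)
    (hRD : ∀ z : Phase d, energy u z ≤ D + 1 → ‖z.1‖ ≤ R ∧ ‖z.2‖ ≤ R) {z : ℝ → Phase d}
    (h0 : energy u (z 0) ≤ D) (hT : 0 ≤ T)
    (hz : ∀ t ∈ Icc 0 T, HasDerivWithinAt z
      (sepField (clamp R) (fun x => -∇ u (clamp R x)) (z t)) (Icc 0 T) t) :
    IsHamiltonianCurve u T z ∧ ∀ t ∈ Icc 0 T, energy u (z t) = energy u (z 0) := by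
  have hb := energy_bounded_along hu hR hRD h0 hT hz
  have hham : IsHamiltonianCurve u T z := by
    intro t ht
    have h3 := hRD (z t) (hb t ht)
    have := hz t ht
    simp only [sepField] at this
    rwa [clamp_eq_self hR h3.1, clamp_eq_self hR h3.2] at this
  refine ⟨hham, ?_⟩
  refine constant_of_has_deriv_right_zero
    (fun t ht => (hasDerivWithinAt_energy hu (hz t ht)).continuousWithinAt) fun t ht => ?_
  have h1 := hasDerivWithinAt_energy hu (hham t (Ico_subset_Icc_self ht))
  simp only at h1
  rw [inner_neg_right, real_inner_comm, neg_add_cancel] at h1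
  exact h1.mono_of_mem_nhdsWithin (Icc_mem_nhdsGE_of_mem ht)

/-- The Hamiltonian flow at time `T` preserves the extended target. -/
lemma exists_hamiltonian_flow (hm : 0 < m) (hL : 0 ≤ L) (hl : 0 ≤ l)
    (hu : PotentialAssumptions m L l u) {T : ℝ} (hT : 0 ≤ T) :
    ∃ Φ : Phase d → Phase d, Measurable Φ ∧ (targetPhase u).map Φ = targetPhase u ∧
      ∀ z₀, ∃ z : ℝ → Phase d, z 0 = z₀ ∧ z T = Φ z₀ ∧ IsHamiltonianCurve u T z ∧
        ∀ t ∈ Icc 0 T, energy u (z t) = energy u z₀ := by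
  -- The radius controls the sublevel k + 1, one unit above the level k at which the curves start,
  -- as the barrier argument requires.
  choose R hR hRD using fun k : ℕ => exists_radius_of_energy_le hm hu ((k : ℝ) + 1)
  choose Λ B hB using fun k : ℕ => sepBounds_clamp hL hl hu (hR k)
  choose Φ hΦm hΦv hΦc using fun k : ℕ => (hB k).exists_flow hT
  have hmeas := hu.measurable_energy
  -- Each starting point uses the truncated flow of the first natural level above its energy. This
  -- keeps the glued map measurable, and the flows of different levels need not be compared.
  set κ : Phase d → ℕ := fun z => ⌈energy u z⌉₊ with hκ
  have hκm : Measurable κ := Nat.measurable_ceil.comp hmeas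
  have hΨm : Measurable fun z => Φ (κ z) z := by
    have h1 : Measurable fun p : ℕ × Phase d => Φ p.1 p.2 :=
      measurable_from_prod_countable_right fun k => hΦm k
    exact h1.comp (hκm.prodMk measurable_id)
  have hcurve : ∀ (k : ℕ) z₀, energy u z₀ ≤ k → ∃ z : ℝ → Phase d, z 0 = z₀ ∧ z T = Φ k z₀ ∧
      IsHamiltonianCurve u T z ∧ ∀ t ∈ Icc 0 T, energy u (z t) = energy u z₀ := by
    intro k z₀ hk
    obtain ⟨z, h0, h1, hz⟩ := hΦc k z₀
    have h2 := isHamiltonianCurve_of_clamp hu (hR k) (hRD k) (by rwa [h0]) hT hz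
    rw [h0] at h2
    exact ⟨z, h0, h1, h2⟩
  have henergy : ∀ z, energy u (Φ (κ z) z) = energy u z := by
    intro z
    obtain ⟨w, _, h1, _, h3⟩ := hcurve (κ z) z (Nat.le_ceil _)
    rw [← h1]
    exact h3 T (right_mem_Icc.2 hT)
  refine ⟨fun z => Φ (κ z) z, hΨm, ?_, fun z₀ => hcurve _ z₀ (Nat.le_ceil _)⟩
  have hprob := isProbabilityMeasure_targetPhase hm hu
  have hprob' : IsProbabilityMeasure ((targetPhase u).map fun z => Φ (κ z) z) :=
    Measure.isProbabilityMeasure_map hΨm.aemeasurable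
  -- Both sides are probability measures, so one inequality suffices; this is why a flow map that
  -- merely does not increase volume is enough.
  refine Measure.eq_of_le_of_measure_univ_eq ?_ (by simp)
  set w : Phase d → ℝ≥0∞ := fun z => ENNReal.ofReal (Real.exp (-energy u z)) with hw
  have hwm : Measurable w := by fun_prop
  refine Measure.le_iff.2 fun A hA => ?_
  rw [Measure.map_apply hΨm hA, targetPhase_def, gibbs_def, Measure.smul_apply, Measure.smul_apply]
  refine mul_le_mul_right ?_ _
  -- Conservation of energy makes `Φ k` map the layer κ = k into itself with unchanged density, so
  -- the inequality can be proved layer by layer.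
  have hpart : ∀ S : Set (Phase d), MeasurableSet S → (volume.withDensity w) S =
      ∑' k : ℕ, (volume.withDensity w) (S ∩ κ ⁻¹' {k}) := by
    intro S hS
    rw [← measure_iUnion]
    · congr 1
      ext z; simp
    · intro i j hij
      refine Set.disjoint_left.2 fun z hz hz' => hij ?_
      rw [← hz.2, ← hz'.2]
    · exact fun k => hS.inter (hκm (measurableSet_singleton k))
  rw [hpart _ (hΨm hA), hpart A hA]
  refine ENNReal.tsum_le_tsum fun k => ?_
  have hSk : MeasurableSet (A ∩ κ ⁻¹' {k}) := hA.inter (hκm (measurableSet_singleton k))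
  rw [withDensity_apply _ ((hΨm hA).inter (hκm (measurableSet_singleton k))),
    withDensity_apply _ hSk, ← lintegral_indicator hSk,
    ← lintegral_indicator ((hΨm hA).inter (hκm (measurableSet_singleton k)))]
  calc _ ≤ ∫⁻ z, indicator (A ∩ κ ⁻¹' {k}) w (Φ k z) := by
        refine lintegral_mono fun z => ?_
        by_cases hz : z ∈ (fun z => Φ (κ z) z) ⁻¹' A ∩ κ ⁻¹' {k}
        · have hzk : κ z = k := hz.2
          have h1 : Φ k z ∈ A ∩ κ ⁻¹' {k} := by
            have h2 := hz.1
            have h3 := henergy z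
            simp only [mem_preimage] at h2
            rw [hzk] at h2 h3
            refine ⟨h2, ?_⟩
            simp only [mem_preimage, mem_singleton_iff, hκ] at hzk ⊢
            rw [h3, hzk]
          have h4 : w (Φ k z) = w z := by
            have h3 := henergy z
            rw [hzk] at h3
            simp only [hw, h3]
          rw [indicator_of_mem hz, indicator_of_mem h1, h4]
        · rw [indicator_of_notMem hz]
          exact zero_le
    _ = ∫⁻ z, indicator (A ∩ κ ⁻¹' {k}) w z ∂((volume : Measure (Phase d)).map (Φ k)) := by
        rw [lintegral_map (hwm.indicator hSk) (hΦm k)]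
    _ ≤ _ := lintegral_mono' (hΦv k) le_rfl

end HamiltonianFlow

/-! ### Local error of the tamed Verlet step -/

section LocalError

variable {d : ℕ} {m L l H lam : ℝ} {u : E d → ℝ} {n : ℕ}

lemma PotentialAssumptions.norm_gradient_le_pow (hL : 0 ≤ L) (hl : 0 ≤ l) (hn : l ≤ n)
    (hu : PotentialAssumptions m L l u) (hH : ‖∇ u 0‖ ≤ H) {b : ℝ} (hb : 1 ≤ b) {x : E d}
    (hx : ‖x‖ ≤ b) : ‖∇ u x‖ ≤ (H + L) * (2 * b) ^ (n + 1) := by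
  have hH0 : 0 ≤ H := (norm_nonneg _).trans hH
  have h1 := hu.locally_lipschitz x 0
  rw [norm_zero, add_zero, sub_zero] at h1
  have h2 : (1 + ‖x‖) ^ l ≤ (2 * b) ^ n := by
    calc (1 + ‖x‖) ^ l ≤ (2 * b) ^ l := by
          have h : 1 + ‖x‖ ≤ 2 * b := by linarith
          gcongr
      _ ≤ (2 * b) ^ (n : ℝ) := Real.rpow_le_rpow_of_exponent_le (by linarith) hn
      _ = (2 * b) ^ n := Real.rpow_natCast _ _
  have h3 : L * (1 + ‖x‖) ^ l * ‖x‖ ≤ L * (2 * b) ^ n * (2 * b) := by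
    gcongr; linarith
  have h4 : ‖∇ u x‖ ≤ ‖∇ u x - ∇ u 0‖ + ‖∇ u 0‖ := by
    simpa using norm_add_le (∇ u x - ∇ u 0) (∇ u 0)
  have h5 : H * 1 ≤ H * (2 * b) ^ (n + 1) := by
    gcongr; exact one_le_pow₀ (by linarith)
  calc ‖∇ u x‖ ≤ L * (2 * b) ^ n * (2 * b) + H * (2 * b) ^ (n + 1) := by linarith
    _ = _ := by ring

lemma PotentialAssumptions.norm_gDrift_le_pow (hm : 0 ≤ m) (hL : 0 ≤ L) (hl : 0 ≤ l) (hn : l ≤ n)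
    (hu : PotentialAssumptions m L l u) (hH : ‖∇ u 0‖ ≤ H) {b : ℝ} (hb : 1 ≤ b) {x : E d}
    (hx : ‖x‖ ≤ b) : ‖gDrift m u x‖ ≤ (H + L + m) * (2 * b) ^ (n + 1) := by
  have h1 := hu.norm_gradient_le_pow hL hl hn hH hb hx
  have h2 : 2 * b ≤ (2 * b) ^ (n + 1) := le_self_pow₀ (by linarith) (by omega)
  calc ‖gDrift m u x‖ ≤ ‖∇ u x‖ + ‖m • x‖ := norm_sub_le _ _
    _ ≤ (H + L) * (2 * b) ^ (n + 1) + m * (2 * b) ^ (n + 1) := by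
        rw [norm_smul, Real.norm_of_nonneg hm]
        gcongr
        linarith
    _ = _ := by ring

lemma tamedDrift_eq_gradient {x : E d} (hx : ‖x‖ ≤ radius m L l lam - 2) :
    tamedDrift m L l u lam x = ∇ u x := by
  simp only [tamedDrift, cutT, cutS]
  rw [if_pos (by linarith), if_pos hx, gDrift]
  module

/-- The difference vanishes for ‖x‖ ≤ r - 2. Otherwise r ≤ 3b, and since λ r^(2(l+2)) equals the
constant `c`, the quantity λ(3b)^(2(n+2))/c is at least 1. Multiplying a crude polynomial bound by
it produces the factor λ. -/
lemma exists_norm_tamedDrift_sub_le (hm : 0 < m) (hL : 0 < L) (hl : 0 < l) (hH : 0 ≤ H) :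
    ∃ (C : ℝ) (k : ℕ), 0 ≤ C ∧ ∀ (d : ℕ) (u : E d → ℝ), PotentialAssumptions m L l u →
      ‖∇ u 0‖ ≤ H → ∀ lam, 0 < lam → 2 ≤ radius m L l lam → ∀ (b : ℝ) (x : E d), 1 ≤ b →
        ‖x‖ ≤ b → ‖tamedDrift m L l u lam x - ∇ u x‖ ≤ lam * (C * b ^ k) := by
  obtain ⟨n, hn⟩ := exists_nat_ge l
  set c := ((L + m) ^ (l + 2)) ^ 2 with hc
  have hc0 : 0 < c := by positivity
  refine ⟨2 * (H + L + m) * 6 ^ (n + 1) * 3 ^ (2 * (n + 2)) / c, n + 2 + 2 * (n + 2),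
    by positivity, fun d u hu hu0 lam hlam hr b x hb hx => ?_⟩
  by_cases hxr : ‖x‖ ≤ radius m L l lam - 2
  · rw [tamedDrift_eq_gradient hxr, sub_self, norm_zero]
    positivity
  have hrad := radius_rpow hL hm hl hlam
  set r := radius m L l lam with hrdef
  have hr0 : 0 < r := by linarith
  have hrb : r ≤ 3 * b := by linarith
  have hg := hu.continuous_gDrift hl.le
  have hg1 : ‖gDrift m u x‖ ≤ (H + L + m) * (6 * b) ^ (n + 1) :=
    (hu.norm_gDrift_le_pow hm.le hL.le hl.le hn hu0 hb hx).trans (by gcongr; norm_num)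
  have hR1 : gSup m u r ≤ (H + L + m) * (6 * b) ^ (n + 1) := by
    refine gSup_le hr0 fun y hy => ?_
    refine (hu.norm_gDrift_le_pow (b := 3 * b) hm.le hL.le hl.le hn hu0 (by linarith)
      (hy.trans hrb)).trans (le_of_eq ?_)
    ring
  have hR0 := gSup_nonneg hg hr0
  have ht := cutT_mem_Icc r ‖x‖
  have hs := cutS_mem_Icc hr ‖x‖
  have e1 : tamedDrift m L l u lam x - ∇ u x =
      (cutT r ‖x‖ - 1) • gDrift m u x + (gSup m u r * cutS r ‖x‖) • x := by
    simp only [tamedDrift, gDrift, ← hrdef]; module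
  have h1 : ‖tamedDrift m L l u lam x - ∇ u x‖ ≤
      2 * (H + L + m) * 6 ^ (n + 1) * b ^ (n + 2) := by
    rw [e1]
    calc _ ≤ ‖(cutT r ‖x‖ - 1) • gDrift m u x‖ + ‖(gSup m u r * cutS r ‖x‖) • x‖ :=
          norm_add_le _ _
      _ ≤ 1 * ((H + L + m) * (6 * b) ^ (n + 1)) + (H + L + m) * (6 * b) ^ (n + 1) * 1 * b := by
          rw [norm_smul, norm_smul, Real.norm_of_nonneg (mul_nonneg hR0 hs.1)]
          have : ‖cutT r ‖x‖ - 1‖ ≤ 1 := by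
            rw [Real.norm_eq_abs, abs_le]; constructor <;> linarith [ht.1, ht.2]
          gcongr
          · exact hs.1
          · exact hs.2
      _ ≤ 1 * ((H + L + m) * (6 * b) ^ (n + 1)) * b + (H + L + m) * (6 * b) ^ (n + 1) * 1 * b := by
          rw [add_le_add_iff_right]
          exact le_mul_of_one_le_right (by positivity) hb
      _ = _ := by rw [mul_pow]; ring
  have h2 : 1 ≤ lam * (3 * b) ^ (2 * (n + 2)) / c := by
    rw [le_div_iff₀ hc0, one_mul]
    have h3 : r ^ (l + 2) ≤ (3 * b) ^ (n + 2) := by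
      calc r ^ (l + 2) ≤ (3 * b) ^ (l + 2) := by gcongr
        _ ≤ (3 * b) ^ ((n + 2 : ℕ) : ℝ) :=
            Real.rpow_le_rpow_of_exponent_le (by linarith) (by push_cast; linarith)
        _ = _ := Real.rpow_natCast _ _
    have h4 : c = lam * (r ^ (l + 2)) ^ 2 := by
      rw [hrad, div_pow, Real.sq_sqrt hlam.le]; field_simp; rw [hc]
    calc c = lam * (r ^ (l + 2)) ^ 2 := h4
      _ ≤ lam * ((3 * b) ^ (n + 2)) ^ 2 := by gcongr
      _ = _ := by rw [← pow_mul, mul_comm 2]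
  calc _ ≤ 2 * (H + L + m) * 6 ^ (n + 1) * b ^ (n + 2) * 1 := by rw [mul_one]; exact h1
    _ ≤ 2 * (H + L + m) * 6 ^ (n + 1) * b ^ (n + 2) * (lam * (3 * b) ^ (2 * (n + 2)) / c) := by
        gcongr
    _ = _ := by rw [mul_pow, pow_add b]; ring

/-- Along a Hamiltonian curve the position is affine up to a quadratic error. -/
lemma IsHamiltonianCurve.estimates {T G Λ B : ℝ} {z : ℝ → Phase d} (hT : 0 ≤ T)
    (hΛ : 0 ≤ Λ)
    (hz : IsHamiltonianCurve u T z) (hB : ∀ t ∈ Icc 0 T, ‖(z t).2‖ ≤ B)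
    (hG : ∀ t ∈ Icc 0 T, ‖∇ u (z t).1‖ ≤ G)
    (hlip : ∀ t ∈ Icc 0 T, ‖∇ u (z t).1 - ∇ u (z 0).1‖ ≤ Λ * ‖(z t).1 - (z 0).1‖) :
    ‖(z T).1 - (z 0).1 - T • (z 0).2‖ ≤ T ^ 2 * G ∧
      ‖∇ u (z T).1 - ∇ u (z 0).1‖ ≤ T * (Λ * B) ∧
      ‖(z T).2 - (z 0).2 + T • ∇ u (z 0).1‖ ≤ T ^ 2 * (Λ * B) := by
  have h0 : (0 : ℝ) ∈ Icc 0 T := left_mem_Icc.2 hT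
  have h1 : T ∈ Icc 0 T := right_mem_Icc.2 hT
  have hG0 : 0 ≤ G := (norm_nonneg _).trans (hG 0 h0)
  have hB0 : 0 ≤ B := (norm_nonneg _).trans (hB 0 h0)
  have hX : ∀ t ∈ Icc 0 T, HasDerivWithinAt (fun t => (z t).1) (z t).2 (Icc 0 T) t := fun t ht =>
    (ContinuousLinearMap.fst ℝ (E d) (E d)).hasFDerivAt.comp_hasDerivWithinAt t (hz t ht)
  have hV : ∀ t ∈ Icc 0 T, HasDerivWithinAt (fun t => (z t).2) (-∇ u (z t).1) (Icc 0 T) t :=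
    fun t ht =>
    (ContinuousLinearMap.snd ℝ (E d) (E d)).hasFDerivAt.comp_hasDerivWithinAt t (hz t ht)
  have hlin : ∀ (w : E d), ∀ t, HasDerivWithinAt (fun t : ℝ => t • w) w (Icc 0 T) t := fun w t => by
    simpa using ((hasDerivAt_id t).smul_const w).hasDerivWithinAt
  have hXb : ∀ t ∈ Icc 0 T, ‖(z t).1 - (z 0).1‖ ≤ T * B := by
    intro t ht
    have := Convex.norm_image_sub_le_of_norm_hasDerivWithin_le hX hB (convex_Icc 0 T) h0 ht
    rw [sub_zero, Real.norm_of_nonneg ht.1] at this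
    refine this.trans ?_
    rw [mul_comm]
    gcongr
    exact ht.2
  have hVb : ∀ t ∈ Icc 0 T, ‖(z t).2 - (z 0).2‖ ≤ T * G := by
    intro t ht
    have := Convex.norm_image_sub_le_of_norm_hasDerivWithin_le hV
      (fun s hs => by rw [norm_neg]; exact hG s hs) (convex_Icc 0 T) h0 ht
    rw [sub_zero, Real.norm_of_nonneg ht.1] at this
    refine this.trans ?_
    rw [mul_comm]
    gcongr
    exact ht.2
  have hgb : ∀ t ∈ Icc 0 T, ‖∇ u (z t).1 - ∇ u (z 0).1‖ ≤ T * (Λ * B) := by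
    intro t ht
    calc _ ≤ Λ * ‖(z t).1 - (z 0).1‖ := hlip t ht
      _ ≤ Λ * (T * B) := by gcongr; exact hXb t ht
      _ = _ := by ring
  refine ⟨?_, hgb T h1, ?_⟩
  · have := Convex.norm_image_sub_le_of_norm_hasDerivWithin_le
      (fun t ht => (hX t ht).sub (hlin (z 0).2 t)) hVb (convex_Icc 0 T) h0 h1
    rw [sub_zero, Real.norm_of_nonneg hT] at this
    simp only [Pi.sub_apply, zero_smul, sub_zero] at this
    rw [sub_right_comm]
    calc _ ≤ _ := this
      _ = _ := by ring
  · have := Convex.norm_image_sub_le_of_norm_hasDerivWithin_le (C := T * (Λ * B))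
      (fun t ht => (hV t ht).add (hlin (∇ u (z 0).1) t))
      (fun t ht => by rw [neg_add_eq_sub, norm_sub_rev]; exact hgb t ht) (convex_Icc 0 T) h0 h1
    rw [sub_zero, Real.norm_of_nonneg hT] at this
    simp only [Pi.add_apply, zero_smul, add_zero] at this
    rw [sub_add_eq_add_sub]
    calc _ ≤ _ := this
      _ = _ := by ring

/-- One velocity Verlet step with drift `b`. -/
def verletStep (b : E d → E d) (lam : ℝ) (z : Phase d) : Phase d :=
  stepB b lam (stepA lam (stepB b lam z))

/-- The position error is a Taylor remainder. The velocity error is a Taylor remainder plus λ/2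
times a sum of drift defects and gradient increments of order λ. The Lipschitz constant enters only
through λM times the position error, so a bound on λM suffices and no factor M appears. -/
lemma verletStep_error {M P G Λ B κ : ℝ} {z : ℝ → Phase d} {b : E d → E d}
    (hlam : 0 < lam) (hlam1 : lam ≤ 1) (hΛ : 0 ≤ Λ) (hκ : 1 ≤ κ)
    (hz : IsHamiltonianCurve u lam z) (hB : ∀ t ∈ Icc 0 lam, ‖(z t).2‖ ≤ B)
    (hG : ∀ t ∈ Icc 0 lam, ‖∇ u (z t).1‖ ≤ G)
    (hlip : ∀ t ∈ Icc 0 lam, ‖∇ u (z t).1 - ∇ u (z 0).1‖ ≤ Λ * ‖(z t).1 - (z 0).1‖)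
    (hb : ∀ x y, ‖b x - b y‖ ≤ M * ‖x - y‖) (hM : lam * M ≤ 2 * κ)
    (hP : ∀ t ∈ Icc 0 lam, ‖b (z t).1 - ∇ u (z t).1‖ ≤ lam * P) :
    ‖(verletStep b lam (z 0)).1 - (z lam).1‖ ≤ lam ^ 2 * (κ * (2 * G + 2 * P + 2 * (Λ * B))) ∧
      ‖(verletStep b lam (z 0)).2 - (z lam).2‖ ≤ lam ^ 2 * (κ * (2 * G + 2 * P + 2 * (Λ * B))) := by
  have h0 : (0 : ℝ) ∈ Icc 0 lam := left_mem_Icc.2 hlam.le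
  have h1 : lam ∈ Icc 0 lam := right_mem_Icc.2 hlam.le
  obtain ⟨hx, hg, hv⟩ := hz.estimates hlam.le hΛ hB hG hlip
  have hG0 : 0 ≤ G := (norm_nonneg _).trans (hG 0 h0)
  have hB0 : 0 ≤ B := (norm_nonneg _).trans (hB 0 h0)
  have hP0 : 0 ≤ P := by
    have := (norm_nonneg _).trans (hP 0 h0)
    exact nonneg_of_mul_nonneg_right this hlam
  set x := (z 0).1
  set v := (z 0).2
  set X := (z lam).1
  set V := (z lam).2
  have hbx : ‖b x‖ ≤ G + P := by
    have e : ‖b x‖ ≤ ‖b x - ∇ u x‖ + ‖∇ u x‖ := by simpa using norm_add_le (b x - ∇ u x) (∇ u x)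
    have e2 : lam * P ≤ 1 * P := by gcongr
    linarith [hP 0 h0, hG 0 h0]
  set x₁ := x + lam • (v - (lam / 2) • b x) with hx₁
  have hxx : ‖x₁ - X‖ ≤ lam ^ 2 * (2 * G + P) := by
    have e : x₁ - X = -(X - x - lam • v) + (-(lam ^ 2 / 2)) • b x := by rw [hx₁]; module
    rw [e]
    refine (norm_add_le _ _).trans ?_
    rw [norm_neg, norm_smul, norm_neg, Real.norm_of_nonneg (by positivity)]
    have : lam ^ 2 / 2 * ‖b x‖ ≤ lam ^ 2 / 2 * (G + P) := by gcongr
    nlinarith [sq_nonneg lam, mul_nonneg (sq_nonneg lam) hG0, mul_nonneg (sq_nonneg lam) hP0]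
  have hΛB : 0 ≤ Λ * B := mul_nonneg hΛ hB0
  refine ⟨?_, ?_⟩
  · refine (show ‖x₁ - X‖ ≤ _ from hxx).trans ?_
    gcongr ?_ * ?_
    nlinarith [mul_nonneg (sub_nonneg.2 hκ) hG0, mul_nonneg (sub_nonneg.2 hκ) hP0,
      mul_nonneg (zero_le_one.trans hκ) hΛB]
  · have e : (verletStep b lam (z 0)).2 - V = -(V - v + lam • ∇ u x) +
        (lam / 2) • (-(b x - ∇ u x) + (-(∇ u X - ∇ u x)) + (-(b X - ∇ u X)) + (b X - b x₁)) := by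
      simp only [verletStep, stepB, stepA]
      rw [← hx₁]
      module
    rw [e]
    refine (norm_add_le _ _).trans ?_
    rw [norm_neg, norm_smul, Real.norm_of_nonneg (by positivity)]
    have hsum : ‖-(b x - ∇ u x) + (-(∇ u X - ∇ u x)) + (-(b X - ∇ u X)) + (b X - b x₁)‖ ≤
        lam * P + lam * (Λ * B) + lam * P + M * (‖x₁ - X‖) := by
      refine norm_add_le_of_le (norm_add_le_of_le (norm_add_le_of_le ?_ ?_) ?_) ?_
      · rw [norm_neg]; exact hP 0 h0
      · rw [norm_neg]; exact hg
      · rw [norm_neg]; exact hP lam h1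
      · rw [norm_sub_rev x₁]; exact hb _ _
    have h2 : lam / 2 * ‖-(b x - ∇ u x) + (-(∇ u X - ∇ u x)) + (-(b X - ∇ u X)) + (b X - b x₁)‖ ≤
        lam / 2 * (lam * P + lam * (Λ * B) + lam * P + M * (‖x₁ - X‖)) := by gcongr
    have h3 : lam * M * ‖x₁ - X‖ ≤ 2 * κ * (lam ^ 2 * (2 * G + P)) := by gcongr
    have h4 := mul_nonneg (mul_nonneg (sub_nonneg.2 hκ) (sq_nonneg lam)) hΛB
    have h5 := mul_nonneg (mul_nonneg (sub_nonneg.2 hκ) (sq_nonneg lam)) hP0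
    have h6 := mul_nonneg (sq_nonneg lam) hΛB
    linarith

lemma norm_le_of_energy_le (hm : 0 < m) (hu : PotentialAssumptions m L l u) (hu0 : ‖∇ u 0‖ ≤ H)
    {D : ℝ} (z : Phase d) (hD : energy u z - u 0 ≤ D) :
    ‖z.1‖ ≤ 1 + (2 / m + 2) * (D + H ^ 2 / (2 * m)) ∧
      ‖z.2‖ ≤ 1 + (2 / m + 2) * (D + H ^ 2 / (2 * m)) := by
  have h1 := energy_lower_sq hm hu z
  have h2 : ‖∇ u 0‖ ^ 2 / (2 * m) ≤ H ^ 2 / (2 * m) := by gcongr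
  set Q := D + H ^ 2 / (2 * m) with hQ
  have h3 : m / 2 * ‖z.1‖ ^ 2 + ‖z.2‖ ^ 2 / 2 ≤ Q := by linarith
  have h4 : 0 ≤ Q := le_trans (by positivity) h3
  have h5 : ‖z.1‖ ^ 2 ≤ 2 / m * Q := by
    rw [div_mul_eq_mul_div, le_div_iff₀ hm]
    linarith [sq_nonneg ‖z.2‖]
  have h6 : ‖z.2‖ ^ 2 ≤ 2 * Q := by
    have : 0 ≤ m / 2 * ‖z.1‖ ^ 2 := by positivity
    linarith
  have h7 : 0 ≤ 2 / m * Q := by positivity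
  constructor
  · nlinarith [sq_nonneg (‖z.1‖ - 1)]
  · nlinarith [sq_nonneg (‖z.2‖ - 1)]

lemma PotentialAssumptions.energy_le_pow (hm : 0 < m) (hL : 0 ≤ L) (hl : 0 ≤ l) (hn : l ≤ n)
    (hu : PotentialAssumptions m L l u) (hH : ‖∇ u 0‖ ≤ H) (z : Phase d) :
    energy u z - u 0 ≤ (H + L + 1) * (2 * (1 + ‖z.1‖ + ‖z.2‖)) ^ (n + 2) := by
  set b := 1 + ‖z.1‖ + ‖z.2‖ with hb
  have hx0 := norm_nonneg z.1
  have hv0 := norm_nonneg z.2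
  have hb1 : 1 ≤ b := by linarith
  have hH0 : 0 ≤ H := (norm_nonneg _).trans hH
  have h1 := hu.tangent_le z.1 0
  rw [zero_sub, inner_neg_right, norm_neg] at h1
  have h2 := real_inner_le_norm (∇ u z.1) z.1
  have h3 := hu.norm_gradient_le_pow hL hl hn hH hb1 (x := z.1) (by linarith)
  have h4 : ‖∇ u z.1‖ * ‖z.1‖ ≤ (H + L) * (2 * b) ^ (n + 1) * (2 * b) := by
    gcongr; linarith
  have h5 : (2 * b) ^ 2 ≤ (2 * b) ^ (n + 2) := pow_le_pow_right₀ (by linarith) (by omega)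
  have h6 : ‖z.2‖ ^ 2 / 2 ≤ (2 * b) ^ 2 := by nlinarith
  have h7 : 0 ≤ m * ‖z.1‖ ^ 2 := by positivity
  have h8 : (H + L + 1) * (2 * b) ^ (n + 2) =
    (H + L) * (2 * b) ^ (n + 1) * (2 * b) + (2 * b) ^ (n + 2) := by ring
  unfold energy
  linarith

/-- The local error of the tamed Verlet step against the Hamiltonian flow is quadratic in the step
size, with a polynomial prefactor that does not depend on the dimension. -/
lemma exists_local_error {κ : ℝ} (hm : 0 < m) (hL : 0 < L) (hl : 0 < l) (hH : 0 ≤ H)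
    (hκ : 1 ≤ κ) :
    ∃ (C : ℝ) (k : ℕ), 0 < C ∧ ∀ (d : ℕ) (u : E d → ℝ), PotentialAssumptions m L l u →
      ‖∇ u 0‖ ≤ H → ∀ lam M, 0 < lam → lam ≤ 1 → 2 ≤ radius m L l lam → lam * M ≤ 2 * κ →
      (∀ x y, ‖tamedDrift m L l u lam x - tamedDrift m L l u lam y‖ ≤ M * ‖x - y‖) →
      ∀ z : ℝ → Phase d, IsHamiltonianCurve u lam z →
      (∀ t ∈ Icc 0 lam, energy u (z t) = energy u (z 0)) →
      ‖(verletStep (tamedDrift m L l u lam) lam (z 0)).1 - (z lam).1‖ ≤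
          lam ^ 2 * (C * (1 + ‖(z 0).1‖ + ‖(z 0).2‖) ^ k) ∧
        ‖(verletStep (tamedDrift m L l u lam) lam (z 0)).2 - (z lam).2‖ ≤
          lam ^ 2 * (C * (1 + ‖(z 0).1‖ + ‖(z 0).2‖) ^ k) := by
  obtain ⟨Ct, kt, hCt, htame⟩ := exists_norm_tamedDrift_sub_le hm hL hl hH
  obtain ⟨n, hn⟩ := exists_nat_ge l
  set Cb : ℝ := 1 + (2 / m + 2) * ((H + L + 1) * 2 ^ (n + 2) + H ^ 2 / (2 * m)) with hCb
  have hCb1 : 1 ≤ Cb := le_add_of_nonneg_right (by positivity)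
  set Cf : ℝ := 2 * ((H + L) * 2 ^ (n + 1)) + 2 * Ct + 2 * (L * 3 ^ n) with hCf
  have hCf0 : 0 < Cf := by positivity
  refine ⟨κ * (Cf * Cb ^ (n + 1 + kt)), (n + 2) * (n + 1 + kt), by positivity,
    fun d u hu hu0 lam M hlam hlam1 hr hM hb z hz henergy => ?_⟩
  set y := 1 + ‖(z 0).1‖ + ‖(z 0).2‖ with hy
  have hy1 : 1 ≤ y := by
    have := norm_nonneg (z 0).1
    have := norm_nonneg (z 0).2
    linarith
  have hyn : 1 ≤ y ^ (n + 2) := one_le_pow₀ hy1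
  -- Conservation of energy bounds the whole curve by a power of the initial size, which makes the
  -- constants G, Λ, P polynomial in y.
  set B := Cb * y ^ (n + 2) with hB
  have hB1 : 1 ≤ B := one_le_mul_of_one_le_of_one_le hCb1 hyn
  have hD := hu.energy_le_pow hm hL.le hl.le hn hu0 (z 0)
  rw [← hy] at hD
  have hbound : ∀ t ∈ Icc 0 lam, ‖(z t).1‖ ≤ B ∧ ‖(z t).2‖ ≤ B := by
    intro t ht
    have h1 := norm_le_of_energy_le hm hu hu0
      (D := (H + L + 1) * (2 * y) ^ (n + 2)) (z t) (by rw [henergy t ht]; exact hD)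
    have h2 : 1 + (2 / m + 2) * ((H + L + 1) * (2 * y) ^ (n + 2) + H ^ 2 / (2 * m)) ≤ B := by
      calc _ ≤ 1 * y ^ (n + 2) + (2 / m + 2) * ((H + L + 1) * (2 * y) ^ (n + 2) +
            H ^ 2 / (2 * m) * y ^ (n + 2)) := by
            gcongr
            · linarith
            · exact le_mul_of_one_le_right (by positivity) hyn
        _ = B := by rw [hB, hCb, mul_pow]; ring
    exact ⟨h1.1.trans h2, h1.2.trans h2⟩
  have h0 : (0 : ℝ) ∈ Icc 0 lam := left_mem_Icc.2 hlam.le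
  have hΛ : L * (1 + 2 * B) ^ l ≤ L * (3 * B) ^ n := by
    gcongr
    calc (1 + 2 * B) ^ l ≤ (3 * B) ^ l := by
          have : 1 + 2 * B ≤ 3 * B := by linarith
          gcongr
      _ ≤ (3 * B) ^ (n : ℝ) := Real.rpow_le_rpow_of_exponent_le (by linarith) hn
      _ = _ := Real.rpow_natCast _ _
  have hmain := verletStep_error (G := (H + L) * (2 * B) ^ (n + 1)) (Λ := L * (3 * B) ^ n)
    (P := Ct * B ^ kt) hlam hlam1 (by positivity) hκ hz (fun t ht => (hbound t ht).2)
    (fun t ht => hu.norm_gradient_le_pow hL.le hl.le hn hu0 hB1 (hbound t ht).1)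
    (fun t ht => (hu.norm_gradient_sub_le hL.le hl.le (hbound t ht).1 (hbound 0 h0).1).trans
      (mul_le_mul_of_nonneg_right hΛ (norm_nonneg _))) hb hM
    (fun t ht => htame d u hu hu0 lam hlam hr B _ hB1 (hbound t ht).1)
  have hfin : 2 * ((H + L) * (2 * B) ^ (n + 1)) + 2 * (Ct * B ^ kt) + 2 * (L * (3 * B) ^ n * B) ≤
      Cf * Cb ^ (n + 1 + kt) * y ^ ((n + 2) * (n + 1 + kt)) := by
    have e1 : B ^ (n + 1) ≤ B ^ (n + 1 + kt) := pow_le_pow_right₀ hB1 (by omega)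
    have e2 : B ^ kt ≤ B ^ (n + 1 + kt) := pow_le_pow_right₀ hB1 (by omega)
    calc _ = 2 * ((H + L) * 2 ^ (n + 1)) * B ^ (n + 1) + 2 * Ct * B ^ kt +
          2 * (L * 3 ^ n) * B ^ (n + 1) := by
            clear_value B Cf Cb
            rw [mul_pow, mul_pow]; ring
      _ ≤ 2 * ((H + L) * 2 ^ (n + 1)) * B ^ (n + 1 + kt) + 2 * Ct * B ^ (n + 1 + kt) +
          2 * (L * 3 ^ n) * B ^ (n + 1 + kt) := by gcongr
      _ = Cf * B ^ (n + 1 + kt) := by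
          rw [hCf, add_mul _ (2 * (L * 3 ^ n)), add_mul _ (2 * Ct)]
      _ = _ := by rw [hB, mul_pow, ← pow_mul]; ring
  have hκ0 : 0 ≤ κ := by linarith
  rw [mul_assoc κ]
  exact ⟨hmain.1.trans (by gcongr), hmain.2.trans (by gcongr)⟩

end LocalError

/-! ### Couplings and the Wasserstein distance -/

section Couplings

variable {X Y : Type*} [MeasurableSpace X] [MeasurableSpace Y]

lemma IsCoupling.isProbabilityMeasure {ρ : Measure (X × X)} {μ ν : Measure X}
    (h : IsCoupling ρ μ ν) [IsProbabilityMeasure μ] : IsProbabilityMeasure ρ := by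
  refine ⟨?_⟩
  have h1 : ρ.map Prod.fst univ = 1 := by rw [h.1, measure_univ]
  rwa [Measure.map_apply measurable_fst MeasurableSet.univ, preimage_univ] at h1

lemma W2_le_of_isCoupling (sq : X → X → ℝ) {ρ : Measure (X × X)} {μ ν : Measure X}
    (h : IsCoupling ρ μ ν) :
    W2 sq μ ν ≤ (∫⁻ p, ENNReal.ofReal (sq p.1 p.2) ∂ρ) ^ (1 / 2 : ℝ) :=
  ENNReal.rpow_le_rpow (iInf₂_le ρ h) (by norm_num)

lemma W2_eq_iInf (sq : X → X → ℝ) (μ ν : Measure X) :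
    W2 sq μ ν = ⨅ ρ : {ρ : Measure (X × X) // IsCoupling ρ μ ν},
      (∫⁻ p, ENNReal.ofReal (sq p.1 p.2) ∂ρ.1) ^ (1 / 2 : ℝ) := by
  have h : (0 : ℝ) < 1 / 2 := by norm_num
  rw [W2, iInf_subtype']
  exact (ENNReal.orderIsoRpow (1 / 2) h).map_iInf _

/-- An estimate valid for every initial coupling passes to the infimum, so no optimal coupling is
required. -/
lemma le_mul_W2_add (sq : X → X → ℝ) {μ ν : Measure X} {A D x : ℝ≥0∞} (hA0 : A ≠ 0) (hA : A ≠ ⊤)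
    (h : ∀ ρ, IsCoupling ρ μ ν →
      x ≤ A * (∫⁻ p, ENNReal.ofReal (sq p.1 p.2) ∂ρ) ^ (1 / 2 : ℝ) + D) :
    x ≤ A * W2 sq μ ν + D := by
  rw [W2_eq_iInf, ENNReal.mul_iInf_of_ne hA0 hA, ENNReal.iInf_add]
  exact le_iInf fun ρ => h ρ.1 ρ.2

/-- A map that does not increase distances does not increase the Wasserstein distance. -/
lemma W2_map_le {sq : X → X → ℝ} {sq' : Y → Y → ℝ} {f : X → Y} (hf : Measurable f)
    (hsq : ∀ x y, sq' (f x) (f y) ≤ sq x y) (hmeas : Measurable fun p : Y × Y => sq' p.1 p.2)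
    (μ ν : Measure X) : W2 sq' (μ.map f) (ν.map f) ≤ W2 sq μ ν := by
  rw [W2_eq_iInf sq]
  refine le_iInf fun ⟨ρ, hρ⟩ => ?_
  have hff : Measurable (Prod.map f f) := hf.prodMap hf
  have hc : IsCoupling (ρ.map (Prod.map f f)) (μ.map f) (ν.map f) := by
    refine ⟨?_, ?_⟩
    · rw [Measure.map_map measurable_fst hff, ← hρ.1, Measure.map_map hf measurable_fst]; rfl
    · rw [Measure.map_map measurable_snd hff, ← hρ.2, Measure.map_map hf measurable_snd]; rfl
  refine (W2_le_of_isCoupling sq' hc).trans ?_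
  rw [lintegral_map (by fun_prop) hff]
  refine ENNReal.rpow_le_rpow (lintegral_mono fun p => ?_) (by norm_num)
  exact ENNReal.ofReal_le_ofReal (hsq _ _)

end Couplings

/-! ### The twisted norm and its transport cost -/

section TwistedCost

variable {d : ℕ} {β A : ℝ}

/-- Completing the square gives |z₁ + βz₂|² + (A - β²)|z₂|², a Euclidean norm after a linear map;
the triangle and Minkowski inequalities follow. -/
lemma twistForm_eq_norm_sq (hA : β ^ 2 ≤ A) (z : Phase d) : twistForm β A z.1 z.2 =
    ‖WithLp.toLp 2 (z.1 + β • z.2, √(A - β ^ 2) • z.2)‖ ^ 2 := by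
  rw [WithLp.prod_norm_sq_eq_of_L2]
  change _ = ‖z.1 + β • z.2‖ ^ 2 + ‖√(A - β ^ 2) • z.2‖ ^ 2
  rw [norm_add_sq_real, norm_smul, norm_smul, mul_pow, mul_pow, real_inner_smul_right, Real.norm_eq_abs,
    Real.norm_eq_abs, sq_abs, sq_abs, Real.sq_sqrt (by linarith), twistForm]
  ring

lemma twistForm_nonneg (hA : β ^ 2 ≤ A) (z : Phase d) : 0 ≤ twistForm β A z.1 z.2 := by
  rw [twistForm_eq_norm_sq hA]; positivity

lemma sqrt_twistForm_add_le (hA : β ^ 2 ≤ A) (z w : Phase d) :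
    √(twistForm β A (z + w).1 (z + w).2) ≤
      √(twistForm β A z.1 z.2) + √(twistForm β A w.1 w.2) := by
  rw [twistForm_eq_norm_sq hA, twistForm_eq_norm_sq hA, twistForm_eq_norm_sq hA,
    Real.sqrt_sq (norm_nonneg _), Real.sqrt_sq (norm_nonneg _), Real.sqrt_sq (norm_nonneg _)]
  refine le_trans (le_of_eq (congrArg norm ?_)) (norm_add_le _ _)
  refine congrArg (WithLp.toLp 2) (Prod.ext ?_ ?_)
  · change z.1 + w.1 + β • (z.2 + w.2) = z.1 + β • z.2 + (w.1 + β • w.2)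
    module
  · change √(A - β ^ 2) • (z.2 + w.2) = √(A - β ^ 2) • z.2 + √(A - β ^ 2) • w.2
    module

lemma continuous_twistForm : Continuous fun z : Phase d => twistForm β A z.1 z.2 := by
  unfold twistForm; fun_prop

/-- Minkowski's inequality for the twisted norm. -/
lemma lintegral_twistForm_add_le (hA : β ^ 2 ≤ A) {Ω : Type*} [MeasurableSpace Ω] {P : Measure Ω}
    {f g : Ω → Phase d} (hf : Measurable f) (hg : Measurable g) :
    (∫⁻ ω, ENNReal.ofReal (twistForm β A (f ω + g ω).1 (f ω + g ω).2) ∂P) ^ (1 / 2 : ℝ) ≤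
      (∫⁻ ω, ENNReal.ofReal (twistForm β A (f ω).1 (f ω).2) ∂P) ^ (1 / 2 : ℝ) +
        (∫⁻ ω, ENNReal.ofReal (twistForm β A (g ω).1 (g ω).2) ∂P) ^ (1 / 2 : ℝ) := by
  have hN : Measurable fun z : Phase d => ENNReal.ofReal √(twistForm β A z.1 z.2) :=
    (Real.continuous_sqrt.comp continuous_twistForm).measurable.ennreal_ofReal
  have hsq : ∀ z : Phase d, ENNReal.ofReal (twistForm β A z.1 z.2) =
      ENNReal.ofReal √(twistForm β A z.1 z.2) ^ (2 : ℝ) := by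
    intro z
    rw [ENNReal.ofReal_rpow_of_nonneg (Real.sqrt_nonneg _) (by norm_num), Real.rpow_two,
      Real.sq_sqrt (twistForm_nonneg hA z)]
  simp_rw [hsq]
  refine le_trans (ENNReal.rpow_le_rpow (lintegral_mono fun ω => ?_) (by norm_num))
    (ENNReal.lintegral_Lp_add_le (hN.comp hf).aemeasurable (hN.comp hg).aemeasurable one_le_two)
  refine ENNReal.rpow_le_rpow ?_ (by norm_num)
  simp only [Pi.add_apply]
  rw [← ENNReal.ofReal_add (Real.sqrt_nonneg _) (Real.sqrt_nonneg _)]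
  exact ENNReal.ofReal_le_ofReal (sqrt_twistForm_add_le hA _ _)

/-- The twisted quadratic transport cost of a coupling. -/
def twistCost (β A : ℝ) (ρ : Measure (Phase d × Phase d)) : ℝ≥0∞ :=
  (∫⁻ p, ENNReal.ofReal (twistForm β A (p.1 - p.2).1 (p.1 - p.2).2) ∂ρ) ^ (1 / 2 : ℝ)

lemma rpow_half_lintegral_const_mul_le {Ω : Type*} [MeasurableSpace Ω] {P : Measure Ω}
    {f g : Ω → ℝ} {c : ℝ} (hc : 0 ≤ c) (h : ∀ ω, f ω ≤ c * g ω) :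
    (∫⁻ ω, ENNReal.ofReal (f ω) ∂P) ^ (1 / 2 : ℝ) ≤
      ENNReal.ofReal √c * (∫⁻ ω, ENNReal.ofReal (g ω) ∂P) ^ (1 / 2 : ℝ) := by
  have h1 : ∫⁻ ω, ENNReal.ofReal (f ω) ∂P ≤
      ENNReal.ofReal c * ∫⁻ ω, ENNReal.ofReal (g ω) ∂P := by
    rw [← lintegral_const_mul' _ _ ENNReal.ofReal_ne_top]
    refine lintegral_mono fun ω => ?_
    rw [← ENNReal.ofReal_mul hc]
    exact ENNReal.ofReal_le_ofReal (h ω)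
  refine (ENNReal.rpow_le_rpow h1 (by norm_num)).trans (le_of_eq ?_)
  rw [ENNReal.mul_rpow_of_nonneg _ _ (by norm_num), ENNReal.ofReal_rpow_of_nonneg hc (by norm_num),
    Real.sqrt_eq_rpow]

lemma twistCost_le {M : ℝ} (hM : 1 ≤ M) (hβ : β ^ 2 ≤ 1 / (4 * M))
    (ρ : Measure (Phase d × Phase d)) : twistCost β (2 / (3 * M)) ρ ≤
      ENNReal.ofReal √(3 / 2) *
        (∫⁻ p, ENNReal.ofReal (phaseSqDist p.1 p.2) ∂ρ) ^ (1 / 2 : ℝ) :=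
  rpow_half_lintegral_const_mul_le (by norm_num) fun _ => twistForm_le hM hβ _ _

lemma le_twistCost {M : ℝ} (hM : 1 ≤ M) (hβ : β ^ 2 ≤ 1 / (4 * M))
    (ρ : Measure (Phase d × Phase d)) :
    (∫⁻ p, ENNReal.ofReal (phaseSqDist p.1 p.2) ∂ρ) ^ (1 / 2 : ℝ) ≤
      ENNReal.ofReal √(24 / 7 * M) * twistCost β (2 / (3 * M)) ρ :=
  rpow_half_lintegral_const_mul_le (by positivity) fun _ => le_twistForm hM hβ _ _

end TwistedCost

/-! ### One step of the coupled chains -/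

section CoupledChain

variable {d : ℕ} {lam γ : ℝ} {b : E d → E d} {Φ : Phase d → Phase d}

lemma obaboStep_eq (z : Phase d) (g g' : E d) : obaboStep b lam γ z g g' =
    stepO lam γ (verletStep b lam (stepO lam γ z g)) g' := rfl

lemma continuous_verletStep (hb : Continuous b) : Continuous (verletStep b lam) := by
  unfold verletStep stepB stepA
  fun_prop

/-- The two Gaussian inputs of a transition. -/
abbrev noise (d : ℕ) : Measure (E d × E d) := (stdGaussian (E d)).prod (stdGaussian (E d))

/-- Transition of a pair: the first component follows the OBABO chain, the second one replaces the
numerical integrator by `Φ`, with the same noise. -/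
def coupledStep (b : E d → E d) (Φ : Phase d → Phase d) (lam γ : ℝ)
    (q : (Phase d × Phase d) × (E d × E d)) : Phase d × Phase d :=
  (obaboStep b lam γ q.1.1 q.2.1 q.2.2, stepO lam γ (Φ (stepO lam γ q.1.2 q.2.1)) q.2.2)

lemma measurable_stepO_comp {α : Type*} [MeasurableSpace α] {f : α → Phase d} {g : α → E d}
    (hf : Measurable f) (hg : Measurable g) : Measurable fun a => stepO lam γ (f a) (g a) :=
  (continuous_stepO lam γ).measurable.comp (hf.prodMk hg)

lemma measurable_obaboStep (hb : Continuous b) :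
    Measurable fun q : Phase d × (E d × E d) => obaboStep b lam γ q.1 q.2.1 q.2.2 :=
  measurable_stepO_comp ((continuous_verletStep hb).measurable.comp
    (measurable_stepO_comp (by fun_prop) (by fun_prop))) (by fun_prop)

lemma measurable_coupledStep (hb : Continuous b) (hΦ : Measurable Φ) :
    Measurable (coupledStep b Φ lam γ) :=
  ((measurable_obaboStep hb).comp (by fun_prop : Measurable
      fun q : (Phase d × Phase d) × (E d × E d) => (q.1.1, q.2))).prodMk
    (measurable_stepO_comp (hΦ.comp (measurable_stepO_comp (by fun_prop) (by fun_prop)))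
      (by fun_prop))

lemma isProbabilityMeasure_obaboLaw (hb : Continuous b) {μ₀ : Measure (Phase d)}
    [IsProbabilityMeasure μ₀] (n : ℕ) : IsProbabilityMeasure (obaboLaw b lam γ μ₀ n) := by
  induction n with
  | zero => assumption
  | succ n ih => exact Measure.isProbabilityMeasure_map (measurable_obaboStep hb).aemeasurable

variable {ν : Measure (Phase d)}

/-- The first marginal is the definition of the chain. For the second, each of refreshment, `Φ` and
refreshment leaves `ν` invariant. -/
lemma isCoupling_coupledStep [IsProbabilityMeasure ν] (hb : Continuous b) (hΦ : Measurable Φ) (hΦν : ν.map Φ = ν)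
    (hO : (ν.prod (stdGaussian (E d))).map (fun q => stepO lam γ q.1 q.2) = ν)
    {μ₀ : Measure (Phase d)} [IsProbabilityMeasure μ₀] {n : ℕ}
    {ρ : Measure (Phase d × Phase d)} (hρ : IsCoupling ρ (obaboLaw b lam γ μ₀ n) ν) :
    IsCoupling ((ρ.prod (noise d)).map (coupledStep b Φ lam γ)) (obaboLaw b lam γ μ₀ (n + 1)) ν := by
  have := isProbabilityMeasure_obaboLaw (lam := lam) (γ := γ) (μ₀ := μ₀) hb n
  have := hρ.isProbabilityMeasure
  have hF := measurable_coupledStep (lam := lam) (γ := γ) hb hΦ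
  have hpush : ∀ {f : Phase d × Phase d → Phase d}, Measurable f →
      (ρ.map f).prod (noise d) = (ρ.prod (noise d)).map (Prod.map f id) := fun {f} hf => by
    conv_lhs => rw [← Measure.map_id (μ := noise d)]
    exact Measure.map_prod_map _ _ hf measurable_id
  refine ⟨?_, ?_⟩
  · rw [Measure.map_map measurable_fst hF, obaboLaw, ← hρ.1, hpush measurable_fst,
      Measure.map_map (measurable_obaboStep hb) (measurable_fst.prodMap measurable_id)]
    rfl
  · have hS : Measurable fun q : Phase d × E d => stepO lam γ q.1 q.2 :=
      (continuous_stepO lam γ).measurable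
    have hassoc : ν.prod (noise d) =
        ((ν.prod (stdGaussian (E d))).prod (stdGaussian (E d))).map MeasurableEquiv.prodAssoc :=
      (Measure.prodAssoc_prod ..).symm
    have hS2 : Measurable fun q : Phase d × (E d × E d) =>
        stepO lam γ (Φ (stepO lam γ q.1 q.2.1)) q.2.2 :=
      measurable_stepO_comp (hΦ.comp (measurable_stepO_comp (by fun_prop) (by fun_prop)))
        (by fun_prop)
    calc ((ρ.prod (noise d)).map (coupledStep b Φ lam γ)).map Prod.snd
        = ((ρ.prod (noise d)).map (Prod.map Prod.snd id)).map
            fun q => stepO lam γ (Φ (stepO lam γ q.1 q.2.1)) q.2.2 := by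
          rw [Measure.map_map measurable_snd hF,
            Measure.map_map hS2 (measurable_snd.prodMap measurable_id)]
          rfl
      _ = (ν.prod (noise d)).map fun q => stepO lam γ (Φ (stepO lam γ q.1 q.2.1)) q.2.2 := by
          rw [← hpush measurable_snd, hρ.2]
      _ = (((ν.prod (stdGaussian (E d))).prod (stdGaussian (E d))).map
            (Prod.map (Φ ∘ fun q : Phase d × E d => stepO lam γ q.1 q.2) id)).map
            (fun q => stepO lam γ q.1 q.2) := by
          rw [hassoc, Measure.map_map hS2 MeasurableEquiv.prodAssoc.measurable,
            Measure.map_map hS ((hΦ.comp hS).prodMap measurable_id)]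
          rfl
      _ = ν := by
          rw [← Measure.map_prod_map _ _ (hΦ.comp hS) measurable_id, Measure.map_id,
            ← Measure.map_map hΦ hS, hO, hΦν, hO]

/-- The velocity scaling part of the refreshment, applied to differences. -/
def scaleVel (lam γ : ℝ) (z : Phase d) : Phase d := (z.1, Real.exp (-(lam * γ) / 2) • z.2)

lemma stepO_sub_stepO (z w : Phase d) (g : E d) :
    stepO lam γ z g - stepO lam γ w g = scaleVel lam γ (z - w) := by
  simp only [stepO, scaleVel, Prod.mk_sub_mk, Prod.fst_sub, Prod.snd_sub, Prod.mk.injEq, true_and]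
  module

lemma scaleVel_add (z w : Phase d) :
    scaleVel lam γ (z + w) = scaleVel lam γ z + scaleVel lam γ w := by
  simp only [scaleVel, Prod.fst_add, Prod.snd_add, Prod.mk_add_mk, smul_add]

lemma twistForm_verletStep_contraction {m M : ℝ} (hb : DriftBounds m M b) (hlam : 0 < lam)
    (hm : 0 < m) (hγ0 : 0 < γ) (hγ : 4 * M ≤ γ ^ 2) (hlamγ : lam ≤ m / (33 * γ ^ 3))
    (z w : Phase d) (g : E d) :
    twistForm (twistCoeff (lam * γ) / γ) (2 / (3 * M))
      (scaleVel lam γ (verletStep b lam (stepO lam γ z g) - verletStep b lam (stepO lam γ w g))).1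
      (scaleVel lam γ (verletStep b lam (stepO lam γ z g) - verletStep b lam (stepO lam γ w g))).2 ≤
      (1 - m / (3 * γ) * lam) *
        twistForm (twistCoeff (lam * γ) / γ) (2 / (3 * M)) (z - w).1 (z - w).2 := by
  set z₁ := verletStep b lam (stepO lam γ z g) with hz₁
  set w₁ := verletStep b lam (stepO lam γ w g) with hw₁
  refine twistForm_contraction hlam hm hb.two_mul_le hγ0 hγ hlamγ
    (D₀ := b z.1 - b w.1) (D₁ := b z₁.1 - b w₁.1) ?_ ?_ (hb.cocoercive _ _) (hb.cocoercive _ _)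
    (hb.strongly_monotone _ _) (hb.strongly_monotone _ _)
  · simp only [scaleVel, hz₁, hw₁, verletStep, stepB, stepA, stepO, Prod.fst_sub, Prod.snd_sub]
    module
  · have e : ∀ p : Phase d, (verletStep b lam p).2 =
        p.2 - (lam / 2) • b p.1 - (lam / 2) • b (verletStep b lam p).1 := fun p => rfl
    simp only [scaleVel, Prod.snd_sub]
    rw [hz₁, e, ← hz₁, hw₁, e, ← hw₁]
    simp only [stepO]
    module

/-- The pair is split through the numerical step started from the second component: numerical
against numerical contracts, numerical against `Φ` is the local error. The latter sits at the
refreshed second component, whose law is `ν`, so only an average over `ν` is needed. -/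
lemma twistCost_coupledStep_le {m M δ : ℝ} (hb : DriftBounds m M b) (hbc : Continuous b)
    (hΦ : Measurable Φ) (hM : 1 ≤ M) (hlam : 0 < lam) (hm : 0 < m) (hγ0 : 0 < γ)
    (hγ : 4 * M ≤ γ ^ 2) (hlamγ : lam ≤ m / (33 * γ ^ 3)) (hh : lam * γ ≤ 2)
    (hq : 0 ≤ 1 - m / (3 * γ) * lam)
    (hO : (ν.prod (stdGaussian (E d))).map (fun q => stepO lam γ q.1 q.2) = ν)
    (herr : (∫⁻ z, ENNReal.ofReal (3 / 2 * (‖(verletStep b lam z).1 - (Φ z).1‖ ^ 2 +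
      ‖(verletStep b lam z).2 - (Φ z).2‖ ^ 2)) ∂ν) ^ (1 / 2 : ℝ) ≤ ENNReal.ofReal δ)
    {ρ : Measure (Phase d × Phase d)} [IsProbabilityMeasure ρ] (hρ : ρ.map Prod.snd = ν) :
    twistCost (twistCoeff (lam * γ) / γ) (2 / (3 * M))
        ((ρ.prod (noise d)).map (coupledStep b Φ lam γ)) ≤
      ENNReal.ofReal √(1 - m / (3 * γ) * lam) *
        twistCost (twistCoeff (lam * γ) / γ) (2 / (3 * M)) ρ + ENNReal.ofReal δ := by
  have hM0 : 0 < M := by linarith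
  have hβ := twistCoeff_div_sq_le hlam hγ0 hM0 hγ hh
  set β := twistCoeff (lam * γ) / γ
  have hA : β ^ 2 ≤ 2 / (3 * M) := hβ.trans (by
    rw [div_le_div_iff₀ (by positivity) (by positivity)]; linarith)
  have hV : Measurable (verletStep b lam) := (continuous_verletStep hbc).measurable
  have hs1 : Measurable fun q : (Phase d × Phase d) × (E d × E d) => stepO lam γ q.1.1 q.2.1 :=
    measurable_stepO_comp (by fun_prop) (by fun_prop)
  have hs2 : Measurable fun q : (Phase d × Phase d) × (E d × E d) => stepO lam γ q.1.2 q.2.1 :=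
    measurable_stepO_comp (by fun_prop) (by fun_prop)
  have hscale : Measurable (scaleVel lam γ : Phase d → Phase d) := by unfold scaleVel; fun_prop
  set f : (Phase d × Phase d) × (E d × E d) → Phase d := fun q =>
    scaleVel lam γ (verletStep b lam (stepO lam γ q.1.1 q.2.1) -
      verletStep b lam (stepO lam γ q.1.2 q.2.1)) with hf
  set e : (Phase d × Phase d) × (E d × E d) → Phase d := fun q =>
    scaleVel lam γ (verletStep b lam (stepO lam γ q.1.2 q.2.1) -
      Φ (stepO lam γ q.1.2 q.2.1)) with he
  have hfm : Measurable f := hscale.comp ((hV.comp hs1).sub (hV.comp hs2))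
  have hem : Measurable e := hscale.comp ((hV.comp hs2).sub (hΦ.comp hs2))
  have hsplit : ∀ q, (coupledStep b Φ lam γ q).1 - (coupledStep b Φ lam γ q).2 = f q + e q := by
    intro q
    rw [coupledStep, obaboStep_eq, stepO_sub_stepO, hf, he, ← scaleVel_add, sub_add_sub_cancel]
  have hN : Measurable fun p : Phase d × Phase d =>
      ENNReal.ofReal (twistForm β (2 / (3 * M)) (p.1 - p.2).1 (p.1 - p.2).2) :=
    (continuous_twistForm.measurable.comp
      (measurable_fst.sub measurable_snd)).ennreal_ofReal
  rw [twistCost, lintegral_map hN (measurable_coupledStep hbc hΦ)]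
  simp_rw [hsplit]
  refine (lintegral_twistForm_add_le hA hfm hem).trans (add_le_add ?_ ?_)
  · have h1 : ∀ q : (Phase d × Phase d) × (E d × E d),
        twistForm β (2 / (3 * M)) (f q).1 (f q).2 ≤ (1 - m / (3 * γ) * lam) *
          twistForm β (2 / (3 * M)) (q.1.1 - q.1.2).1 (q.1.1 - q.1.2).2 := fun q =>
      twistForm_verletStep_contraction hb hlam hm hγ0 hγ hlamγ q.1.1 q.1.2 q.2.1
    have h2 : ρ = (ρ.prod (noise d)).map Prod.fst := by
      rw [← Measure.fst, Measure.fst_prod]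
    have h3 : twistCost β (2 / (3 * M)) ρ = (∫⁻ q, ENNReal.ofReal (twistForm β (2 / (3 * M))
        (q.1.1 - q.1.2).1 (q.1.1 - q.1.2).2) ∂(ρ.prod (noise d))) ^ (1 / 2 : ℝ) := by
      conv_lhs => rw [twistCost, h2, lintegral_map hN measurable_fst]
    rw [h3]
    exact rpow_half_lintegral_const_mul_le hq h1
  · refine le_trans (ENNReal.rpow_le_rpow ?_ (by norm_num)) herr
    have hlaw : (ρ.prod (noise d)).map (fun q => stepO lam γ q.1.2 q.2.1) = ν := by
      have h1 : (ρ.map Prod.snd).prod ((noise d).map Prod.fst) =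
          (ρ.prod (noise d)).map (Prod.map Prod.snd Prod.fst) :=
        Measure.map_prod_map _ _ measurable_snd measurable_fst
      have h2 : (noise d).map Prod.fst = stdGaussian (E d) := by
        rw [← Measure.fst, Measure.fst_prod]
      rw [hρ, h2] at h1
      conv_rhs => rw [← hO, h1]
      rw [Measure.map_map (continuous_stepO lam γ).measurable
        (measurable_snd.prodMap measurable_fst)]
      rfl
    conv_rhs => rw [← hlaw]
    rw [lintegral_map (by fun_prop) hs2]
    refine lintegral_mono fun q => ENNReal.ofReal_le_ofReal ?_
    refine (twistForm_le hM hβ _ _).trans ?_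
    have hexp : Real.exp (-(lam * γ) / 2) ≤ 1 :=
      Real.exp_le_one_iff.2 (by have := mul_pos hlam hγ0; linarith)
    simp only [he, scaleVel, Prod.fst_sub, Prod.snd_sub, norm_smul, Real.norm_eq_abs, Real.abs_exp]
    gcongr
    exact mul_le_of_le_one_left (norm_nonneg _) hexp

end CoupledChain

/-! ### The non-asymptotic bound -/

section Convergence

variable {d : ℕ} {m L l H lam γ : ℝ} {u : E d → ℝ}

/-- Geometric decay of the twisted cost along the coupled chains, up to the accumulated error. -/
lemma exists_isCoupling_twistCost_le {β A q δ D : ℝ} {b : E d → E d} {Φ : Phase d → Phase d}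
    {ν μ₀ : Measure (Phase d)} [IsProbabilityMeasure ν] [IsProbabilityMeasure μ₀]
    (hb : Continuous b) (hΦ : Measurable Φ) (hΦν : ν.map Φ = ν)
    (hO : (ν.prod (stdGaussian (E d))).map (fun q => stepO lam γ q.1 q.2) = ν)
    (hq : 0 ≤ q) (hδ : 0 ≤ δ) (hD : 0 ≤ D) (hqD : q * D + δ ≤ D)
    (hstep : ∀ ρ : Measure (Phase d × Phase d), IsProbabilityMeasure ρ → ρ.map Prod.snd = ν →
      twistCost β A ((ρ.prod (noise d)).map (coupledStep b Φ lam γ)) ≤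
        ENNReal.ofReal q * twistCost β A ρ + ENNReal.ofReal δ)
    {ρ₀ : Measure (Phase d × Phase d)} (hρ₀ : IsCoupling ρ₀ μ₀ ν) (n : ℕ) :
    ∃ ρ, IsCoupling ρ (obaboLaw b lam γ μ₀ n) ν ∧
      twistCost β A ρ ≤ ENNReal.ofReal (q ^ n) * twistCost β A ρ₀ + ENNReal.ofReal D := by
  induction n with
  | zero => exact ⟨ρ₀, hρ₀, by simp⟩
  | succ n ih =>
    obtain ⟨ρ, hρ, hcost⟩ := ih
    have := isProbabilityMeasure_obaboLaw (lam := lam) (γ := γ) (μ₀ := μ₀) hb n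
    refine ⟨_, isCoupling_coupledStep hb hΦ hΦν hO hρ, ?_⟩
    calc _ ≤ ENNReal.ofReal q * twistCost β A ρ + ENNReal.ofReal δ :=
          hstep ρ hρ.isProbabilityMeasure hρ.2
      _ ≤ ENNReal.ofReal q * (ENNReal.ofReal (q ^ n) * twistCost β A ρ₀ + ENNReal.ofReal D) +
          ENNReal.ofReal δ := by gcongr
      _ = ENNReal.ofReal (q ^ (n + 1)) * twistCost β A ρ₀ + ENNReal.ofReal (q * D + δ) := by
          rw [mul_add, ← mul_assoc, ← ENNReal.ofReal_mul hq, ← ENNReal.ofReal_mul hq, pow_succ',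
            ENNReal.ofReal_add (by positivity) hδ, add_assoc]
      _ ≤ _ := by gcongr

/-- The equivalence of norms is used at both ends for the initial distance, giving √(24/7 · 3/2) ≤
3, but only once for the error, giving √(24/7) ≤ 2; each carries a single √M. -/
lemma W2_le_of_twistCost_le {β M Q D : ℝ} (hM : 1 ≤ M) (hβ : β ^ 2 ≤ 1 / (4 * M)) (hQ : 0 < Q)
    (hD : 0 ≤ D) {μ₀ μ ν : Measure (Phase d)}
    (h : ∀ ρ₀, IsCoupling ρ₀ μ₀ ν → ∃ ρ, IsCoupling ρ μ ν ∧ twistCost β (2 / (3 * M)) ρ ≤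
      ENNReal.ofReal Q * twistCost β (2 / (3 * M)) ρ₀ + ENNReal.ofReal D) :
    W2 phaseSqDist μ ν ≤ ENNReal.ofReal (3 * √M * Q) * W2 phaseSqDist μ₀ ν +
      ENNReal.ofReal (2 * √M * D) := by
  have hM0 : 0 < √M := Real.sqrt_pos.2 (by linarith)
  refine le_mul_W2_add _ (ENNReal.ofReal_pos.2 (by positivity)).ne' ENNReal.ofReal_ne_top
    fun ρ₀ hρ₀ => ?_
  obtain ⟨ρ, hρ, hcost⟩ := h ρ₀ hρ₀
  set J := (∫⁻ p, ENNReal.ofReal (phaseSqDist p.1 p.2) ∂ρ₀) ^ (1 / 2 : ℝ)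
  have e1 : √(24 / 7 * M) = √(24 / 7) * √M := Real.sqrt_mul (by norm_num) _
  have e2 : √(24 / 7) * √(3 / 2) ≤ 3 := by
    rw [← Real.sqrt_mul (by norm_num)]
    exact Real.sqrt_le_iff.2 ⟨by norm_num, by norm_num⟩
  have e3 : √(24 / 7) ≤ 2 := Real.sqrt_le_iff.2 ⟨by norm_num, by norm_num⟩
  calc W2 phaseSqDist μ ν ≤ _ := W2_le_of_isCoupling _ hρ
    _ ≤ ENNReal.ofReal √(24 / 7 * M) * twistCost β (2 / (3 * M)) ρ := le_twistCost hM hβ ρ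
    _ ≤ ENNReal.ofReal √(24 / 7 * M) *
        (ENNReal.ofReal Q * (ENNReal.ofReal √(3 / 2) * J) + ENNReal.ofReal D) := by
        gcongr
        refine hcost.trans ?_
        gcongr
        exact twistCost_le hM hβ ρ₀
    _ = ENNReal.ofReal (√(24 / 7) * √(3 / 2) * √M * Q) * J +
        ENNReal.ofReal (√(24 / 7) * √M * D) := by
        rw [e1, mul_add, ← mul_assoc, ← mul_assoc, ← ENNReal.ofReal_mul (by positivity),
          ← ENNReal.ofReal_mul (by positivity), ← ENNReal.ofReal_mul (by positivity)]
        congr 3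
        ring
    _ ≤ _ := by gcongr

/-- Numerical consequences of admissibility. -/
structure StepBounds (m M lam γ : ℝ) : Prop where
  lam_pos : 0 < lam
  lip_ge : 1 ≤ M
  friction_pos : 0 < γ
  friction_sq_ge : 4 * M ≤ γ ^ 2
  lam_le : lam ≤ m / (33 * γ ^ 3)
  lam_le_one : lam ≤ 1
  lam_mul_friction_le : lam * γ ≤ 2
  lam_mul_lip_le : lam * M ≤ 2 * (1 + m)
  rate_le : m / (3 * γ) * lam ≤ 1 / 2

lemma Admissible.stepBounds (hm : 0 < m) (h : Admissible m L l u lam γ)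
    (hM : 2 * m ≤ tamedLip m L l u lam) : StepBounds m (tamedLip m L l u lam) lam γ := by
  have hM1 := h.lip_ge
  have hf := h.friction_ge
  have hlam := h.lam_pos
  have hle := h.lam_le
  set M := tamedLip m L l u lam
  have hs : 1 ≤ √M := Real.one_le_sqrt.2 hM1
  have hγ2 : 2 ≤ γ := by linarith
  have hγ0 : 0 < γ := by linarith
  have hsq : 4 * M ≤ γ ^ 2 := by
    calc 4 * M = (2 * √M) ^ 2 := by rw [mul_pow, Real.sq_sqrt (by linarith)]; norm_num
      _ ≤ γ ^ 2 := by gcongr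
  rw [le_div_iff₀ (by positivity)] at hle
  -- Here m ≤ M/2 ≤ γ²/8, so 33 λγ³ ≤ m makes λγ small independently of m.
  have h1 : 33 * (lam * γ) * γ ^ 2 ≤ 1 / 8 * γ ^ 2 := by nlinarith
  have h2 : 33 * (lam * γ) ≤ 1 / 8 := le_of_mul_le_mul_right h1 (by positivity)
  have h3 : lam * 2 ≤ lam * γ := by gcongr
  have h4 : lam * (4 * M) ≤ lam * γ ^ 2 := by gcongr
  have h5 : lam * γ ^ 2 * 2 ≤ lam * γ ^ 2 * γ := by gcongr
  refine ⟨hlam, hM1, hγ0, hsq, h.lam_le, by linarith, by linarith, by nlinarith, ?_⟩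
  rw [div_mul_eq_mul_div, div_le_iff₀ (by positivity)]
  have h6 : m * lam ≤ γ ^ 2 / 8 * lam := by gcongr; linarith
  nlinarith

lemma lintegral_error_le {f g : Phase d → Phase d} {ν : Measure (Phase d)} {C K : ℝ} {k : ℕ}
    (hd : 1 ≤ d) (hK : 0 ≤ K)
    (h1 : ∀ z, ‖(f z).1 - (g z).1‖ ≤ lam ^ 2 * (C * (1 + ‖z.1‖ + ‖z.2‖) ^ k))
    (h2 : ∀ z, ‖(f z).2 - (g z).2‖ ≤ lam ^ 2 * (C * (1 + ‖z.1‖ + ‖z.2‖) ^ k))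
    (hmom : ∫⁻ z, ENNReal.ofReal ((1 + ‖z.1‖ + ‖z.2‖) ^ (2 * k)) ∂ν ≤
      ENNReal.ofReal (K * (d : ℝ) ^ k)) :
    (∫⁻ z, ENNReal.ofReal (3 / 2 * (‖(f z).1 - (g z).1‖ ^ 2 + ‖(f z).2 - (g z).2‖ ^ 2)) ∂ν) ^
      (1 / 2 : ℝ) ≤ ENNReal.ofReal (lam ^ 2 * (√(3 * C ^ 2 * K) * (d : ℝ) ^ k)) := by
  have hd1 : (1 : ℝ) ≤ d := by exact_mod_cast hd
  refine (rpow_half_lintegral_const_mul_le (c := 3 * (lam ^ 2 * C) ^ 2)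
    (g := fun z : Phase d => (1 + ‖z.1‖ + ‖z.2‖) ^ (2 * k)) (by positivity) fun z => ?_).trans ?_
  · have e1 := pow_le_pow_left₀ (norm_nonneg _) (h1 z) 2
    have e2 := pow_le_pow_left₀ (norm_nonneg _) (h2 z) 2
    have e3 : (lam ^ 2 * (C * (1 + ‖z.1‖ + ‖z.2‖) ^ k)) ^ 2 =
        (lam ^ 2 * C) ^ 2 * (1 + ‖z.1‖ + ‖z.2‖) ^ (2 * k) := by
      rw [← mul_assoc, mul_pow, ← pow_mul, mul_comm k]
    rw [e3] at e1 e2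
    linarith
  · calc _ ≤ ENNReal.ofReal √(3 * (lam ^ 2 * C) ^ 2) *
          (ENNReal.ofReal (K * (d : ℝ) ^ k)) ^ (1 / 2 : ℝ) := by gcongr
      _ = ENNReal.ofReal √(3 * (lam ^ 2 * C) ^ 2 * (K * (d : ℝ) ^ k)) := by
          rw [ENNReal.ofReal_rpow_of_nonneg (by positivity) (by norm_num), ← Real.sqrt_eq_rpow,
            ← ENNReal.ofReal_mul (by positivity), ← Real.sqrt_mul (by positivity)]
      _ ≤ _ := by
          refine ENNReal.ofReal_le_ofReal (Real.sqrt_le_iff.2 ⟨by positivity, ?_⟩)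
          rw [mul_pow (lam ^ 2) C, mul_pow (lam ^ 2), mul_pow √_, Real.sq_sqrt (by positivity)]
          -- The root of d^k is bounded crudely by d^k, which keeps the exponent a natural number.
          have : (d : ℝ) ^ k ≤ ((d : ℝ) ^ k) ^ 2 := le_self_pow₀ (one_le_pow₀ hd1) two_ne_zero
          calc _ = (lam ^ 2) ^ 2 * (3 * C ^ 2 * K) * (d : ℝ) ^ k := by ring
            _ ≤ (lam ^ 2) ^ 2 * (3 * C ^ 2 * K) * ((d : ℝ) ^ k) ^ 2 := by gcongr
            _ = _ := by ring

/-- Non-asymptotic convergence bound with an error of order `√M λγ`. -/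
theorem exists_W2_phase_le (hm : 0 < m) (hL : 0 < L) (hl : 0 < l) (hH : 0 ≤ H) :
    ∃ (K : ℝ) (p : ℕ), 0 < K ∧ ∀ (d : ℕ), 1 ≤ d → ∀ u : E d → ℝ, PotentialAssumptions m L l u →
      ‖∇ u 0‖ ≤ H → ∀ μ₀ : Measure (Phase d), IsProbabilityMeasure μ₀ → ∀ lam γ : ℝ,
      Admissible m L l u lam γ → ∀ n : ℕ,
      W2 phaseSqDist (tamedLaw m L l u lam γ μ₀ n) (targetPhase u) ≤
        ENNReal.ofReal (3 * √(tamedLip m L l u lam) * (1 - m / (3 * γ) * lam) ^ ((n : ℝ) / 2)) *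
          W2 phaseSqDist μ₀ (targetPhase u) +
        ENNReal.ofReal (K * (d : ℝ) ^ p * √(tamedLip m L l u lam) * (lam * γ / m)) := by
  obtain ⟨C, k, hC, hlocal⟩ := exists_local_error hm hL hl hH
    (show (1 : ℝ) ≤ 1 + m by linarith)
  obtain ⟨K, hK, hmom⟩ := exists_moment_bound hm H k
  refine ⟨12 * √(3 * C ^ 2 * K), k, by positivity, fun d hd u hu hu0 μ₀ hμ₀ lam γ hadm n => ?_⟩
  have hdrift := (driftBounds_tamedDrift hd hm hl hu hadm.radius_ge
    (exists_lipschitzWith_of_lipConst_pos (zero_lt_one.trans_le hadm.lip_ge))).1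
  have hsb := hadm.stepBounds hm hdrift.two_mul_le
  have hbc := continuous_of_norm_sub_le hdrift.lipschitz
  have hprob := isProbabilityMeasure_targetPhase hm hu
  have hlam := hsb.lam_pos
  have hγ := hsb.friction_pos
  have hM1 := hsb.lip_ge
  obtain ⟨Φ, hΦ, hΦν, hcurve⟩ := exists_hamiltonian_flow hm hL.le hl.le hu hlam.le
  have hO := map_stepO_targetPhase (lam := lam) (γ := γ) hm hu (by positivity)
  have herr : ∀ z, _ ∧ _ := fun z => by
    obtain ⟨ζ, h0, h1, h2, h3⟩ := hcurve z
    have := hlocal d u hu hu0 lam _ hlam hsb.lam_le_one hadm.radius_ge hsb.lam_mul_lip_le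
      hdrift.lipschitz ζ h2 (by rwa [h0])
    rw [h0, h1] at this
    exact this
  have hδ := lintegral_error_le hd hK.le (fun z => (herr z).1) (fun z => (herr z).2)
    (hmom d hd L l u hu hu0)
  set c := √(3 * C ^ 2 * K) * (d : ℝ) ^ k with hc
  have hc0 : 0 ≤ c := by positivity
  have hβ := twistCoeff_div_sq_le hlam hγ (zero_lt_one.trans_le hM1) hsb.friction_sq_ge
    hsb.lam_mul_friction_le
  have hs0 : 0 < m / (3 * γ) * lam := by positivity
  set s := m / (3 * γ) * lam with hs
  have hs1 : s ≤ 1 / 2 := hsb.rate_le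
  -- The cost is the root of the quadratic form, so it contracts by √(1 - s) ≤ 1 - s/2. Hence D =
  -- 2δ/s with δ = λ²c satisfies √(1 - s) D + δ ≤ D, and λ²/s = 3λγ/m.
  have hq1 : √(1 - s) ≤ 1 - s / 2 :=
    Real.sqrt_le_iff.2 ⟨by linarith, by nlinarith [sq_nonneg s]⟩
  have hD : 2 * (lam ^ 2 * c) / s = 6 * c * (lam * γ / m) := by
    rw [hs]; field_simp; ring
  have hqD : √(1 - s) * (2 * (lam ^ 2 * c) / s) + lam ^ 2 * c ≤ 2 * (lam ^ 2 * c) / s := by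
    calc _ ≤ (1 - s / 2) * (2 * (lam ^ 2 * c) / s) + lam ^ 2 * c := by gcongr
      _ = _ := by field_simp; ring
  have hmain := W2_le_of_twistCost_le (μ := tamedLaw m L l u lam γ μ₀ n) (Q := √(1 - s) ^ n)
    hM1 hβ (pow_pos (Real.sqrt_pos.2 (by linarith)) n)
    (D := 2 * (lam ^ 2 * c) / s) (by positivity) fun ρ₀ hρ₀ =>
      exists_isCoupling_twistCost_le hbc hΦ hΦν hO (Real.sqrt_nonneg _)
        (δ := lam ^ 2 * c) (by positivity) (by positivity) hqD
        (fun ρ hρ hρν => twistCost_coupledStep_le hdrift hbc hΦ hM1 hlam hm hγ hsb.friction_sq_ge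
          hsb.lam_le hsb.lam_mul_friction_le (by linarith) hO hδ hρν) hρ₀ n
  have e1 : √(1 - s) ^ n = (1 - s) ^ ((n : ℝ) / 2) := by
    rw [Real.sqrt_eq_rpow, ← Real.rpow_natCast, ← Real.rpow_mul (by linarith)]
    congr 1; ring
  rw [e1, hD] at hmain
  refine hmain.trans (le_of_eq ?_)
  congr 2
  rw [hc]; ring

/-- The product coupling has finite cost by second moments. Finiteness is what lets the geometric
factor make the initial term small in (ii). -/
lemma W2_targetPhase_lt_top (hm : 0 < m) (hd : 1 ≤ d) (hu : PotentialAssumptions m L l u)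
    {μ₀ : Measure (Phase d)} [IsProbabilityMeasure μ₀] (hμ₀ : AllMoments μ₀) :
    W2 phaseSqDist μ₀ (targetPhase u) < ⊤ := by
  have hprob := isProbabilityMeasure_targetPhase hm hu
  obtain ⟨K, hK, hmom⟩ := exists_moment_bound hm ‖∇ u 0‖ 1
  have h1 := hmom d hd L l u hu le_rfl
  have hc : IsCoupling (μ₀.prod (targetPhase u)) μ₀ (targetPhase u) := by
    constructor
    · rw [← Measure.fst, Measure.fst_prod]
    · rw [← Measure.snd, Measure.snd_prod]
  refine (W2_le_of_isCoupling _ hc).trans_lt (ENNReal.rpow_lt_top_of_nonneg (by norm_num) ?_)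
  have hfst : Measurable fun z : Phase d => ENNReal.ofReal (2 * (‖z.1‖ ^ 2 + ‖z.2‖ ^ 2)) := by
    fun_prop
  have hsnd : Measurable fun z : Phase d =>
      ENNReal.ofReal (4 * (1 + ‖z.1‖ + ‖z.2‖) ^ (2 * 1)) := by fun_prop
  have hle : ∫⁻ p, ENNReal.ofReal (phaseSqDist p.1 p.2) ∂(μ₀.prod (targetPhase u)) ≤
      ∫⁻ p, (ENNReal.ofReal (2 * (‖p.1.1‖ ^ 2 + ‖p.1.2‖ ^ 2)) +
        ENNReal.ofReal (4 * (1 + ‖p.2.1‖ + ‖p.2.2‖) ^ (2 * 1))) ∂(μ₀.prod (targetPhase u)) := by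
    refine lintegral_mono fun p => ?_
    rw [← ENNReal.ofReal_add (by positivity) (by positivity)]
    refine ENNReal.ofReal_le_ofReal ?_
    have hs : ∀ x y : E d, ‖x - y‖ ^ 2 ≤ 2 * ‖x‖ ^ 2 + 2 * ‖y‖ ^ 2 := fun x y => by
      have := pow_le_pow_left₀ (norm_nonneg _) (norm_sub_le x y) 2
      linarith [sq_nonneg (‖x‖ - ‖y‖)]
    have a1 := hs p.1.1 p.2.1
    have a2 := hs p.1.2 p.2.2
    have a3 : (1 + ‖p.2.1‖ + ‖p.2.2‖) ^ (2 * 1) = (1 + ‖p.2.1‖ + ‖p.2.2‖) ^ 2 := by norm_num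
    have := norm_nonneg p.2.1
    have := norm_nonneg p.2.2
    rw [a3]
    unfold phaseSqDist
    nlinarith [mul_nonneg (norm_nonneg p.2.1) (norm_nonneg p.2.2)]
  refine (hle.trans_lt ?_).ne
  rw [lintegral_add_left (by exact hfst.comp measurable_fst)]
  refine ENNReal.add_lt_top.2 ⟨?_, ?_⟩
  · have e := lintegral_map (μ := μ₀.prod (targetPhase u)) hfst measurable_fst
    rw [← Measure.fst, Measure.fst_prod] at e
    rw [← e]
    have hi := ((hμ₀ 1).1.add (hμ₀ 1).2).const_mul 2
    exact hi.lintegral_lt_top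
  · have e := lintegral_map (μ := μ₀.prod (targetPhase u)) hsnd measurable_snd
    rw [← Measure.snd, Measure.snd_prod] at e
    rw [← e]
    simp_rw [ENNReal.ofReal_mul (show (0 : ℝ) ≤ 4 by norm_num)]
    rw [lintegral_const_mul' _ _ ENNReal.ofReal_ne_top]
    exact ENNReal.mul_lt_top ENNReal.ofReal_lt_top (h1.trans_lt ENNReal.ofReal_lt_top)

end Convergence

/-! ### Choice of parameters and iteration complexity -/

section IterationComplexity

variable {d : ℕ} {m L l lam : ℝ} {u : E d → ℝ}

lemma le_radius (hL : 0 < L) (hm : 0 < m) (hl : 0 < l) (hlam : 0 < lam) {ρ : ℝ} (hρ : 0 < ρ)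
    (h : √lam ≤ ((L + m) / ρ) ^ (l + 2)) : ρ ≤ radius m L l lam := by
  have h0 : 0 < √lam := Real.sqrt_pos.2 hlam
  have h1 : ρ ^ (l + 2) ≤ radius m L l lam ^ (l + 2) := by
    rw [radius_rpow hL hm hl hlam, le_div_iff₀ h0]
    rw [Real.div_rpow (by positivity) hρ.le, le_div_iff₀ (by positivity)] at h
    linarith
  exact (Real.rpow_le_rpow_iff hρ.le (by unfold radius; positivity) (by positivity)).1 h1

/-- By (1 - s)^x ≤ exp(-s x) ≤ ε²/B. Of the two powers of ε, one is the accuracy and the other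
absorbs the prefactor S, allowed to grow up to order 1/ε. -/
lemma mul_rpow_mul_le {s ε S W B x : ℝ} (hε : 0 < ε) (hs : s ≤ 1) (hx : 0 ≤ x)
    (hB : 0 < B) (hS : 6 * S * W ≤ B / ε) (hSW : 0 ≤ S * W)
    (hn : Real.log B + 2 * Real.log (1 / ε) ≤ s * x) :
    3 * S * (1 - s) ^ x * W ≤ ε / 2 := by
  have h1 : (1 - s) ^ x ≤ ε ^ 2 / B := by
    calc (1 - s) ^ x ≤ Real.exp (-s) ^ x := by
          have := Real.add_one_le_exp (-s)
          have h0 : 0 ≤ 1 - s := by linarith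
          gcongr
          linarith
      _ = Real.exp (-(s * x)) := by rw [← Real.exp_mul]; ring_nf
      _ ≤ Real.exp (-(Real.log B + 2 * Real.log (1 / ε))) := by gcongr
      _ = ε ^ 2 / B := by
          rw [one_div, Real.log_inv, neg_add, Real.exp_add, Real.exp_neg, Real.exp_log hB,
            show -(2 * -Real.log ε) = Real.log ε + Real.log ε by ring, Real.exp_add,
            Real.exp_log hε]
          field_simp
  calc 3 * S * (1 - s) ^ x * W = 3 * (S * W) * (1 - s) ^ x := by ring
    _ ≤ 3 * (S * W) * (ε ^ 2 / B) := by gcongr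
    _ = 6 * S * W * (ε ^ 2 / (2 * B)) := by field_simp; ring
    _ ≤ B / ε * (ε ^ 2 / (2 * B)) := by gcongr
    _ = ε / 2 := by field_simp

/-- The minimal friction is admissible for small step sizes. -/
lemma exists_admissible (hd : 1 ≤ d) (hm : 0 < m) (hL : 0 < L) (hl : 0 < l)
    (hu : PotentialAssumptions m L l u) : ∃ C c : ℝ, 0 < C ∧ 0 < c ∧ ∀ lam, 0 < lam → lam ≤ c →
      Admissible m L l u lam (2 * √(tamedLip m L l u lam)) ∧ tamedLip m L l u lam ≤ C / √lam := by
  obtain ⟨C, hC, hlip⟩ := exists_tamedLip_le hm hL hl hu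
  -- A radius at least ρ gives both r ≥ 2 and m r² ≥ 1, hence M ≥ 1.
  set ρ := max 2 (1 / √m) with hρ
  have hρ2 : 2 ≤ ρ := le_max_left _ _
  have hρ0 : 0 < ρ := by linarith
  have hsm : 0 < √m := Real.sqrt_pos.2 hm
  have hρm : 1 ≤ m * ρ ^ 2 := by
    have h1 : (1 / √m) ^ 2 ≤ ρ ^ 2 := by gcongr; exact le_max_right _ _
    rw [div_pow, Real.sq_sqrt hm.le, one_pow, div_le_iff₀ hm] at h1
    linarith
  set b := ((L + m) / ρ) ^ (l + 2) with hb
  have hb0 : 0 < b := by positivity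
  -- The second threshold is the fourth power of λ · 33 · (2√M)³ ≤ m: the left side becomes 33⁴ ·
  -- 4096 · λ(M²λ)³ with M²λ ≤ C².
  refine ⟨C, min (b ^ 2) (m ^ 4 / (33 ^ 4 * 4096 * C ^ 6)), hC, by positivity,
    fun lam hlam hle => ?_⟩
  have hle1 : √lam ≤ b := Real.sqrt_le_iff.2 ⟨hb0.le, hle.trans (min_le_left _ _)⟩
  have hle2 := hle.trans (min_le_right _ _)
  have hrad : ρ ≤ radius m L l lam := le_radius hL hm hl hlam hρ0 hle1
  have hr2 : 2 ≤ radius m L l lam := hρ2.trans hrad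
  obtain ⟨hex, hM⟩ := hlip lam hlam hr2
  have hM1 : 1 ≤ tamedLip m L l u lam := by
    refine (hρm.trans ?_).trans (mul_radius_sq_le_tamedLip hd hm hl hu hr2 hex)
    gcongr
  set M := tamedLip m L l u lam
  have hM0 : 0 < √M := Real.sqrt_pos.2 (by linarith)
  refine ⟨⟨hlam, hr2, hM1, le_rfl, ?_⟩, hM⟩
  rw [le_div_iff₀ (by positivity)]
  refine le_of_pow_le_pow_left₀ (n := 4) (by norm_num) hm.le ?_
  rw [le_div_iff₀ (by positivity)] at hle2
  have hM2 : M ^ 2 * lam ≤ C ^ 2 := by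
    have h1 : M * √lam ≤ C := (le_div_iff₀ (Real.sqrt_pos.2 hlam)).1 hM
    calc M ^ 2 * lam = (M * √lam) ^ 2 := by rw [mul_pow, Real.sq_sqrt hlam.le]
      _ ≤ C ^ 2 := by gcongr
  have hM6 : (M ^ 2 * lam) ^ 3 ≤ (C ^ 2) ^ 3 := by gcongr
  calc (lam * (33 * (2 * √M) ^ 3)) ^ 4 = 33 ^ 4 * 4096 * (lam * ((√M ^ 2) ^ 2 * lam) ^ 3) := by ring
    _ = 33 ^ 4 * 4096 * (lam * (M ^ 2 * lam) ^ 3) := by rw [Real.sq_sqrt (by linarith)]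
    _ ≤ 33 ^ 4 * 4096 * (lam * (C ^ 2) ^ 3) := by gcongr
    _ = lam * (33 ^ 4 * 4096 * C ^ 6) := by ring
    _ ≤ m ^ 4 := hle2

/-- Iteration complexity of order `ε ^ (-5/2) log (1/ε)`. -/
theorem exists_iteration_complexity (hm : 0 < m) (hL : 0 < L) (hl : 0 < l) (hd : 1 ≤ d)
    (hu : PotentialAssumptions m L l u) {μ₀ : Measure (Phase d)} (hμ : IsProbabilityMeasure μ₀)
    (hμ₀ : AllMoments μ₀) :
    ∃ A : ℝ, 0 < A ∧ ∀ ε : ℝ, 0 < ε → ε ≤ 1 / 2 → ∃ lam γ : ℝ, Admissible m L l u lam γ ∧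
      ∀ n : ℕ, A * (Real.log (1 / ε) / ε ^ (5 / 2 : ℝ)) ≤ (n : ℝ) →
        W2 phaseSqDist (tamedLaw m L l u lam γ μ₀ n) (targetPhase u) ≤ ENNReal.ofReal ε := by
  obtain ⟨K, p, hK, hbound⟩ := exists_W2_phase_le (H := ‖∇ u 0‖) hm hL hl (norm_nonneg _)
  obtain ⟨C, c₀, hC, hc₀, hadm⟩ := exists_admissible hd hm hL hl hu
  set K' := K * (d : ℝ) ^ p with hK'
  have hd0 : (0 : ℝ) < d := by exact_mod_cast hd
  have hK'0 : 0 < K' := by positivity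
  -- The step is λ = (tε)², so √λ = tε and M ≤ C/(tε). With γ = 2√M the error 2K'λM/m is at most
  -- 2K'Ctε/m, which is ε/2 or less once 4K'Ct ≤ m.
  set t := min √c₀ (m / (4 * K' * C)) with ht
  have ht0 : 0 < t := lt_min (Real.sqrt_pos.2 hc₀) (by positivity)
  have htc : t ^ 2 ≤ c₀ := by
    calc t ^ 2 ≤ √c₀ ^ 2 := by gcongr; exact min_le_left _ _
      _ = c₀ := Real.sq_sqrt hc₀.le
  have htK : t * (4 * K' * C) ≤ m := (le_div_iff₀ (by positivity)).1 (min_le_right _ _)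
  have hWtop := W2_targetPhase_lt_top (L := L) (l := l) hm hd hu hμ₀
  set W := (W2 phaseSqDist μ₀ (targetPhase u)).toReal with hW
  have hW0 : 0 ≤ W := ENNReal.toReal_nonneg
  -- This bounds √M √ε, so the prefactor of the initial distance is of order ε^(-1/2).
  set a := √(C / t) with ha
  have ha0 : 0 < a := Real.sqrt_pos.2 (by positivity)
  set B := 6 * a * W + 1 with hB
  have hB1 : 1 ≤ B := le_add_of_nonneg_left (by positivity)
  have hlog2 : 0 < Real.log 2 := Real.log_pos (by norm_num)
  have hlogB : 0 ≤ Real.log B := Real.log_nonneg hB1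
  -- The exponent of decay is mλn/(12√M) ≥ m t² ε^(5/2) n/(12a). The constant log B is absorbed
  -- using log(1/ε) ≥ log 2, which is where ε ≤ 1/2 enters.
  refine ⟨12 * a / (m * t ^ 2) * (Real.log B / Real.log 2 + 2), by positivity,
    fun ε hε hε2 => ?_⟩
  have hlam0 : 0 < (t * ε) ^ 2 := by positivity
  have hsl : √((t * ε) ^ 2) = t * ε := Real.sqrt_sq (by positivity)
  have hlamc : (t * ε) ^ 2 ≤ c₀ := by
    refine le_trans ?_ htc
    gcongr
    exact mul_le_of_le_one_right ht0.le (by linarith)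
  obtain ⟨hA, hMC⟩ := hadm _ hlam0 hlamc
  refine ⟨_, _, hA, fun n hn => ?_⟩
  have hM1 := hA.lip_ge
  have hw := hbound d hd u hu le_rfl μ₀ hμ _ _ hA n
  rw [hsl] at hMC
  set lam := (t * ε) ^ 2 with hlam
  set M := tamedLip m L l u lam
  set S := √M with hS
  have hS1 : 1 ≤ S := Real.one_le_sqrt.2 hM1
  have hS2 : S ^ 2 = M := Real.sq_sqrt (by linarith)
  have hMa : M * ε ≤ C / t := by
    rw [le_div_iff₀ (by positivity)] at hMC
    rw [le_div_iff₀ ht0]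
    linarith
  have hSa : S * √ε ≤ a := by
    rw [ha, hS, ← Real.sqrt_mul (by linarith)]
    exact Real.sqrt_le_sqrt hMa
  have hlogε : Real.log 2 ≤ Real.log (1 / ε) := by
    refine Real.log_le_log (by norm_num) ?_
    rw [le_div_iff₀ hε]; linarith
  have herr : K' * S * (lam * (2 * S) / m) ≤ ε / 2 := by
    have h1 : K' * S * (lam * (2 * S) / m) = 2 * K' * t ^ 2 * ε * (M * ε) / m := by
      rw [← hS2, hlam]; ring
    rw [h1, div_le_iff₀ hm]
    calc 2 * K' * t ^ 2 * ε * (M * ε) ≤ 2 * K' * t ^ 2 * ε * (C / t) := by gcongr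
      _ = ε / 2 * (t * (4 * K' * C)) := by field_simp; ring
      _ ≤ ε / 2 * m := by gcongr
  have hsε : ε ≤ √ε := Real.le_sqrt_of_sq_le (by nlinarith)
  have hSB : 6 * S * W ≤ B / ε := by
    rw [le_div_iff₀ hε]
    calc 6 * S * W * ε ≤ 6 * S * W * √ε := by gcongr
      _ = 6 * (S * √ε) * W := by ring
      _ ≤ 6 * a * W := by gcongr
      _ ≤ B := by linarith
  have hrate : Real.log B + 2 * Real.log (1 / ε) ≤ m / (3 * (2 * S)) * lam * ((n : ℝ) / 2) := by
    have h52 : ε ^ (5 / 2 : ℝ) = ε ^ 2 * √ε := by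
      rw [Real.sqrt_eq_rpow, ← Real.rpow_natCast, ← Real.rpow_add hε]; norm_num
    have hsq : 0 < √ε := Real.sqrt_pos.2 hε
    have h1 : m * t ^ 2 * (ε ^ 2 * √ε) / (12 * a) ≤ m / (3 * (2 * S)) * lam / 2 := by
      rw [hlam, div_le_iff₀ (by positivity)]
      calc m * t ^ 2 * (ε ^ 2 * √ε) = m / (12 * S) * (t ^ 2 * ε ^ 2) * 12 * (S * √ε) := by
            field_simp
        _ ≤ m / (12 * S) * (t ^ 2 * ε ^ 2) * 12 * a := by gcongr
        _ = _ := by field_simp; ring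
    have h2 : Real.log B ≤ Real.log B / Real.log 2 * Real.log (1 / ε) := by
      rw [div_mul_eq_mul_div, le_div_iff₀ hlog2]
      gcongr
    calc Real.log B + 2 * Real.log (1 / ε)
        ≤ (Real.log B / Real.log 2 + 2) * Real.log (1 / ε) := by rw [add_mul]; gcongr
      _ = m * t ^ 2 * (ε ^ 2 * √ε) / (12 * a) * (12 * a / (m * t ^ 2) *
          (Real.log B / Real.log 2 + 2) * (Real.log (1 / ε) / ε ^ (5 / 2 : ℝ))) := by
          rw [h52]; field_simp
      _ ≤ m * t ^ 2 * (ε ^ 2 * √ε) / (12 * a) * n := by gcongr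
      _ ≤ m / (3 * (2 * S)) * lam / 2 * n := by gcongr
      _ = _ := by ring
  have hdrift := (driftBounds_tamedDrift hd hm hl hu hA.radius_ge
    (exists_lipschitzWith_of_lipConst_pos (zero_lt_one.trans_le hM1))).1
  have hs1 := (hA.stepBounds hm hdrift.two_mul_le).rate_le
  have hfirst := mul_rpow_mul_le hε (hs1.trans (by norm_num)) (by positivity : (0 : ℝ) ≤ n / 2)
    (by linarith) hSB (by positivity) hrate
  rw [← ENNReal.ofReal_toReal hWtop.ne] at hw
  refine hw.trans ?_
  have hpow : 0 ≤ (1 - m / (3 * (2 * S)) * lam) ^ ((n : ℝ) / 2) :=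
    Real.rpow_nonneg (by linarith) _
  rw [← ENNReal.ofReal_mul (by positivity), ← ENNReal.ofReal_add (by positivity) (by positivity)]
  exact ENNReal.ofReal_le_ofReal (by linarith)

end IterationComplexity

end TamedOBABO

end

theorem mainTheorem7 (m L l : ℝ) (hm : 0 < m) (hL : 0 < L) (hl : 0 < l) :
    (∀ H : ℝ, 0 ≤ H → ∃ (K : ℝ) (p : ℕ), 0 < K ∧
      ∀ (d : ℕ), 1 ≤ d → ∀ (u : TamedOBABO.E d → ℝ),
      TamedOBABO.PotentialAssumptions m L l u → ‖gradient u 0‖ ≤ H →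
      ∀ (μ₀ : MeasureTheory.Measure (TamedOBABO.Phase d)),
      MeasureTheory.IsProbabilityMeasure μ₀ → TamedOBABO.AllMoments μ₀ →
      ∀ (lam γ : ℝ), TamedOBABO.Admissible m L l u lam γ →
      ∀ n : ℕ,
        TamedOBABO.W2 TamedOBABO.posSqDist
            ((TamedOBABO.tamedLaw m L l u lam γ μ₀ n).map Prod.fst) (TamedOBABO.targetPos u)
          ≤ TamedOBABO.W2 TamedOBABO.phaseSqDist
            (TamedOBABO.tamedLaw m L l u lam γ μ₀ n) (TamedOBABO.targetPhase u) ∧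
        TamedOBABO.W2 TamedOBABO.phaseSqDist
            (TamedOBABO.tamedLaw m L l u lam γ μ₀ n) (TamedOBABO.targetPhase u)
          ≤ ENNReal.ofReal (3 * √(TamedOBABO.tamedLip m L l u lam) *
                (1 - m / (3 * γ) * lam) ^ ((n : ℝ) / 2)) *
              TamedOBABO.W2 TamedOBABO.phaseSqDist μ₀ (TamedOBABO.targetPhase u) +
            ENNReal.ofReal
              (K * (d : ℝ) ^ p * TamedOBABO.tamedLip m L l u lam * (lam * γ / m))) ∧
    (∀ (d : ℕ), 1 ≤ d → ∀ (u : TamedOBABO.E d → ℝ),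
      TamedOBABO.PotentialAssumptions m L l u →
      ∀ (μ₀ : MeasureTheory.Measure (TamedOBABO.Phase d)),
      MeasureTheory.IsProbabilityMeasure μ₀ → TamedOBABO.AllMoments μ₀ →
      ∃ A : ℝ, 0 < A ∧ ∀ ε : ℝ, 0 < ε → ε ≤ 1 / 2 →
        ∃ lam γ : ℝ, TamedOBABO.Admissible m L l u lam γ ∧
          ∀ n : ℕ, A * (Real.log (1 / ε) / ε ^ (5 / 2 : ℝ)) ≤ (n : ℝ) →
            TamedOBABO.W2 TamedOBABO.phaseSqDist
              (TamedOBABO.tamedLaw m L l u lam γ μ₀ n) (TamedOBABO.targetPhase u)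
            ≤ ENNReal.ofReal ε) := by
  refine ⟨fun H hH => ?_, fun d hd u hu μ₀ hμ hμ₀ =>
    TamedOBABO.exists_iteration_complexity hm hL hl hd hu hμ hμ₀⟩
  obtain ⟨K, p, hK, h⟩ := TamedOBABO.exists_W2_phase_le hm hL hl hH
  refine ⟨K, p, hK, fun d hd u hu hu0 μ₀ hμ _ lam γ hadm n => ⟨?_, ?_⟩⟩
  · rw [← TamedOBABO.map_fst_targetPhase hu]
    refine TamedOBABO.W2_map_le measurable_fst (fun x y => ?_)
      (by unfold TamedOBABO.posSqDist; fun_prop) _ _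
    exact le_add_of_nonneg_right (sq_nonneg _)
  · refine (h d hd u hu hu0 μ₀ hμ lam γ hadm n).trans ?_
    have hM := hadm.lip_ge
    -- The bound available has √M in the error term; M ≥ 1 weakens it to M.
    have hs : √(TamedOBABO.tamedLip m L l u lam) ≤ TamedOBABO.tamedLip m L l u lam :=
      Real.sqrt_le_iff.2 ⟨by linarith, le_self_pow₀ hM two_ne_zero⟩
    have hγ : 0 ≤ γ := le_trans (by positivity) hadm.friction_ge
    have hlam := hadm.lam_pos.le
    gcongr
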